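/- Let $K$ be a noetherian ring and let $X$ be a separated $K$-scheme which is smooth over $K$, i.e. formally smooth and of finite type. Write $X^n=X\times_K\cdots\times_K X$ ($n$ factors) and let $\Delta\colon X\to X^2$ be the diagonal embedding. For $q\ge 0$ let $\widehat{\mathcal B}_q(X)=\mathcal O_{\mathfrak X^{q+2}}$ be the structure sheaf of the formal completion $\mathfrak X^{q+2}$ of $X^{q+2}$ along the diagonal, regarded as a sheaf of rings on $X$; it is an $\mathcal O_X$-algebra by the first projection and has the augmentation $\widehat{\mathcal B}_q(X)\to\mathcal O_X$, whose kernel is denoted by $\mathcal I_q$. The $\widehat{\mathcal B}_q(X)$ form a simplicial sheaf of rings, whose $i$-th face map $\widehat{\mathcal B}_q(X)\to\widehat{\mathcal B}_{q-1}(X)$, $0\le i\le q$, is given by $a_0\otimes\cdots\otimes a_{q+1}\mapsto a_0\otimes\cdots\otimes a_ia_{i+1}\otimes\cdots\otimes a_{q+1}$. Let $\widehat{\mathcal C}_q(X)=\widehat{\mathcal B}_q(X)\otimes_{\widehat{\mathcal B}_0(X)}\mathcal O_X$, where $\widehat{\mathcal B}_0(X)=\mathcal O_{\mathfrak X^2}$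 acts on $\widehat{\mathcal B}_q(X)$ through the first and the last tensor factor, with the $\mathcal I_q$-adic topology; these are the terms of the complex $\widehat{\mathcal C}(X)$ of complete Hochschild chains, whose differential is the alternating sum of the face maps. For an $\mathcal O_X$-module $\mathcal M$ let $\mathcal Hom^{\mathrm{cont}}_{\mathcal O_X}(\widehat{\mathcal C}(X),\mathcal M)$ be the complex of $\mathcal O_X$-modules which in degree $q\ge 0$ is the sheaf of continuous $\mathcal O_X$-linear homomorphisms $\widehat{\mathcal C}_q(X)\to\mathcal M$, where $\mathcal M$ is discrete, with the differential induced by that of $\widehat{\mathcal C}(X)$. **Theorem.** For every $\mathcal O_X$-module $\mathcal M$ (not necessarily quasi-coherent) there is an isomorphism $$\mathcal Hom^{\mathrm{cont}}_{\mathcal O_X}\bigl(\widehat{\mathcal C}(X),\mathcal M\bigr)\;\cong\;\mathrm R\mathcal Hom_{\mathcal O_{X^2}}(\mathcal O_X,\mathcal M)$$ in the derived category $\mathsf D(\mathsf{Mod}\,\mathcal O_{X^2})$, functorial in $\mathcal M$. Here $\mathcal O_X$, $\mathcal M$ and the complex on the left are regarded as (complexes of) $\mathcal O_{X^2}$-modules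 by push-forward along $\Delta$, and $\mathrm R\mathcal Hom$ is the derived sheaf Hom. -/

import Mathlib

open CategoryTheory Limits AlgebraicGeometry TopologicalSpace Opposite

open scoped Topology

universe u w

noncomputable section

namespace ContHochschild

section EnoughInjectives

variable {C : Type u} [SmallCategory C] {J : GrothendieckTopology C} (R : Sheaf J RingCat.{u})

lemma ab5OfSize_presheafOfModules (R : Cᵒᵖ ⥤ RingCat.{u}) :
    AB5OfSize.{u, u} (PresheafOfModules.{u} R) where
  ofShape K _ _ := by
    have : HasExactColimitsOfShape K (Cᵒᵖ ⥤ AddCommGrpCat.{u}) := inferInstance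
    have : ReflectsFiniteLimits (PresheafOfModules.toPresheaf.{u} R) := ⟨fun J => inferInstance⟩
    exact HasExactColimitsOfShape.domain_of_functor K (PresheafOfModules.toPresheaf.{u} R)

lemma isGrothendieckAbelian_sheafOfModules :
    IsGrothendieckAbelian.{u} (SheafOfModules.{u} R) where
  ab5OfSize := ⟨fun K _ _ => by
    have := ab5OfSize_presheafOfModules R.obj
    have : HasExactColimitsOfShape K (PresheafOfModules.{u} R.obj) := inferInstance
    exact (PresheafOfModules.sheafificationAdjunction (𝟙 R.obj)).hasExactColimitsOfShape K⟩
  hasSeparator := ⟨∐ (fun X : C => (PresheafOfModules.sheafification (𝟙 R.obj)).obj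
      ((PresheafOfModules.free R.obj).obj (yoneda.obj X))), by
    apply ObjectProperty.IsSeparating.isSeparator_coproduct
    intro M N f g h
    apply (SheafOfModules.forget R).map_injective
    apply PresheafOfModules.freeYoneda.isSeparating R.obj
    rintro _ ⟨X⟩ a
    have := h _ (ObjectProperty.ofObj_apply _ X)
      (((PresheafOfModules.sheafificationAdjunction (𝟙 R.obj)).homEquiv _ _).symm a)
    apply ((PresheafOfModules.sheafificationAdjunction (𝟙 R.obj)).homEquiv _ _).symm.injective
    exact (Adjunction.homEquiv_naturality_right_symm _ a f).trans
      (this.trans (Adjunction.homEquiv_naturality_right_symm _ a g).symm)⟩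

instance (X : Scheme.{u}) : EnoughInjectives X.Modules :=
  have : IsGrothendieckAbelian.{u} X.Modules :=
    isGrothendieckAbelian_sheafOfModules X.ringCatSheaf
  inferInstance

end EnoughInjectives

section SheafHom

variable {X : Scheme.{u}}

/-- An `𝒪_X`-module whose modules of sections over affine open subsets carry topologies, for which
the restriction maps are continuous. -/
structure TopModule (X : Scheme.{u}) where
  /-- the underlying `𝒪_X`-module -/
  mod : X.Modules
  /-- the topology on the sections over an affine open subset -/
  top (V : X.affineOpens) : TopologicalSpace Γ(mod, V.1)
  continuous_res {V W : X.affineOpens} (h : W.1 ≤ V.1) :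
    Continuous[top V, top W] (mod.presheaf.map (homOfLE h).op)

/-- A morphism of topologized `𝒪_X`-modules is an `𝒪_X`-linear morphism which is continuous on the
sections over affine open subsets. -/
@[ext]
structure TopModule.Hom (N N' : TopModule X) where
  /-- the underlying morphism of `𝒪_X`-modules -/
  hom : N.mod ⟶ N'.mod
  continuous_app (V : X.affineOpens) : Continuous[N.top V, N'.top V] (hom.app V.1)

instance : Category (TopModule X) where
  Hom := TopModule.Hom
  id N := ⟨𝟙 N.mod, fun V => by let := N.top V; exact continuous_id⟩
  comp {N N' N''} f g := ⟨f.hom ≫ g.hom, fun V => by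
    let := N.top V
    let := N'.top V
    let := N''.top V
    exact (g.continuous_app V).comp (f.continuous_app V)⟩

@[ext]
lemma TopModule.hom_ext {N N' : TopModule X} {f g : N ⟶ N'} (h : f.hom = g.hom) : f = g :=
  TopModule.Hom.ext h

@[simp]
lemma TopModule.id_hom (N : TopModule X) : (𝟙 N : N ⟶ N).hom = 𝟙 N.mod := rfl

@[simp]
lemma TopModule.comp_hom {N N' N'' : TopModule X} (f : N ⟶ N') (g : N' ⟶ N'') :
    (f ≫ g).hom = f.hom ≫ g.hom := rfl

/-- An `𝒪_X`-module with the discrete topologies. -/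
def discrete (N : X.Modules) : TopModule X where
  mod := N
  top _ := ⊥
  continuous_res _ := continuous_bot

/-- The sections over `U` of the sheaf of continuous homomorphisms from `N` to the discrete
module `M`: the `𝒪_U`-linear morphisms `N|_U ⟶ M|_U`, i.e. the families of linear maps
`Γ(N, V) ⟶ Γ(M, V)` for `V ⊆ U` which are compatible with restrictions, which are continuous
on the sections over the affine open subsets of `U`. -/
def contHomOn (N : TopModule X) (M : X.Modules) (U : X.Opens) :
    AddSubgroup (∀ V : {V : X.Opens // V ≤ U}, Γ(N.mod, V.1) →ₗ[Γ(X, V.1)] Γ(M, V.1)) where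
  carrier := {φ |
    (∀ (V W : {V : X.Opens // V ≤ U}) (h : W.1 ≤ V.1) (s : Γ(N.mod, V.1)),
      φ W (N.mod.presheaf.map (homOfLE h).op s) = M.presheaf.map (homOfLE h).op (φ V s)) ∧
    ∀ (V : X.affineOpens) (h : V.1 ≤ U), Continuous[N.top V, ⊥] (φ ⟨V.1, h⟩)}
  zero_mem' := ⟨fun V W h s => by simp, fun V h => by
    let := N.top V
    let : TopologicalSpace Γ(M, V.1) := ⊥
    exact continuous_const⟩
  add_mem' {φ ψ} hφ hψ := ⟨fun V W h s => by simp [hφ.1 V W h s, hψ.1 V W h s], fun V h => by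
    let := N.top V
    let : TopologicalSpace Γ(M, V.1) := ⊥
    have : DiscreteTopology Γ(M, V.1) := ⟨rfl⟩
    exact (hφ.2 V h).add (hψ.2 V h)⟩
  neg_mem' {φ} hφ := ⟨fun V W h s => by simp [hφ.1 V W h s], fun V h => by
    let := N.top V
    let : TopologicalSpace Γ(M, V.1) := ⊥
    have : DiscreteTopology Γ(M, V.1) := ⟨rfl⟩
    exact (hφ.2 V h).neg⟩

variable (N N' N'' : TopModule X) (M M' M'' : X.Modules)

/-- For a discrete module `N`, continuity is no condition: the sections over `U` are all the
`𝒪_U`-linear morphisms `N|_U ⟶ M|_U`. -/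
lemma mem_contHomOn_discrete (N M : X.Modules) (U : X.Opens)
    (φ : ∀ V : {V : X.Opens // V ≤ U}, Γ(N, V.1) →ₗ[Γ(X, V.1)] Γ(M, V.1)) :
    φ ∈ contHomOn (discrete N) M U ↔
      ∀ (V W : {V : X.Opens // V ≤ U}) (h : W.1 ≤ V.1) (s : Γ(N, V.1)),
        φ W (N.presheaf.map (homOfLE h).op s) = M.presheaf.map (homOfLE h).op (φ V s) :=
  ⟨fun h => h.1, fun h => ⟨h, fun _ _ => continuous_bot⟩⟩

variable {N N' N'' M M' M''} in
@[ext]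
lemma contHomOn_ext {U : X.Opens} {φ ψ : contHomOn N M U}
    (h : ∀ V hV s, φ.1 ⟨V, hV⟩ s = ψ.1 ⟨V, hV⟩ s) : φ = ψ :=
  Subtype.ext (funext fun V => LinearMap.ext fun s => h V.1 V.2 s)

/-- The action of functions: `(r • φ)_V = r|_V • φ_V`. -/
instance (U : X.Opens) : SMul Γ(X, U) (contHomOn N M U) where
  smul r φ := ⟨fun V => X.presheaf.map (homOfLE V.2).op r • φ.1 V, fun V W h s => by
      have := φ.2.1 V W h s
      simp only [LinearMap.smul_apply, this, Scheme.Modules.map_smul]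
      rw [← CommRingCat.comp_apply, ← Functor.map_comp]
      rfl, fun V h => by
      let := N.top V
      let : TopologicalSpace Γ(M, V.1) := ⊥
      exact (continuous_bot (f := fun x : Γ(M, V.1) =>
        X.presheaf.map (homOfLE h).op r • x)).comp (φ.2.2 V h)⟩

lemma smul_apply {U : X.Opens} (r : Γ(X, U)) (φ : contHomOn N M U) (V hV) (s : Γ(N.mod, V)) :
    (r • φ).1 ⟨V, hV⟩ s = X.presheaf.map (homOfLE hV).op r • φ.1 ⟨V, hV⟩ s := rfl

instance (U : X.Opens) : Module Γ(X, U) (contHomOn N M U) where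
  one_smul φ := by
    ext V hV s
    rw [smul_apply, map_one, one_smul]
  mul_smul r r' φ := by
    ext V hV s
    rw [smul_apply, smul_apply, smul_apply, map_mul, mul_smul]
  smul_zero r := by
    ext V hV s
    rw [smul_apply]
    exact smul_zero _
  smul_add r φ ψ := by
    ext V hV s
    rw [smul_apply]
    exact smul_add _ _ _
  add_smul r r' φ := by
    ext V hV s
    rw [smul_apply, map_add]
    exact add_smul _ _ _
  zero_smul φ := by
    ext V hV s
    rw [smul_apply, map_zero]
    exact zero_smul _ _

variable {N M} in
/-- Restriction of homomorphisms to a smaller open subset. -/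
def contHomRes {U U' : X.Opens} (h : U' ≤ U) : contHomOn N M U →+ contHomOn N M U' where
  toFun φ := ⟨fun V => φ.1 ⟨V.1, V.2.trans h⟩,
    fun V W => φ.2.1 ⟨V.1, V.2.trans h⟩ ⟨W.1, W.2.trans h⟩, fun V hV => φ.2.2 V (hV.trans h)⟩
  map_zero' := rfl
  map_add' _ _ := rfl

/-- The presheaf of continuous homomorphisms. -/
def contHomPresheaf : X.Opensᵒᵖ ⥤ Ab.{u} where
  obj U := AddCommGrpCat.of (contHomOn N M U.unop)
  map i := AddCommGrpCat.ofHom (contHomRes i.unop.le)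

lemma isSheaf_contHomPresheaf : TopCat.Presheaf.IsSheaf (contHomPresheaf N M) := by
  rw [TopCat.Presheaf.isSheaf_iff_isSheafUniqueGluing]
  intro ι U sf hsf
  let FM : TopCat.Sheaf Ab X := ⟨M.presheaf, M.isSheaf⟩
  -- the local values agree on overlaps
  have key (i j : ι) (V : X.Opens) (hi : V ≤ U i) (hj : V ≤ U j) (s : Γ(N.mod, V)) :
      (sf i).1 ⟨V, hi⟩ s = (sf j).1 ⟨V, hj⟩ s := by
    have := congr($(hsf i j).1 ⟨V, le_inf hi hj⟩ s)
    exact this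
  have res (i : ι) (V W : X.Opens) (hV : V ≤ U i) (h : W ≤ V) (s : Γ(N.mod, V)) :
      (sf i).1 ⟨W, h.trans hV⟩ (N.mod.presheaf.map (homOfLE h).op s) =
        M.presheaf.map (homOfLE h).op ((sf i).1 ⟨V, hV⟩ s) :=
    (sf i).2.1 ⟨V, hV⟩ ⟨W, h.trans hV⟩ h s
  have glue (V : X.Opens) (hV : V ≤ iSup U) (s : Γ(N.mod, V)) :
      ∃! t : Γ(M, V), ∀ i, M.presheaf.map (homOfLE (inf_le_left : V ⊓ U i ≤ V)).op t =
        (sf i).1 ⟨V ⊓ U i, inf_le_right⟩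
          (N.mod.presheaf.map (homOfLE (inf_le_left : V ⊓ U i ≤ V)).op s) := by
    refine FM.existsUnique_gluing' (fun i => V ⊓ U i) V (fun i => homOfLE inf_le_left) ?_ _ ?_
    · rw [← inf_iSup_eq]
      exact le_inf le_rfl hV
    · intro i j
      change M.presheaf.map (homOfLE _).op _ = M.presheaf.map (homOfLE _).op _
      rw [← res, ← res, ← AddCommGrpCat.comp_apply, ← AddCommGrpCat.comp_apply,
        ← Functor.map_comp, ← Functor.map_comp]
      exact key i j _ _ _ _
  choose g hg hg' using glue
  have hg'' (V : X.Opens) (hV : V ≤ iSup U) (s : Γ(N.mod, V)) (i : ι) (W : X.Opens)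
      (hW : W ≤ V) (hWi : W ≤ U i) : M.presheaf.map (homOfLE hW).op (g V hV s) =
        (sf i).1 ⟨W, hWi⟩ (N.mod.presheaf.map (homOfLE hW).op s) := by
    have h1 : (homOfLE hW).op = (homOfLE (inf_le_left : V ⊓ U i ≤ V)).op ≫
      (homOfLE (le_inf hW hWi)).op := rfl
    rw [h1, Functor.map_comp, Functor.map_comp, AddCommGrpCat.comp_apply,
      AddCommGrpCat.comp_apply, hg]
    exact (res i _ W inf_le_right (le_inf hW hWi) _).symm
  have ext (V : X.Opens) (hV : V ≤ iSup U) (t t' : Γ(M, V))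
      (h : ∀ (i : ι) (W : X.Opens) (hW : W ≤ V) (_ : W ≤ U i),
        M.presheaf.map (homOfLE hW).op t = M.presheaf.map (homOfLE hW).op t') : t = t' := by
    refine FM.eq_of_locally_eq' (fun i => V ⊓ U i) V (fun i => homOfLE inf_le_left) ?_ _ _ ?_
    · rw [← inf_iSup_eq]
      exact le_inf le_rfl hV
    · intro i
      exact h i _ _ inf_le_right
  refine ⟨⟨fun V =>
    { toFun := g V.1 V.2
      map_add' s s' := ext V.1 V.2 _ _ fun i W hW hWi => by
        rw [map_add, hg'' V.1 V.2 _ i W hW hWi, hg'' V.1 V.2 _ i W hW hWi,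
          hg'' V.1 V.2 _ i W hW hWi, map_add, map_add]
      map_smul' r s := ext V.1 V.2 _ _ fun i W hW hWi => by
        rw [RingHom.id_apply, Scheme.Modules.map_smul, hg'' V.1 V.2 _ i W hW hWi,
          hg'' V.1 V.2 _ i W hW hWi, Scheme.Modules.map_smul, map_smul] }, ?_, ?_⟩, ?_, ?_⟩
  · intro V W h s
    refine ext W.1 W.2 _ _ fun i W' hW' hWi' => ?_
    change M.presheaf.map _ (g W.1 W.2 _) = M.presheaf.map _ (M.presheaf.map _ (g V.1 V.2 s))
    rw [hg'' W.1 W.2 _ i W' hW' hWi', ← AddCommGrpCat.comp_apply, ← AddCommGrpCat.comp_apply,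
      ← Functor.map_comp, ← Functor.map_comp]
    exact (hg'' V.1 V.2 s i W' (hW'.trans h) hWi').symm
  · intro V hV
    have hcov : ∀ x ∈ V.1, ∃ (i : ι) (W : X.affineOpens), W.1 ≤ V.1 ∧ W.1 ≤ U i ∧ x ∈ W.1 := by
      intro x hx
      obtain ⟨i, hi⟩ := Opens.mem_iSup.mp (hV hx)
      obtain ⟨W, hW, hxW, hle⟩ := X.isBasis_affineOpens.exists_subset_of_mem_open
        (show x ∈ (V.1 ⊓ U i : X.Opens) from ⟨hx, hi⟩) (V.1 ⊓ U i).2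
      obtain ⟨W, hW, rfl⟩ := hW
      exact ⟨i, ⟨W, hW⟩, fun y hy => (hle hy).1, fun y hy => (hle hy).2, hxW⟩
    choose i W hWV hWi hxW using hcov
    obtain ⟨T, hT⟩ := V.2.isCompact.elim_finite_subcover
      (fun x : V.1 => ((W x.1 x.2).1 : Set X)) (fun x => (W x.1 x.2).1.2)
      (fun x hx => Set.mem_iUnion.mpr ⟨⟨x, hx⟩, hxW x hx⟩)
    let := N.top V
    let : TopologicalSpace Γ(M, V.1) := ⊥
    have : DiscreteTopology Γ(M, V.1) := ⟨rfl⟩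
    have hopen (s : Γ(N.mod, V.1)) (x : V.1) : IsOpen {s' : Γ(N.mod, V.1) |
        (sf (i x.1 x.2)).1 ⟨(W x.1 x.2).1, hWi x.1 x.2⟩
          (N.mod.presheaf.map (homOfLE (hWV x.1 x.2)).op s') =
        (sf (i x.1 x.2)).1 ⟨(W x.1 x.2).1, hWi x.1 x.2⟩
          (N.mod.presheaf.map (homOfLE (hWV x.1 x.2)).op s)} := by
      let := N.top (W x.1 x.2)
      let : TopologicalSpace Γ(M, (W x.1 x.2).1) := ⊥
      have : DiscreteTopology Γ(M, (W x.1 x.2).1) := ⟨rfl⟩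
      have h1 := ((sf (i x.1 x.2)).2.2 (W x.1 x.2) (hWi x.1 x.2)).comp
        (N.continuous_res (hWV x.1 x.2))
      exact h1.isOpen_preimage {_} (isOpen_discrete _)
    change Continuous (g V.1 hV)
    refine continuous_def.mpr fun O _ => isOpen_iff_mem_nhds.mpr fun s hs => ?_
    refine Filter.mem_of_superset (IsOpen.mem_nhds
      (isOpen_biInter_finset (s := T) fun x _ => hopen s x) ?_) ?_
    · simp
    · intro s' hs'
      have : g V.1 hV s' = g V.1 hV s := by
        refine FM.eq_of_locally_eq' (fun x : T => (W x.1.1 x.1.2).1) V.1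
          (fun x => homOfLE (hWV _ _)) ?_ _ _ ?_
        · intro y hy
          obtain ⟨x, hxT, hx⟩ := Set.mem_iUnion₂.mp (hT hy)
          exact Opens.mem_iSup.mpr ⟨⟨x, hxT⟩, hx⟩
        · intro x
          have h2 := Set.mem_iInter₂.mp hs' x.1 x.2
          exact (hg'' _ _ _ _ _ _ _).trans (h2.trans (hg'' _ _ _ _ _ _ _).symm)
      change g V.1 hV s' ∈ O
      rw [this]
      exact hs
  · intro i
    apply contHomOn_ext
    intro V hV s
    change g V _ s = _
    refine ext V (hV.trans (le_iSup U i)) _ _ fun j W hW hWj => ?_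
    rw [hg'' V _ s j W hW hWj, ← res, key]
  · intro φ hφ
    apply contHomOn_ext
    intro V hV s
    refine hg' V hV s _ fun i => ?_
    rw [← φ.2.1 ⟨V, hV⟩ ⟨V ⊓ U i, inf_le_left.trans hV⟩]
    exact congr($(hφ i).1 ⟨V ⊓ U i, inf_le_right⟩ _)

instance (U : X.Opensᵒᵖ) : Module (X.ringCatSheaf.obj.obj U) ((contHomPresheaf N M).obj U) :=
  inferInstanceAs (Module Γ(X, U.unop) (contHomOn N M U.unop))

/-- The `𝒪_X`-module `𝓗om^cont_{𝒪_X}(N, M)` of continuous homomorphisms from the topologized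
module `N` to the discrete module `M`. -/
def contHomObj : X.Modules where
  val := PresheafOfModules.ofPresheaf (contHomPresheaf N M) (fun {U V} i r φ => by
    apply contHomOn_ext
    intro W hW s
    change X.presheaf.map (homOfLE (hW.trans i.unop.le)).op r • φ.1 ⟨W, hW.trans i.unop.le⟩ s =
      X.presheaf.map (homOfLE hW).op (X.presheaf.map i r) • φ.1 ⟨W, hW.trans i.unop.le⟩ s
    congr 1
    exact congr($(X.presheaf.map_comp i (homOfLE hW).op) r))
  isSheaf := isSheaf_contHomPresheaf N M

variable {N N' N'' M M' M''}

/-- The functoriality of `𝓗om^cont_{𝒪_X}(N, M)` in both arguments. -/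
def contHomMap (f : N' ⟶ N) (g : M ⟶ M') : contHomObj N M ⟶ contHomObj N' M' where
  val := PresheafOfModules.homMk
    { app U := AddCommGrpCat.ofHom
        { toFun φ := ⟨fun V =>
            { toFun s := g.app V.1 (φ.1 V (f.hom.app V.1 s))
              map_add' := by simp
              map_smul' := by simp }, fun V W h s => by
                have h1 := congr($(f.hom.mapPresheaf.naturality (homOfLE h).op) s)
                have h2 := congr($(g.mapPresheaf.naturality (homOfLE h).op)
                  (φ.1 V (f.hom.app V.1 s)))
                have h3 := φ.2.1 V W h (f.hom.app V.1 s)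
                change g.app W.1 (φ.1 W (f.hom.app W.1 (N'.mod.presheaf.map (homOfLE h).op s))) =
                  M'.presheaf.map (homOfLE h).op (g.app V.1 (φ.1 V (f.hom.app V.1 s)))
                refine Eq.trans ?_ h2
                change _ = g.app W.1 (M.presheaf.map (homOfLE h).op (φ.1 V (f.hom.app V.1 s)))
                rw [← h3]
                exact congrArg (fun x => g.app W.1 (φ.1 W x)) h1, fun V h => by
                let := N.top V
                let := N'.top V
                let : TopologicalSpace Γ(M, V.1) := ⊥
                let : TopologicalSpace Γ(M', V.1) := ⊥
                exact (continuous_bot (f := g.app V.1)).comp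
                  ((φ.2.2 V h).comp (f.continuous_app V))⟩
          map_zero' := contHomOn_ext fun V hV s => map_zero (g.app V).hom
          map_add' φ ψ := contHomOn_ext fun V hV s => map_add (g.app V).hom _ _ }
      naturality U V i := rfl } (fun U r φ => contHomOn_ext fun V hV s =>
        g.app_smul (X.presheaf.map (homOfLE hV).op r) _)

variable (X) in
/-- The bifunctor `(N, M) ↦ 𝓗om^cont_{𝒪_X}(N, M)`, contravariant in the topologized module `N` and
covariant in the discrete module `M`. -/
def contHom : (TopModule X)ᵒᵖ ⥤ X.Modules ⥤ X.Modules where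
  obj N :=
    { obj M := contHomObj N.unop M
      map g := contHomMap (𝟙 N.unop) g
      map_id _ := rfl
      map_comp _ _ := rfl }
  map f := { app M := contHomMap f.unop (𝟙 M), naturality _ _ _ := rfl }
  map_id _ := rfl
  map_comp _ _ := rfl

/-- The functor `𝓗om_{𝒪_X}(N, -)`. -/
def sheafHom (N : X.Modules) : X.Modules ⥤ X.Modules :=
  (contHom X).obj (op (discrete N))

instance (N : X.Modules) : (sheafHom N).Additive where
  map_add := rfl

end SheafHom

section Powers

lemma idealSheafData_pow_le_map {X Y : Scheme.{u}} (g : X ⟶ Y) (I : X.IdealSheafData)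
    (J : Y.IdealSheafData) (h : J ≤ I.map g) (k : ℕ) : J ^ k ≤ (I ^ k).map g := by
  have hc {Z : Scheme.{u}} (c : Z ⟶ X) (U : Y.Opens) (W : X.Opens) (hW : W ≤ g ⁻¹ᵁ U) :
      g.appLE U W hW ≫ c.app W = (c ≫ g).app U ≫ Z.presheaf.map
        (homOfLE (fun y hy => hW hy : c ⁻¹ᵁ W ≤ (c ≫ g) ⁻¹ᵁ U)).op := by
    rw [Scheme.Hom.app_eq_appLE, Scheme.Hom.app_eq_appLE, Scheme.Hom.appLE_comp_appLE,
      Scheme.Hom.appLE_map]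
  have hJ (U : Y.affineOpens) (W : X.affineOpens) (hW : W.1 ≤ g ⁻¹ᵁ U.1) :
      J.ideal U ≤ (I.ideal W).comap (g.appLE U.1 W.1 hW).hom := by
    intro a ha
    have h1 : ((I.subschemeι ≫ g).app U.1).hom a = 0 := Scheme.Hom.ideal_ker_le _ U (h U ha)
    have h2 : (I.subschemeι.app W.1).hom ((g.appLE U.1 W.1 hW).hom a) = 0 := by
      have h4 := congr($(hc I.subschemeι U.1 W.1 hW).hom a)
      simp only [CommRingCat.hom_comp, RingHom.comp_apply] at h4
      rw [h4, h1, map_zero]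
    rw [Ideal.mem_comap, ← I.ker_subschemeι_app W]
    exact h2
  refine Scheme.IdealSheafData.le_ofIdeals_iff.mpr fun U => ?_
  intro a ha
  rw [RingHom.mem_ker]
  let Z := (I ^ k).subscheme
  let FZ : TopCat.Sheaf CommRingCat Z := Z.sheaf
  let c : Z ⟶ X := (I ^ k).subschemeι
  have hcov : ∀ x ∈ g ⁻¹ᵁ U.1, ∃ W : X.affineOpens, W.1 ≤ g ⁻¹ᵁ U.1 ∧ x ∈ W.1 := by
    intro x hx
    obtain ⟨W, hW, hxW, hle⟩ := X.isBasis_affineOpens.exists_subset_of_mem_open hx (g ⁻¹ᵁ U.1).2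
    obtain ⟨W, hW, rfl⟩ := hW
    exact ⟨⟨W, hW⟩, hle, hxW⟩
  choose W hW hxW using hcov
  refine FZ.eq_of_locally_eq' (fun x : g ⁻¹ᵁ U.1 => c ⁻¹ᵁ (W x.1 x.2).1) _
    (fun x => homOfLE fun y hy => hW _ _ hy) ?_ _ _ fun x => ?_
  · intro y hy
    exact Opens.mem_iSup.mpr ⟨⟨c y, hy⟩, hxW _ _⟩
  · have h4 := congr($(hc c U.1 (W x.1 x.2).1 (hW _ _)).hom a)
    refine h4.symm.trans (Eq.trans ?_ (map_zero (Z.presheaf.map _).hom).symm)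
    change _ ∈ RingHom.ker (c.app (W x.1 x.2).1).hom
    rw [(I ^ k).ker_subschemeι_app (W x.1 x.2)]
    have h5 : (J.ideal U) ^ k ≤
        ((I.ideal (W x.1 x.2)) ^ k).comap (g.appLE U.1 (W x.1 x.2).1 (hW _ _)).hom :=
      (Ideal.pow_right_mono (hJ U _ (hW _ _)) k).trans (Ideal.le_comap_pow _ k)
    exact h5 ha

variable {S X : Scheme.{u}} (f : X ⟶ S)

/-- The `n`-fold fibre product `X ×_S ⋯ ×_S X`. -/
def power (n : ℕ) : Scheme.{u} := widePullback S (fun _ : Fin n => X) (fun _ => f)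

/-- The projection `X^n ⟶ X` to the `i`-th factor. -/
def proj {n : ℕ} (i : Fin n) : power f n ⟶ X := WidePullback.π (fun _ : Fin n => f) i

/-- The structure morphism `X^n ⟶ S`. -/
def base (n : ℕ) : power f n ⟶ S := WidePullback.base (fun _ : Fin n => f)

variable {f} in
lemma power_hom_ext {n : ℕ} {Z : Scheme.{u}} {g h : Z ⟶ power f n}
    (H : ∀ i, g ≫ proj f i = h ≫ proj f i) (H' : g ≫ base f n = h ≫ base f n) : g = h :=
  WidePullback.hom_ext _ _ _ H H'

/-- The morphism `X^m ⟶ X^n`, `(x_i)_i ↦ (x_{σ(j)})_j`, given by a map of index sets. -/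
def powerMap {m n : ℕ} (σ : Fin n → Fin m) : power f m ⟶ power f n :=
  WidePullback.lift (base f m) (fun j => proj f (σ j))
    (fun j => WidePullback.π_arrow (fun _ : Fin m => f) (σ j))

/-- The diagonal embedding `X ⟶ X^n`. -/
def diag (n : ℕ) : X ⟶ power f n :=
  WidePullback.lift f (fun _ => 𝟙 X) (fun _ => Category.id_comp f)

@[simp]
lemma powerMap_proj {m n : ℕ} (σ : Fin n → Fin m) (j : Fin n) :
    powerMap f σ ≫ proj f j = proj f (σ j) :=
  WidePullback.lift_π _ _ _ _ _

@[simp]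
lemma powerMap_base {m n : ℕ} (σ : Fin n → Fin m) : powerMap f σ ≫ base f n = base f m :=
  WidePullback.lift_base _ _ _ _

@[simp]
lemma diag_proj {n : ℕ} (j : Fin n) : diag f n ≫ proj f j = 𝟙 X :=
  WidePullback.lift_π _ _ _ _ _

@[simp]
lemma diag_base (n : ℕ) : diag f n ≫ base f n = f :=
  WidePullback.lift_base _ _ _ _

@[simp]
lemma diag_powerMap {m n : ℕ} (σ : Fin n → Fin m) : diag f m ≫ powerMap f σ = diag f n :=
  power_hom_ext (by simp) (by simp)

lemma powerMap_id (n : ℕ) : powerMap f (id : Fin n → Fin n) = 𝟙 _ :=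
  power_hom_ext (by simp) (by simp)

lemma powerMap_comp {l m n : ℕ} (σ : Fin m → Fin l) (τ : Fin n → Fin m) :
    powerMap f (σ ∘ τ) = powerMap f σ ≫ powerMap f τ :=
  power_hom_ext (by simp) (by simp)

/-- The ideal sheaf of the diagonal in `X^n`. -/
def diagIdeal (n : ℕ) : (power f n).IdealSheafData := (diag f n).ker

/-- The `k`-th infinitesimal neighbourhood of the diagonal in `X^n`: the closed subscheme of `X^n`
defined by the `(k+1)`-st power of the ideal sheaf of the diagonal. -/
def nbhd (n k : ℕ) : Scheme.{u} := (diagIdeal f n ^ (k + 1)).subscheme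

/-- The embedding of the infinitesimal neighbourhood. -/
def nbhdι (n k : ℕ) : nbhd f n k ⟶ power f n := (diagIdeal f n ^ (k + 1)).subschemeι

instance (n k : ℕ) : IsClosedImmersion (nbhdι f n k) :=
  inferInstanceAs (IsClosedImmersion (diagIdeal f n ^ (k + 1)).subschemeι)

lemma diagIdeal_pow_le {m n : ℕ} (σ : Fin n → Fin m) {k k' : ℕ} (h : k ≤ k') :
    diagIdeal f n ^ (k' + 1) ≤ (diagIdeal f m ^ (k + 1)).map (powerMap f σ) := by
  refine le_trans (fun U => Ideal.pow_le_pow_right (Nat.succ_le_succ h))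
    (idealSheafData_pow_le_map _ _ _ ?_ (k + 1))
  rw [diagIdeal, diagIdeal, ← Scheme.Hom.ker_comp, diag_powerMap]

/-- The morphisms of infinitesimal neighbourhoods induced by the morphisms of powers of `X` and by
the inclusions. -/
def nbhdMap {m n : ℕ} (σ : Fin n → Fin m) {k k' : ℕ} (h : k ≤ k') : nbhd f m k ⟶ nbhd f n k' :=
  Scheme.IdealSheafData.subschemeMap _ _ (powerMap f σ) (diagIdeal_pow_le f σ h)

@[simp]
lemma nbhdMap_nbhdι {m n : ℕ} (σ : Fin n → Fin m) {k k' : ℕ} (h : k ≤ k') :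
    nbhdMap f σ h ≫ nbhdι f n k' = nbhdι f m k ≫ powerMap f σ :=
  Scheme.IdealSheafData.subschemeMap_subschemeι _ _ _ _

@[simp]
lemma nbhdMap_nbhdι_assoc {m n : ℕ} (σ : Fin n → Fin m) {k k' : ℕ} (h : k ≤ k')
    {Z : Scheme.{u}} (g : power f n ⟶ Z) :
    nbhdMap f σ h ≫ nbhdι f n k' ≫ g = nbhdι f m k ≫ powerMap f σ ≫ g := by
  rw [← Category.assoc, nbhdMap_nbhdι, Category.assoc]

lemma nbhdMap_id (n k : ℕ) : nbhdMap f (id : Fin n → Fin n) (le_refl k) = 𝟙 _ := by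
  rw [← cancel_mono (nbhdι f n k), nbhdMap_nbhdι, powerMap_id, Category.comp_id, Category.id_comp]

lemma nbhdMap_comp {l m n : ℕ} (σ : Fin m → Fin l) (τ : Fin n → Fin m) {k k' k'' : ℕ}
    (h : k ≤ k') (h' : k' ≤ k'') :
    nbhdMap f (σ ∘ τ) (h.trans h') = nbhdMap f σ h ≫ nbhdMap f τ h' := by
  simp [← cancel_mono (nbhdι f n k''), powerMap_comp]

lemma nbhdι_ker_le (n k : ℕ) : (nbhdι f n k).ker ≤ (diag f n).ker :=
  (Scheme.IdealSheafData.ker_subschemeι (diagIdeal f n ^ (k + 1))).trans_le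
    fun U => Ideal.pow_le_self k.succ_ne_zero

/-- The embedding of `X` into the infinitesimal neighbourhoods of the diagonal. -/
def toNbhd (n k : ℕ) : X ⟶ nbhd f n k :=
  IsClosedImmersion.lift (nbhdι f n k) (diag f n) (nbhdι_ker_le f n k)

@[simp]
lemma toNbhd_nbhdι (n k : ℕ) : toNbhd f n k ≫ nbhdι f n k = diag f n :=
  IsClosedImmersion.lift_fac _ _ _

@[simp]
lemma toNbhd_nbhdι_assoc (n k : ℕ) {Z : Scheme.{u}} (g : power f n ⟶ Z) :
    toNbhd f n k ≫ nbhdι f n k ≫ g = diag f n ≫ g := by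
  rw [← Category.assoc, toNbhd_nbhdι]

@[simp]
lemma toNbhd_nbhdMap {m n : ℕ} (σ : Fin n → Fin m) {k k' : ℕ} (h : k ≤ k') :
    toNbhd f m k ≫ nbhdMap f σ h = toNbhd f n k' := by
  simp [← cancel_mono (nbhdι f n k')]

end Powers

section Push

variable (X : Scheme.{u})

/-- The functor sending a scheme `g : Z ⟶ X` over `X` to the sheaf of rings `g_* 𝒪_Z` on `X`. -/
def pushStruct : (Over X)ᵒᵖ ⥤ TopCat.Sheaf CommRingCat.{u} X where
  obj Z := (TopCat.Sheaf.pushforward CommRingCat.{u} Z.unop.hom.base).obj Z.unop.left.sheaf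
  map {Z Z'} g := ⟨{
    app V := g.unop.left.appLE (Z.unop.hom ⁻¹ᵁ V.unop) (Z'.unop.hom ⁻¹ᵁ V.unop)
      (by rw [← Over.w g.unop]; rfl)
    naturality V W i := (Scheme.Hom.map_appLE _ _ _).trans (Scheme.Hom.appLE_map _ _ _).symm }⟩
  map_id Z := by
    apply ObjectProperty.hom_ext
    apply NatTrans.ext
    funext V
    exact (Scheme.Hom.appLE_eq_app (𝟙 Z.unop.left)).trans (Scheme.Hom.id_app _)
  map_comp {Z Z' Z''} g h := by
    apply ObjectProperty.hom_ext
    apply NatTrans.ext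
    funext V
    exact (Scheme.Hom.appLE_comp_appLE _ _ _ _ _ _ _).symm

/-- The identification of `𝒪_X` with its push-forward under the identity of `X`. -/
def toPushId : X.sheaf ⟶ (pushStruct X).obj (op (Over.mk (𝟙 X))) :=
  ⟨{ app V := (𝟙 X : X ⟶ X).app V.unop
     naturality V W i := (𝟙 X : X ⟶ X).naturality i }⟩

end Push

section Bar

variable {S X : Scheme.{u}} (f : X ⟶ S)

/-- For a monotone map `θ : [p] → [q]`, the map `{0, …, q + 1} → {0, …, p + 1}` sending `j` to
the number of `i` with `θ i < j`. For `θ = δ^i`, the injection `[q - 1] → [q]` which misses `i`, it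
is the surjection which takes the value `i` twice, at `i` and at `i + 1`. -/
def slots {p q : SimplexCategory} (θ : p ⟶ q) (j : Fin (q.len + 2)) : Fin (p.len + 2) :=
  ⟨(Finset.univ.filter fun i : Fin (p.len + 1) => (θ i : ℕ) < j).card,
    Nat.lt_succ_of_le ((Finset.card_le_univ _).trans (Fintype.card_fin _).le)⟩

lemma card_filter_val_lt {n m : ℕ} (h : m ≤ n) :
    (Finset.univ.filter fun i : Fin n => (i : ℕ) < m).card = m := by
  rw [Fin.card_filter_val_lt, min_eq_right h]

lemma slots_id (p : SimplexCategory) : slots (𝟙 p) = id := by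
  funext j
  apply Fin.ext
  exact card_filter_val_lt (Nat.le_of_lt_succ j.2)

lemma slots_comp {p q r : SimplexCategory} (θ : p ⟶ q) (η : q ⟶ r) :
    slots (θ ≫ η) = slots θ ∘ slots η := by
  funext j
  apply Fin.ext
  suffices h : ∀ i, (η (θ i) : ℕ) < j ↔ (θ i : ℕ) < (slots η j : ℕ) from
    congrArg Finset.card (Finset.filter_congr (s := Finset.univ) fun i _ => h i)
  intro i
  have mono := η.toOrderHom.monotone
  constructor
  · intro h
    have : (Finset.univ.filter fun l : Fin (q.len + 1) => (l : ℕ) < (θ i : ℕ) + 1) ⊆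
        Finset.univ.filter fun l : Fin (q.len + 1) => (η l : ℕ) < j := by
      intro l hl
      simp only [Finset.mem_filter, Finset.mem_univ, true_and] at hl ⊢
      exact lt_of_le_of_lt (mono (Nat.le_of_lt_succ hl : l ≤ θ i)) h
    have := Finset.card_le_card this
    rwa [card_filter_val_lt (Nat.succ_le_of_lt (θ i).2)] at this
  · intro h
    by_contra h'
    have : (Finset.univ.filter fun l : Fin (q.len + 1) => (η l : ℕ) < j) ⊆
        Finset.univ.filter fun l : Fin (q.len + 1) => (l : ℕ) < (θ i : ℕ) := by
      intro l hl
      simp only [Finset.mem_filter, Finset.mem_univ, true_and] at hl ⊢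
      by_contra hl'
      exact h' (lt_of_le_of_lt (mono (Nat.le_of_not_lt hl' : θ i ≤ l)) hl)
    have := Finset.card_le_card this
    rw [card_filter_val_lt (θ i).2.le] at this
    exact absurd h (Nat.not_lt.mpr this)

@[simp]
lemma slots_zero {p q : SimplexCategory} (θ : p ⟶ q) : slots θ 0 = 0 := by
  apply Fin.ext
  simp [slots]

/-- The infinitesimal neighbourhoods of the diagonal in `X^{q + 2}`, for all `q`, regarded as
schemes over `X` by the first projection. -/
def nbhds : SimplexCategory ⥤ ℕ ⥤ Over X where
  obj q :=
    { obj k := Over.mk (nbhdι f (q.len + 2) k ≫ proj f 0)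
      map h := Over.homMk (nbhdMap f id h.le) (by simp)
      map_id k := by
        ext
        exact nbhdMap_id f _ _
      map_comp h h' := by
        ext
        exact nbhdMap_comp f id id h.le h'.le }
  map θ :=
    { app k := Over.homMk (nbhdMap f (slots θ) le_rfl) (by simp)
      naturality k k' h := by
        ext
        exact (nbhdMap_comp f id (slots θ) h.le le_rfl).symm.trans
          (nbhdMap_comp f (slots θ) id le_rfl h.le) }
  map_id q := by
    ext k
    simp only [slots_id]
    exact nbhdMap_id f _ _
  map_comp θ η := by
    ext k
    simp only [slots_comp]
    exact nbhdMap_comp f _ _ le_rfl le_rfl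

/-- The embedding of `X` into the infinitesimal neighbourhoods of the diagonal, over `X`. -/
def toNbhds (q : SimplexCategory) (k : ℕ) : Over.mk (𝟙 X) ⟶ ((nbhds f).obj q).obj k :=
  Over.homMk (toNbhd f (q.len + 2) k) (by simp [nbhds])

/-- The complete bar resolution as a simplicial sheaf of rings on `X`: in degree `q` it is the
limit over `k` of the structure sheaves of the `k`-th infinitesimal neighbourhoods of the diagonal
in `X^{q + 2}`, i.e. the structure sheaf of the completion of `X^{q + 2}` along the diagonal. -/
def completeBar : SimplexCategoryᵒᵖ ⥤ TopCat.Sheaf CommRingCat.{u} X :=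
  (nbhds f).op ⋙ Functor.opHom ℕ (Over X) ⋙
    (Functor.whiskeringRight ℕᵒᵖ _ _).obj (pushStruct X) ⋙ lim

/-- The augmentation of the complete bar resolution, i.e. the restriction of functions to the
diagonal. -/
def augmentation (q : SimplexCategoryᵒᵖ) :
    (completeBar f).obj q ⟶ (pushStruct X).obj (op (Over.mk (𝟙 X))) :=
  limit.π (((nbhds f).obj q.unop).op ⋙ pushStruct X) (op 0) ≫
    (pushStruct X).map (toNbhds f q.unop 0).op

lemma map_augmentation {p q : SimplexCategoryᵒᵖ} (θ : p ⟶ q) :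
    (completeBar f).map θ ≫ augmentation f q = augmentation f p := by
  have h : toNbhds f q.unop 0 ≫ ((nbhds f).map θ.unop).app 0 = toNbhds f p.unop 0 := by
    ext
    exact toNbhd_nbhdMap f _ le_rfl
  have h' := limMap_π (Functor.whiskerRight (NatTrans.op ((nbhds f).map θ.unop)) (pushStruct X)) (op 0)
  rw [augmentation, augmentation, ← h, op_comp, Functor.map_comp]
  exact (Category.assoc _ _ _).symm.trans ((congrArg (· ≫ _) h').trans (Category.assoc _ _ _))

instance : HasPushouts (TopCat.Sheaf CommRingCat.{u} X) :=
  inferInstanceAs (HasPushouts (Sheaf (Opens.grothendieckTopology X) CommRingCat.{u}))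

/-- The unique morphism `[0] ⟶ q` of the opposite of the simplex category which comes from
`q → [0]`. It makes the sheaf of rings `B̂_q` an algebra over `B̂_0` (by the outer two factors). -/
def fromZero (q : SimplexCategoryᵒᵖ) : op (SimplexCategory.mk 0) ⟶ q :=
  (SimplexCategory.isTerminalZero.from q.unop).op

@[simp]
lemma fromZero_comp {p q : SimplexCategoryᵒᵖ} (θ : p ⟶ q) : fromZero p ≫ θ = fromZero q :=
  Quiver.Hom.unop_inj (SimplexCategory.isTerminalZero.hom_ext _ _)

/-- The sheaf of rings `Ĉ_q = B̂_q ⊗_{B̂_0} 𝒪_X`. -/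
def chainRing (q : SimplexCategoryᵒᵖ) : TopCat.Sheaf CommRingCat.{u} X :=
  pushout ((completeBar f).map (fromZero q)) (augmentation f (op (SimplexCategory.mk 0)))

/-- The homomorphism `B̂_q ⟶ Ĉ_q`. -/
def fromBar (q : SimplexCategoryᵒᵖ) : (completeBar f).obj q ⟶ chainRing f q :=
  pushout.inl _ _

/-- The homomorphism `𝒪_X ⟶ Ĉ_q`, for `𝒪_X` as the push-forward along the identity. -/
def fromBase' (q : SimplexCategoryᵒᵖ) :
    (pushStruct X).obj (op (Over.mk (𝟙 X))) ⟶ chainRing f q :=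
  pushout.inr _ _

/-- The homomorphism `𝒪_X ⟶ Ĉ_q`. -/
def fromBase (q : SimplexCategoryᵒᵖ) : X.sheaf ⟶ chainRing f q :=
  toPushId X ≫ fromBase' f q

/-- The simplicial structure of `Ĉ`. -/
def chainRingMap {p q : SimplexCategoryᵒᵖ} (θ : p ⟶ q) : chainRing f p ⟶ chainRing f q :=
  pushout.map _ _ _ _ ((completeBar f).map θ) (𝟙 _) (𝟙 _)
    (by rw [← Functor.map_comp, fromZero_comp, Category.id_comp]) (by simp)

@[simp]
lemma fromBar_chainRingMap {p q : SimplexCategoryᵒᵖ} (θ : p ⟶ q) :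
    fromBar f p ≫ chainRingMap f θ = (completeBar f).map θ ≫ fromBar f q :=
  pushout.inl_desc _ _ _

@[simp]
lemma fromBar_chainRingMap_assoc {p q : SimplexCategoryᵒᵖ} (θ : p ⟶ q)
    {A : TopCat.Sheaf CommRingCat.{u} X} (g : chainRing f q ⟶ A) :
    fromBar f p ≫ chainRingMap f θ ≫ g = (completeBar f).map θ ≫ fromBar f q ≫ g := by
  rw [← Category.assoc, fromBar_chainRingMap, Category.assoc]

@[simp]
lemma fromBase'_chainRingMap {p q : SimplexCategoryᵒᵖ} (θ : p ⟶ q) :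
    fromBase' f p ≫ chainRingMap f θ = fromBase' f q :=
  (pushout.inr_desc _ _ _).trans (Category.id_comp _)

@[simp]
lemma fromBase'_chainRingMap_assoc {p q : SimplexCategoryᵒᵖ} (θ : p ⟶ q)
    {A : TopCat.Sheaf CommRingCat.{u} X} (g : chainRing f q ⟶ A) :
    fromBase' f p ≫ chainRingMap f θ ≫ g = fromBase' f q ≫ g := by
  rw [← Category.assoc, fromBase'_chainRingMap]

@[simp]
lemma fromBase_chainRingMap {p q : SimplexCategoryᵒᵖ} (θ : p ⟶ q) :
    fromBase f p ≫ chainRingMap f θ = fromBase f q := by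
  rw [fromBase, fromBase, Category.assoc, fromBase'_chainRingMap]

variable {f} in
lemma chainRing_hom_ext {q : SimplexCategoryᵒᵖ} {A : TopCat.Sheaf CommRingCat.{u} X}
    {g h : chainRing f q ⟶ A} (h₁ : fromBar f q ≫ g = fromBar f q ≫ h)
    (h₂ : fromBase' f q ≫ g = fromBase' f q ≫ h) : g = h :=
  pushout.hom_ext h₁ h₂

lemma chainRingMap_id (q : SimplexCategoryᵒᵖ) : chainRingMap f (𝟙 q) = 𝟙 _ :=
  chainRing_hom_ext (by simp) (by simp)

lemma chainRingMap_comp {p q r : SimplexCategoryᵒᵖ} (θ : p ⟶ q) (η : q ⟶ r) :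
    chainRingMap f (θ ≫ η) = chainRingMap f θ ≫ chainRingMap f η :=
  chainRing_hom_ext (by simp) (by simp)

/-- The ideal of `Γ(V, B̂_q)` of the functions which vanish on the diagonal. -/
def barIdeal (q : SimplexCategoryᵒᵖ) (V : X.Opens) :
    Ideal (((completeBar f).obj q).obj.obj (op V)) :=
  RingHom.ker ((augmentation f q).hom.app (op V)).hom

/-- The ideal of `Γ(V, Ĉ_q)` generated by the functions which vanish on the diagonal. -/
def chainIdeal (q : SimplexCategoryᵒᵖ) (V : X.Opens) : Ideal ((chainRing f q).obj.obj (op V)) :=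
  (barIdeal f q V).map ((fromBar f q).hom.app (op V)).hom

lemma chainIdeal_le_res (q : SimplexCategoryᵒᵖ) {V W : X.Opens} (h : W ≤ V) :
    chainIdeal f q V ≤
      (chainIdeal f q W).comap ((chainRing f q).obj.map (homOfLE h).op).hom := by
  refine Ideal.map_le_iff_le_comap.mpr fun a ha => ?_
  have h1 := congr($((fromBar f q).hom.naturality (homOfLE h).op).hom a)
  have h2 := congr($((augmentation f q).hom.naturality (homOfLE h).op).hom a)
  refine (congrArg (· ∈ chainIdeal f q W) h1).mp (Ideal.mem_map_of_mem _ ?_)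
  refine h2.trans ?_
  exact (congrArg _ (RingHom.mem_ker.mp ha)).trans (RingHom.map_zero _)

lemma chainIdeal_le_map {p q : SimplexCategoryᵒᵖ} (θ : p ⟶ q) (V : X.Opens) :
    chainIdeal f p V ≤
      (chainIdeal f q V).comap ((chainRingMap f θ).hom.app (op V)).hom := by
  refine Ideal.map_le_iff_le_comap.mpr fun a ha => ?_
  have h1 := congr(($(fromBar_chainRingMap f θ).hom.app (op V)).hom a)
  have h2 := congr(($(map_augmentation f θ).hom.app (op V)).hom a)
  refine (congrArg (· ∈ chainIdeal f q V) h1.symm).mp (Ideal.mem_map_of_mem _ ?_)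
  exact h2.trans (RingHom.mem_ker.mp ha)

lemma continuous_adicTopology {A B : Type*} [CommRing A] [CommRing B] (φ : A →+* B) (I : Ideal A)
    (J : Ideal B) (h : I ≤ J.comap φ) : Continuous[I.adicTopology, J.adicTopology] φ := by
  let := I.adicTopology
  let := J.adicTopology
  refine continuous_of_continuousAt_zero φ ?_
  rw [ContinuousAt, map_zero, I.hasBasis_nhds_zero_adic.tendsto_iff J.hasBasis_nhds_zero_adic]
  exact fun n _ => ⟨n, trivial, fun x hx =>
    ((Ideal.pow_right_mono h n).trans (Ideal.le_comap_pow φ n)) hx⟩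

end Bar

section Chains

variable {S X : Scheme.{u}}

/-- A sheaf of `𝒪_X`-algebras as an `𝒪_X`-module. -/
def algebraModule {A : TopCat.Sheaf CommRingCat.{u} X} (φ : X.sheaf ⟶ A) : X.Modules :=
  (SheafOfModules.restrictScalars
    ((sheafCompose (Opens.grothendieckTopology X) (forget₂ CommRingCat.{u} RingCat.{u})).map φ)).obj
    (SheafOfModules.unit _)

/-- The morphism of modules given by a morphism of sheaves of algebras. -/
def algebraModuleMap {A A' : TopCat.Sheaf CommRingCat.{u} X} {φ : X.sheaf ⟶ A} {φ' : X.sheaf ⟶ A'}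
    (g : A ⟶ A') (h : φ ≫ g = φ') : algebraModule φ ⟶ algebraModule φ' where
  val := PresheafOfModules.homMk 
    (Functor.whiskerRight g.hom (forget₂ CommRingCat.{u} RingCat.{u} ⋙ forget₂ RingCat.{u} Ab.{u})) (by
    intro U r a
    have h1 := congr(($(h).hom.app U).hom r)
    refine (RingHom.map_mul (g.hom.app U).hom ((φ.hom.app U).hom r) a).trans ?_
    exact congrArg (· * (g.hom.app U).hom a) h1)

variable (f : X ⟶ S)

/-- The sheaf `Ĉ_q` of complete Hochschild chains as a topologized `𝒪_X`-module: the sections over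
an affine open subset carry the adic topology of the ideal generated by the functions on the
completion of `X^{q + 2}` which vanish on the diagonal. -/
def chainModule (q : SimplexCategoryᵒᵖ) : TopModule X where
  mod := algebraModule (fromBase f q)
  top V := (chainIdeal f q V.1).adicTopology
  continuous_res h := continuous_adicTopology ((chainRing f q).obj.map (homOfLE h).op).hom _ _
    (chainIdeal_le_res f q h)

/-- The complete Hochschild chains, as a simplicial topologized `𝒪_X`-module. -/
def completeChains : SimplexCategoryᵒᵖ ⥤ TopModule X where
  obj := chainModule f
  map {p q} θ := 
    { hom := algebraModuleMap (chainRingMap f θ) (fromBase_chainRingMap f θ)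
      continuous_app V := continuous_adicTopology ((chainRingMap f θ).hom.app (op V.1)).hom _ _
        (chainIdeal_le_map f θ V.1) }
  map_id q := by
    ext U a
    exact congr(($(chainRingMap_id f q).hom.app (op U)).hom a)
  map_comp θ η := by
    ext U a
    exact congr(($(chainRingMap_comp f θ η).hom.app (op U)).hom a)

end Chains

section Cochains

variable {S X : Scheme.{u}} (f : X ⟶ S)

/-- The functor sending an `𝒪_X`-module `M` to the cosimplicial `𝒪_X`-module
`q ↦ 𝓗om^cont_{𝒪_X}(Ĉ_q, M)`. -/
def cosimplicialCochains : X.Modules ⥤ CosimplicialObject X.Modules :=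
  ((completeChains f).rightOp ⋙ contHom X).flip

/-- The functor sending an `𝒪_X`-module `M` to the complex of continuous Hochschild cochains
`𝓗om^cont_{𝒪_X}(Ĉ(X), M)`, with `𝓗om^cont_{𝒪_X}(Ĉ_q, M)` in degree `q ≥ 0` and the alternating sum
of the coface maps as differential. -/
def cochains : X.Modules ⥤ CochainComplex X.Modules ℤ :=
  cosimplicialCochains f ⋙ AlgebraicTopology.alternatingCofaceMapComplex X.Modules ⋙
    ComplexShape.embeddingUpNat.extendFunctor X.Modules

variable [HasDerivedCategory.{w} (power f 2).Modules]

/-- The complex of continuous Hochschild cochains, as a functor to the derived category of modules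
on `X ×_S X`. -/
def derivedCochains : X.Modules ⥤ DerivedCategory (power f 2).Modules :=
  cochains f ⋙ (Scheme.Modules.pushforward (diag f 2)).mapHomologicalComplex _ ⋙
    DerivedCategory.Q

/-- The functor `M ↦ R𝓗om_{𝒪_{X ×_S X}}(𝒪_X, M)`, where `𝒪_X` and `M` are regarded as modules
on `X ×_S X` by push-forward along the diagonal embedding. -/
def derivedHom : X.Modules ⥤ DerivedCategory (power f 2).Modules :=
  Scheme.Modules.pushforward (diag f 2) ⋙ DerivedCategory.Plus.singleFunctor _ 0 ⋙
    (sheafHom ((Scheme.Modules.pushforward (diag f 2)).obj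
      (SheafOfModules.unit X.ringCatSheaf))).rightDerivedFunctorPlus ⋙
    DerivedCategory.Plus.ι

end Cochains

end ContHochschild

end

/-! Let `H^q(M)` be the sheaf of continuous homomorphisms from `B̂_q` to `M` which are linear for
the first tensor factor (`barHomObj`). It is a module over the functions on `X²`, acting through the
two outer factors of `B̂_q`. Three facts give the theorem.

Adjunction. A homomorphism from the push-forward of `𝒪_X` to `H^q(M)` is determined by the image of
`1`. This image is killed by all functions on `X²` which vanish on the diagonal, and so it factors
through `Ĉ_q = B̂_q ⊗_{B̂_0} 𝒪_X`. Hence `𝓗om(𝒪_X, H^q(M))` is the push-forward of `𝓗om^cont(Ĉ_q,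
M)`, compatibly with the cosimplicial structures (`comparison`, `comparison_naturality`).

Resolution. The complex `0 → M → H^0(M) → H^1(M) → ⋯` is exact on `X²` (`exact_coaugmentation`,
`exact_objD`). The insertion of `1` in the last slot of the bar construction is an extra degeneracy.
It respects only the first outer factor, so it is not a contraction of modules on `X²`, but
exactness needs it only as a map on sections.

Acyclicity. The modules `H^q(M)` compute the derived functors of `𝓗om(𝒪_X, -)`. Near the diagonal,
étale coordinates `x_j` on `X` provide the functions `t_j = 1 ⊗ x_j - x_j ⊗ 1`, a regular sequence
which generates the ideal of the diagonal (`IsChart.exists_isCoord`). Call a module divisible if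
each `t_j` acts locally surjectively on the sections killed by the preceding ones (`LocDivisible`).
Injective modules are divisible because the sequence is regular, divisibility passes to cokernels of
monomorphisms, and along an epimorphism with divisible kernel the sections killed by all `t_j` lift
locally. Such sections are the local homomorphisms from `𝒪_X`, so `𝓗om(𝒪_X, -)` is exact on
divisible modules (`isAdapted_sheafHom`).

That `H^q(M)` is divisible is a computation with power series. By infinitesimal lifting for étale
coordinates, `B̂_q` modulo a power of its augmentation ideal is over a chart a truncated polynomial
ring in the coordinate differences (`polyHom_nbhd`, `ker_eq_map_pow`). A continuous homomorphism `φ`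
sees only finitely many coefficients, so it can be composed with the division of polynomials by a
variable. The result `ψ` satisfies `X_i ψ = φ` and is still killed by every other variable which
kills `φ` (`IsChart.exists_divided`). The functions `t_j` act on `H^q(M)` as variables.

Since `M` is arbitrary and sections of `B̂_q` and `Ĉ_q` are controlled only locally, homomorphisms
are mostly constructed from their graphs, which may be given locally (`exists_family_of_graph`). -/

noncomputable section

namespace ContHochschild

/-! ### Derived functors computed by an adapted class of objects. -/

section Adapted

open ZeroObject

variable {C D : Type*} [Category* C] [Category* D] [Abelian C] [Abelian D]

/-- A class of objects which is adapted to an additive functor `F`: it contains the injective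
objects, it is closed under cokernels of monomorphisms, and `F` is exact on it. -/
structure IsAdapted (F : C ⥤ D) [F.Additive] (P : ObjectProperty C) : Prop where
  injective (I : C) [Injective I] : P I
  of_shortExact {T : ShortComplex C} : T.ShortExact → P T.X₁ → P T.X₂ → P T.X₃
  map_shortExact {T : ShortComplex C} : T.ShortExact → P T.X₁ → P T.X₂ → (T.map F).ShortExact

variable {F : C ⥤ D} [F.Additive] {P : ObjectProperty C} (hP : IsAdapted F P)

-- An isomorphism out of `A` is a cokernel of the monomorphism from the zero object, which is
-- injective.
include hP in
lemma IsAdapted.of_iso {A B : C} (e : A ≅ B) (h : P A) : P B := by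
  have hT : (ShortComplex.mk (0 : (0 : C) ⟶ A) e.hom (by simp)).ShortExact :=
    { exact := (ShortComplex.exact_iff_mono _ rfl).mpr inferInstance
      mono_f := inferInstance
      epi_g := inferInstance }
  have : Injective (0 : C) := (isZero_zero C).injective
  exact hP.of_shortExact hT (hP.injective 0) h

/-- In an acyclic complex, the cycles and the next cycles fit in a short exact sequence. -/
lemma shortExact_cycles {K : CochainComplex C ℤ} (hK : K.Acyclic) (n : ℤ) :
    (ShortComplex.mk (K.iCycles n) (K.toCycles n (n + 1)) (by
      rw [← cancel_mono (K.iCycles _), Category.assoc, K.toCycles_i, K.iCycles_d,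
        zero_comp])).ShortExact where
  exact := by
    refine ShortComplex.exact_of_f_is_kernel _ (KernelFork.IsLimit.ofι' _ _ fun k hk => ?_)
    have hk' : k ≫ K.d n (n + 1) = 0 := by
      have := congrArg (· ≫ K.iCycles (n + 1)) hk
      simpa using this
    exact ⟨K.liftCycles k (n + 1) (by simp) hk', by simp⟩
  mono_f := inferInstance
  epi_g := by
    have h : Epi (K.sc (n + 1)).toCycles := ShortComplex.Exact.epi_toCycles (hK (n + 1))
    have key (m : ℤ) (hm : (ComplexShape.up ℤ).prev (n + 1) = m) :
        Epi (K.toCycles m (n + 1)) := by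
      subst hm
      exact h
    exact key n (by simp)

-- By `shortExact_cycles` the cycles in degree `n + 1` are the cokernel of the cycles in degree `n`
-- inside `K.X n`. The bound below starts the induction.
include hP in
lemma IsAdapted.cycles {K : CochainComplex C ℤ} (hK : K.Acyclic) (n₀ : ℤ) [K.IsStrictlyGE n₀]
    (h : ∀ n, P (K.X n)) (n : ℤ) : P (K.cycles n) := by
  -- The induction starts at `n₀ - 1`, where the complex vanishes and the cycles are a zero object,
  -- hence injective.
  have key (m : ℕ) : P (K.cycles (n₀ - 1 + m)) := by
    induction m with
    | zero =>
      have h0 : IsZero (K.X (n₀ - 1 + (0 : ℕ))) := K.isZero_of_isStrictlyGE n₀ _ (by simp)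
      have h1 : IsZero (K.cycles (n₀ - 1 + (0 : ℕ))) :=
        IsZero.of_mono (K.iCycles _) h0
      have := h1.injective
      exact hP.injective _
    | succ m hm =>
      have := hP.of_shortExact (shortExact_cycles hK (n₀ - 1 + m)) hm (h _)
      convert this using 2
      push_cast
      ring
  by_cases hn : n₀ - 1 ≤ n
  · obtain ⟨m, hm⟩ := Int.le.dest hn
    exact hm ▸ key m
  · have h0 : IsZero (K.X n) := K.isZero_of_isStrictlyGE n₀ _ (by lia)
    have h1 : IsZero (K.cycles n) := IsZero.of_mono (K.iCycles _) h0
    have := h1.injective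
    exact hP.injective _

include hP in
/-- A functor preserves the acyclicity of bounded below complexes of objects of an adapted class. -/
lemma IsAdapted.acyclic_map {K : CochainComplex C ℤ} (hK : K.Acyclic) (n₀ : ℤ)
    [K.IsStrictlyGE n₀] (h : ∀ n, P (K.X n)) :
    HomologicalComplex.Acyclic ((F.mapHomologicalComplex (ComplexShape.up ℤ)).obj K) := by
  intro n
  obtain ⟨n, rfl⟩ : ∃ m, n = m + 1 := ⟨n - 1, by ring⟩
  rw [HomologicalComplex.exactAt_iff' _ n (n + 1) (n + 1 + 1) (by simp) (by simp)]
  have hc (m : ℤ) := hP.map_shortExact (shortExact_cycles hK m) (hP.cycles hK n₀ h m) (h m)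
  have h₁ := hc n
  have h₂ := hc (n + 1)
  have h₃ := hc (n + 1 + 1)
  have hepi : Epi (F.map (K.toCycles n (n + 1))) := h₁.epi_g
  have hmono : Mono (F.map (K.iCycles (n + 1 + 1))) := h₃.mono_f
  -- `T` interpolates between the image of the short exact sequence of cycles and the image of the
  -- complex itself. It is exact because `F` keeps the last inclusion of cycles a monomorphism. Its
  -- first object may then be replaced by `F.map` of the preceding term, which surjects onto it.
  let T : ShortComplex D := ShortComplex.mk (F.map (K.iCycles (n + 1)))
    (F.map (K.d (n + 1) (n + 1 + 1))) (by rw [← F.map_comp, K.iCycles_d, F.map_zero])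
  let g₁ : (ShortComplex.mk (K.iCycles (n + 1)) (K.toCycles (n + 1) (n + 1 + 1)) (by
      rw [← cancel_mono (K.iCycles _), Category.assoc, K.toCycles_i, K.iCycles_d,
        zero_comp])).map F ⟶ T :=
    { τ₁ := 𝟙 _
      τ₂ := 𝟙 _
      τ₃ := F.map (K.iCycles (n + 1 + 1))
      comm₁₂ := (Category.id_comp _).trans (Category.comp_id _).symm
      comm₂₃ := (Category.id_comp _).trans
        ((congrArg F.map (K.toCycles_i _ _).symm).trans (F.map_comp _ _)) }
  have : Epi g₁.τ₁ := inferInstanceAs (Epi (𝟙 _))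
  have : IsIso g₁.τ₂ := inferInstanceAs (IsIso (𝟙 _))
  have : Mono g₁.τ₃ := hmono
  have hT : T.Exact := (ShortComplex.exact_iff_of_epi_of_isIso_of_mono g₁).mp h₂.exact
  let g₂ : HomologicalComplex.sc' ((F.mapHomologicalComplex (ComplexShape.up ℤ)).obj K)
      n (n + 1) (n + 1 + 1) ⟶ T :=
    { τ₁ := F.map (K.toCycles n (n + 1))
      τ₂ := 𝟙 _
      τ₃ := 𝟙 _
      comm₁₂ := ((F.map_comp _ _).symm.trans (congrArg F.map (K.toCycles_i _ _))).trans
        (Category.comp_id _).symm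
      comm₂₃ := (Category.id_comp _).trans (Category.comp_id _).symm }
  have : IsIso g₂.τ₂ := inferInstanceAs (IsIso (𝟙 _))
  have : Mono g₂.τ₃ := inferInstanceAs (Mono (𝟙 _))
  have : Epi g₂.τ₁ := hepi
  exact (ShortComplex.exact_iff_of_epi_of_isIso_of_mono g₂).mpr hT

variable [HasDerivedCategory C] [HasDerivedCategory D] [EnoughInjectives C]

/-- The derived functor is computed by bounded below complexes of objects of an adapted class. -/
lemma IsAdapted.isIso_unit (hP : IsAdapted F P) (K : CochainComplex.Plus C)
    (h : ∀ n, P (K.obj.X n)) :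
    IsIso (F.rightDerivedFunctorPlusUnit.app ((HomotopyCategory.Plus.quotient C).obj K)) := by
  obtain ⟨K, n₁, hn₁⟩ := K
  -- The statement is known for complexes of injectives. Choosing the quasi-isomorphism `i` to be a
  -- monomorphism makes its cokernel a bounded below acyclic complex of objects of `P`, so that `F`
  -- keeps it acyclic and keeps `i` a quasi-isomorphism.
  obtain ⟨L, i, hi, hi', hL, hL'⟩ :=
    CochainComplex.Plus.modelCategoryQuillen.exists_mono_quasiIso_injective K (n₁ - 1) n₁
  let T : ShortComplex (CochainComplex C ℤ) := ShortComplex.mk i (cokernel.π i) (by simp)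
  have hT : T.ShortExact :=
    { exact := ShortComplex.exact_cokernel i
      mono_f := hi
      epi_g := inferInstance }
  have hTn (n : ℤ) := (HomologicalComplex.shortExact_iff_degreewise_shortExact T).mp hT n
  have hC : T.X₃.Acyclic := hT.acyclic_X₃ hi'
  have hPC (n : ℤ) : P (T.X₃.X n) := hP.of_shortExact (hTn n) (h n) (hP.injective (L.X n))
  have : T.X₃.IsStrictlyGE (n₁ - 1) := by
    rw [CochainComplex.isStrictlyGE_iff]
    intro m hm
    have := (hTn m).epi_g
    exact IsZero.of_epi (T.g.f m) (L.isZero_of_isStrictlyGE (n₁ - 1) m hm)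
  have hFC := hP.acyclic_map hC (n₁ - 1) hPC
  have hFT : (T.map (F.mapHomologicalComplex (ComplexShape.up ℤ))).ShortExact :=
    HomologicalComplex.shortExact_of_degreewise_shortExact _ fun n =>
      hP.map_shortExact (hTn n) (h n) (hP.injective (L.X n))
  have hq : QuasiIso ((F.mapHomologicalComplex (ComplexShape.up ℤ)).map i) := by
    have hz (m : ℤ) : IsZero ((T.map (F.mapHomologicalComplex (ComplexShape.up ℤ))).X₃.homology m) :=
      (hFC m).isZero_homology
    rw [quasiIso_iff]
    intro m
    rw [quasiIsoAt_iff_isIso_homologyMap]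
    have hmono : Mono (HomologicalComplex.homologyMap
        ((F.mapHomologicalComplex (ComplexShape.up ℤ)).map i) m) :=
      (hFT.homology_exact₁ (m - 1) m (by simp)).mono_g ((hz (m - 1)).eq_of_src _ _)
    have hepi : Epi (HomologicalComplex.homologyMap
        ((F.mapHomologicalComplex (ComplexShape.up ℤ)).map i) m) :=
      (hFT.homology_exact₂ m).epi_f ((hz m).eq_of_tgt _ _)
    exact isIso_of_mono_of_epi _
  let L' : CochainComplex.Plus (InjectiveObject C) :=
    ⟨HomologicalComplex.liftObjectProperty _ L hL, n₁ - 1, by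
      rwa [← CochainComplex.isStrictlyGE_mapHomologicalComplex_obj_iff _ (InjectiveObject.ι _)]⟩
  let K' : CochainComplex.Plus C := ⟨K, n₁, hn₁⟩
  let j : K' ⟶ (InjectiveObject.ι C).mapCochainComplexPlus.obj L' := ObjectProperty.homMk i
  let α := F.rightDerivedFunctorPlusUnit
  have hL₁ : IsIso (α.app ((HomotopyCategory.Plus.quotient C).obj
    ((InjectiveObject.ι C).mapCochainComplexPlus.obj L'))) := inferInstance
  -- Naturality of the unit along `i`: three of the four sides of the square are isomorphisms, hence
  -- so is the unit at `K`.
  have nat := α.naturality ((HomotopyCategory.Plus.quotient C).map j)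
  have h₁ : IsIso (DerivedCategory.Plus.Qh.map ((HomotopyCategory.Plus.quotient C).map j)) :=
    Localization.inverts _ (HomotopyCategory.Plus.quasiIso C) _
      ((HomotopyCategory.quotient_map_mem_quasiIso_iff i).mpr hi')
  have h₂ : IsIso (DerivedCategory.Plus.Qh.map
      (F.mapHomotopyCategoryPlus.map ((HomotopyCategory.Plus.quotient C).map j))) :=
    Localization.inverts _ (HomotopyCategory.Plus.quasiIso D) _
      ((HomotopyCategory.quotient_map_mem_quasiIso_iff
        ((F.mapHomologicalComplex (ComplexShape.up ℤ)).map i)).mpr hq)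
  have h₃ : IsIso (α.app ((HomotopyCategory.Plus.quotient C).obj K') ≫
      (DerivedCategory.Plus.Qh ⋙ F.rightDerivedFunctorPlus).map
        ((HomotopyCategory.Plus.quotient C).map j)) := by
    rw [← nat, Functor.comp_map]
    infer_instance
  have h₄ : IsIso ((DerivedCategory.Plus.Qh ⋙ F.rightDerivedFunctorPlus).map
        ((HomotopyCategory.Plus.quotient C).map j)) := by
    rw [Functor.comp_map]
    infer_instance
  exact IsIso.of_isIso_comp_right _ ((DerivedCategory.Plus.Qh ⋙ F.rightDerivedFunctorPlus).map
        ((HomotopyCategory.Plus.quotient C).map j))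

/-- The derived functor of `F` can be computed by a functorial resolution by bounded below
complexes of objects of an adapted class. -/
lemma IsAdapted.nonempty_iso (hP : IsAdapted F P) {E : Type*} [Category* E] (S : E ⥤ C)
    (R : E ⥤ CochainComplex C ℤ) (η : S ⋙ CochainComplex.singleFunctor C 0 ⟶ R)
    (hη : ∀ M, QuasiIso (η.app M)) (hR : ∀ M, (R.obj M).IsStrictlyGE 0)
    (h : ∀ M n, P ((R.obj M).X n)) :
    Nonempty (R ⋙ F.mapHomologicalComplex (ComplexShape.up ℤ) ⋙ DerivedCategory.Q ≅
      S ⋙ DerivedCategory.Plus.singleFunctor C 0 ⋙ F.rightDerivedFunctorPlus ⋙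
        DerivedCategory.Plus.ι) := by
  let R' : E ⥤ CochainComplex.Plus C := ObjectProperty.lift _ R fun M => ⟨0, hR M⟩
  let α := Functor.whiskerLeft (R' ⋙ HomotopyCategory.Plus.quotient C) F.rightDerivedFunctorPlusUnit
  have hα : IsIso α := by
    have (M : E) : IsIso (α.app M) := hP.isIso_unit (R'.obj M) (h M)
    exact NatIso.isIso_of_isIso_app α
  -- In the bounded below derived category the quasi-isomorphisms `η` identify `S` in degree zero
  -- with the resolution `R`, while `α` identifies the derived functor of `R` with `F` applied
  -- termwise.
  let β : S ⋙ DerivedCategory.Plus.singleFunctor C 0 ⟶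
      R' ⋙ HomotopyCategory.Plus.quotient C ⋙ DerivedCategory.Plus.Qh :=
    { app M := ObjectProperty.homMk ((DerivedCategory.singleFunctorIsoCompQ C 0).hom.app _ ≫
        DerivedCategory.Q.map (η.app M))
      naturality M N g := by
        ext
        exact (Category.assoc _ _ _).symm.trans
          ((congrArg (· ≫ DerivedCategory.Q.map (η.app N))
            ((DerivedCategory.singleFunctorIsoCompQ C 0).hom.naturality (S.map g))).trans
          ((Category.assoc _ _ _).trans ((congrArg (_ ≫ ·)
            ((DerivedCategory.Q.map_comp _ _).symm.trans ((congrArg DerivedCategory.Q.map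
              (η.naturality g)).trans (DerivedCategory.Q.map_comp _ _)))).trans
                (Category.assoc _ _ _).symm))) }
  have hβ : IsIso β := by
    have (M : E) : IsIso (β.app M) := by
      have := hη M
      have : IsIso (DerivedCategory.Plus.ι.map (β.app M)) :=
        inferInstanceAs (IsIso ((DerivedCategory.singleFunctorIsoCompQ C 0).hom.app (S.obj M) ≫
          DerivedCategory.Q.map (η.app M)))
      exact isIso_of_fully_faithful DerivedCategory.Plus.ι _
    exact NatIso.isIso_of_isIso_app β
  let e₁ : R ⋙ F.mapHomologicalComplex (ComplexShape.up ℤ) ⋙ DerivedCategory.Q ≅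
      ((R' ⋙ HomotopyCategory.Plus.quotient C) ⋙ F.mapHomotopyCategoryPlus ⋙
        DerivedCategory.Plus.Qh) ⋙ DerivedCategory.Plus.ι := Iso.refl _
  let e₂ := Functor.isoWhiskerRight (asIso α) DerivedCategory.Plus.ι
  let e₃ := Functor.isoWhiskerRight (asIso β) (F.rightDerivedFunctorPlus ⋙ DerivedCategory.Plus.ι)
  exact ⟨e₁ ≪≫ e₂ ≪≫ e₃.symm⟩

end Adapted

/-! ### Sections of sheaves of modules: local surjectivity, exactness, gluing. -/

section Sections

variable {Y : Scheme.{u}}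

/-- Restriction of functions. -/
def ores {U V : Y.Opens} (h : V ≤ U) : Γ(Y, U) →+* Γ(Y, V) := (Y.presheaf.map (homOfLE h).op).hom

@[simp]
lemma ores_ores {U V W : Y.Opens} (h : V ≤ U) (h' : W ≤ V) (x : Γ(Y, U)) :
    ores h' (ores h x) = ores (h'.trans h) x :=
  congr($(Y.presheaf.map_comp (homOfLE h).op (homOfLE h').op).hom x).symm

@[simp]
lemma ores_refl {U : Y.Opens} (x : Γ(Y, U)) : ores le_rfl x = x :=
  congr($(Y.presheaf.map_id (op U)).hom x)

/-- Restriction of sections. -/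
def res (M : Y.Modules) {U V : Y.Opens} (h : V ≤ U) : Γ(M, U) →+ Γ(M, V) :=
  (M.presheaf.map (homOfLE h).op).hom

variable {M N : Y.Modules}

@[simp]
lemma res_res {U V W : Y.Opens} (h : V ≤ U) (h' : W ≤ V) (x : Γ(M, U)) :
    res M h' (res M h x) = res M (h'.trans h) x :=
  congr($(M.presheaf.map_comp (homOfLE h).op (homOfLE h').op).hom x).symm

@[simp]
lemma res_refl {U : Y.Opens} (x : Γ(M, U)) : res M le_rfl x = x :=
  congr($(M.presheaf.map_id (op U)).hom x)

@[simp]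
lemma res_smul {U V : Y.Opens} (h : V ≤ U) (r : Γ(Y, U)) (x : Γ(M, U)) :
    res M h (r • x) = ores h r • res M h x :=
  M.map_smul (homOfLE h) r x

lemma app_res (φ : M ⟶ N) {U V : Y.Opens} (h : V ≤ U) (x : Γ(M, U)) :
    φ.app V (res M h x) = res N h (φ.app U x) :=
  congr($(φ.mapPresheaf.naturality (homOfLE h).op) x)

lemma eq_of_locally {U : Y.Opens} {x x' : Γ(M, U)}
    (H : ∀ y ∈ U, ∃ (V : Y.Opens) (h : V ≤ U), y ∈ V ∧ res M h x = res M h x') : x = x' := by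
  let FM : TopCat.Sheaf Ab Y := ⟨M.presheaf, M.isSheaf⟩
  choose V h hy hV using H
  exact FM.eq_of_locally_eq' (fun y : U => V y.1 y.2) U (fun y => homOfLE (h _ _))
    (fun y hy' => Opens.mem_iSup.mpr ⟨⟨y, hy'⟩, hy _ _⟩) _ _ fun y => hV _ _

lemma eq_zero_of_locally {U : Y.Opens} {x : Γ(M, U)}
    (H : ∀ y ∈ U, ∃ (V : Y.Opens) (h : V ≤ U), y ∈ V ∧ res M h x = 0) : x = 0 :=
  eq_of_locally fun y hy => by
    obtain ⟨V, h, hV, h0⟩ := H y hy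
    exact ⟨V, h, hV, by rw [h0, map_zero]⟩

lemma ores_eq_of_locally {U : Y.Opens} {x x' : Γ(Y, U)}
    (H : ∀ y ∈ U, ∃ (V : Y.Opens) (h : V ≤ U), y ∈ V ∧ ores h x = ores h x') : x = x' := by
  choose V h hy hV using H
  exact Y.sheaf.eq_of_locally_eq' (fun y : U => V y.1 y.2) U (fun y => homOfLE (h _ _))
    (fun y hy' => Opens.mem_iSup.mpr ⟨⟨y, hy'⟩, hy _ _⟩) _ _ fun y => hV _ _

lemma exists_glue {U : Y.Opens} (V : U → Y.Opens) (hV : ∀ y, V y ≤ U) (hy : ∀ y, y.1 ∈ V y)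
    (s : ∀ y, Γ(M, V y))
    (H : ∀ (y z) (W : Y.Opens) (h : W ≤ V y) (h' : W ≤ V z), res M h (s y) = res M h' (s z)) :
    ∃ x : Γ(M, U), ∀ y, res M (hV y) x = s y := by
  let FM : TopCat.Sheaf Ab Y := ⟨M.presheaf, M.isSheaf⟩
  obtain ⟨x, hx, -⟩ := FM.existsUnique_gluing' V U (fun y => homOfLE (hV y))
    (fun y hy' => Opens.mem_iSup.mpr ⟨⟨y, hy'⟩, hy _⟩) s
    (fun y z => H y z _ inf_le_left inf_le_right)
  exact ⟨x, hx⟩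

lemma injective_app_of_mono (φ : M ⟶ N) [Mono φ] (U : Y.Opens) :
    Function.Injective (φ.app U) := by
  have : Mono ((Scheme.Modules.toPresheaf Y).map φ) := inferInstance
  exact (AddCommGrpCat.mono_iff_injective _).mp ((NatTrans.mono_iff_mono_app _).mp this (op U))

lemma mono_of_injective_app (φ : M ⟶ N) (h : ∀ U, Function.Injective (φ.app U)) : Mono φ where
  right_cancellation f g e := by
    ext U x
    exact h U congr(($e).app U x)

/-- A morphism of sheaves of modules is locally surjective. -/
def IsLocSurj (φ : M ⟶ N) : Prop :=
  ∀ (U : Y.Opens) (x : Γ(N, U)), ∀ y ∈ U, ∃ (V : Y.Opens) (h : V ≤ U) (s : Γ(M, V)),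
    y ∈ V ∧ φ.app V s = res N h x

lemma IsLocSurj.epi {φ : M ⟶ N} (h : IsLocSurj φ) : Epi φ where
  left_cancellation {P} f g e := by
    ext U x
    refine eq_of_locally fun y hy => ?_
    obtain ⟨V, hV, s, hyV, hs⟩ := h U x y hy
    refine ⟨V, hV, hyV, ?_⟩
    rw [← app_res, ← app_res, ← hs]
    exact congr(($e).app V s)

/-- If the sheafification of a presheaf of modules is trivial, then its sections are locally
trivial. -/
lemma eq_zero_locally_of_toSheafify (P : PresheafOfModules.{u} Y.ringCatSheaf.obj) {U : Y.Opens}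
    (x : P.presheaf.obj (op U)) (h : (CategoryTheory.toSheafify
      (Opens.grothendieckTopology Y) P.presheaf).app (op U) x = 0) (y : Y) (hy : y ∈ U) :
    ∃ (V : Y.Opens) (h : V ≤ U), y ∈ V ∧ P.presheaf.map (homOfLE h).op x = 0 := by
  have := Presheaf.isLocallyInjective_toSheafify' (Opens.grothendieckTopology Y) P.presheaf
  obtain ⟨V, i, hi, hyV⟩ := Presheaf.equalizerSieve_mem (Opens.grothendieckTopology Y)
    (CategoryTheory.toSheafify (Opens.grothendieckTopology Y) P.presheaf) x 0
      (by rw [h, map_zero]) y hy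
  refine ⟨V, i.le, hyV, ?_⟩
  exact (show P.presheaf.map i.op x = P.presheaf.map i.op 0 from hi).trans (map_zero _)

/-- The composite of `N` to the presheaf cokernel and on to its sheafification vanishes because `φ`
is an epimorphism. A section of `N` is therefore locally zero in the presheaf cokernel, which means
that it lifts locally. -/
lemma isLocSurj_of_epi (φ : M ⟶ N) [Epi φ] : IsLocSurj φ := by
  intro U x y hy
  let p := cokernel.π φ.val
  let unit := (PresheafOfModules.sheafificationAdjunction (𝟙 Y.ringCatSheaf.obj)).unit.app
    (cokernel φ.val)
  let Z : Y.Modules :=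
    (PresheafOfModules.sheafification (𝟙 Y.ringCatSheaf.obj)).obj (cokernel φ.val)
  let g : N ⟶ Z := ⟨p ≫ unit⟩
  have hg : g = 0 := by
    rw [← cancel_epi φ, comp_zero]
    apply SheafOfModules.hom_ext
    exact (cokernel.condition_assoc φ.val unit).trans zero_comp
  obtain ⟨V, h, hyV, hV⟩ := eq_zero_locally_of_toSheafify (cokernel φ.val) (p.app (op U) x)
    congr($(hg).app U x) y hy
  have hV' : p.app (op V) (res N h x) = 0 := by
    refine Eq.trans ?_ hV
    exact congr($(((PresheafOfModules.toPresheaf _).map p).naturality (homOfLE h).op) x)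
  have hex : (ShortComplex.mk φ.val p (cokernel.condition _)).Exact :=
    ShortComplex.exact_cokernel _
  have hex' := (ShortComplex.moduleCat_exact_iff _).mp
    (hex.map (PresheafOfModules.evaluation _ (op V)))
  obtain ⟨s, hs⟩ := hex' _ hV'
  exact ⟨V, h, s, hyV, hs⟩

/-- Left exactness of sections: the forgetful functor to presheaves of modules preserves kernels. -/
lemma exists_app_eq_of_shortExact {T : ShortComplex Y.Modules} (hT : T.ShortExact) {U : Y.Opens}
    (x : Γ(T.X₂, U)) (hx : T.g.app U x = 0) : ∃ x', T.f.app U x' = x := by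
  have := hT.mono_f
  have hex := hT.exact.map_of_mono_of_preservesKernel (Scheme.Modules.toPresheafOfModules Y)
    inferInstance inferInstance
  have hex' := (ShortComplex.moduleCat_exact_iff _).mp
    (hex.map (PresheafOfModules.evaluation _ (op U)))
  obtain ⟨s, hs⟩ := hex' _ hx
  exact ⟨s, hs⟩

/-- A complex of sheaves of modules is exact if it is locally exact. -/
lemma exact_of_locally {T : ShortComplex Y.Modules}
    (H : ∀ (U : Y.Opens) (x : Γ(T.X₂, U)), T.g.app U x = 0 → ∀ y ∈ U,
      ∃ (V : Y.Opens) (h : V ≤ U) (s : Γ(T.X₁, V)), y ∈ V ∧ T.f.app V s = res T.X₂ h x) :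
    T.Exact := by
  rw [ShortComplex.exact_iff_epi_kernel_lift]
  apply IsLocSurj.epi
  intro U x y hy
  obtain ⟨V, h, s, hyV, hs⟩ := H U ((kernel.ι T.g).app U x)
    congr($(kernel.condition T.g).app U x) y hy
  refine ⟨V, h, s, hyV, injective_app_of_mono (kernel.ι T.g) V ?_⟩
  rw [app_res, ← hs]
  exact congr($(kernel.lift_ι T.g T.f T.zero).app V s)

section Graph

/-- Families of linear maps which are compatible with restrictions can be given locally, by their
graphs. -/
lemma exists_family_of_graph {U : Y.Opens}
    (r : ∀ V : Y.Opens, V ≤ U → Submodule Γ(Y, V) (Γ(N, V) × Γ(M, V)))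
    (hres : ∀ {V W : Y.Opens} (hV : V ≤ U) (h : W ≤ V) {n m}, (n, m) ∈ r V hV →
      (res N h n, res M h m) ∈ r W (h.trans hV))
    (htot : ∀ {V : Y.Opens} (hV : V ≤ U) (n : Γ(N, V)), ∀ y ∈ V, ∃ (W : Y.Opens) (h : W ≤ V)
      (m : Γ(M, W)), y ∈ W ∧ (res N h n, m) ∈ r W (h.trans hV))
    (hzero : ∀ {V : Y.Opens} (hV : V ≤ U) (m : Γ(M, V)), (0, m) ∈ r V hV → m = 0) :
    ∃ φ : ∀ V : {V : Y.Opens // V ≤ U}, Γ(N, V.1) →ₗ[Γ(Y, V.1)] Γ(M, V.1),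
      (∀ (V W : {V : Y.Opens // V ≤ U}) (h : W.1 ≤ V.1) (s : Γ(N, V.1)),
        φ W (res N h s) = res M h (φ V s)) ∧
      ∀ (V : Y.Opens) (hV : V ≤ U) (n m), (n, m) ∈ r V hV → φ ⟨V, hV⟩ n = m := by
  have huniq {V : Y.Opens} (hV : V ≤ U) {n m m'} (h : (n, m) ∈ r V hV) (h' : (n, m') ∈ r V hV) :
      m = m' := by
    refine sub_eq_zero.mp (hzero hV _ ?_)
    have := (r V hV).sub_mem h h'
    rwa [Prod.mk_sub_mk, sub_self] at this
  -- The value at `n` is glued from the local values given by `htot`, which agree on overlaps by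
  -- `huniq`. It is recorded in the form that it restricts to every value related to a restriction
  -- of `n`, so that later identities can be checked locally.
  have ex {V : Y.Opens} (hV : V ≤ U) (n : Γ(N, V)) : ∃ m : Γ(M, V),
      ∀ {W : Y.Opens} (h : W ≤ V) {m'}, (res N h n, m') ∈ r W (h.trans hV) → res M h m = m' := by
    choose W hWV s hyW hs using fun y : V => htot hV n y.1 y.2
    obtain ⟨m, hm⟩ := exists_glue W hWV hyW s fun y z W' h h' => by
      have h1 := hres ((hWV y).trans hV) h (hs y)
      have h2 := hres ((hWV z).trans hV) h' (hs z)
      rw [res_res] at h1 h2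
      exact huniq _ h1 h2
    refine ⟨m, fun {W'} h {m'} hm' => eq_of_locally fun y hy => ?_⟩
    have h1 := hres ((hWV ⟨y, h hy⟩).trans hV) (inf_le_right : W' ⊓ W ⟨y, h hy⟩ ≤ _) (hs ⟨y, h hy⟩)
    have h2 := hres (h.trans hV) (inf_le_left : W' ⊓ W ⟨y, h hy⟩ ≤ _) hm'
    rw [res_res] at h1 h2
    refine ⟨_, inf_le_left, ⟨hy, hyW ⟨y, h hy⟩⟩, ?_⟩
    rw [← huniq _ h1 h2, ← hm, res_res, res_res]
  choose φ hφ using @ex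
  have char {V : Y.Opens} (hV : V ≤ U) {n : Γ(N, V)} {m : Γ(M, V)}
      (h : ∀ y ∈ V, ∃ (W : Y.Opens) (h : W ≤ V), y ∈ W ∧
        (res N h n, res M h m) ∈ r W (h.trans hV)) : φ hV n = m := by
    refine eq_of_locally fun y hy => ?_
    obtain ⟨W, hWV, hyW, hW⟩ := h y hy
    exact ⟨W, hWV, hyW, hφ hV n hWV hW⟩
  have mem {V : Y.Opens} (hV : V ≤ U) (n : Γ(N, V)) (y : Y) (hy : y ∈ V) :
      ∃ (W : Y.Opens) (h : W ≤ V), y ∈ W ∧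
        (res N h n, res M h (φ hV n)) ∈ r W (h.trans hV) := by
    obtain ⟨W, hWV, m, hyW, hm⟩ := htot hV n y hy
    refine ⟨W, hWV, hyW, ?_⟩
    rwa [hφ hV n hWV hm]
  refine ⟨fun V =>
    { toFun := φ V.2
      map_add' n n' := char _ fun y hy => ?_
      map_smul' a n := char _ fun y hy => ?_ }, fun V W h s => char _ fun y hy => ?_,
    fun V hV n m h => char _ fun y hy => ⟨V, le_rfl, hy, hres hV le_rfl h⟩⟩
  · obtain ⟨W, hWV, hyW, hW⟩ := mem V.2 n y hy
    obtain ⟨W', hWV', hyW', hW'⟩ := mem V.2 n' y hy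
    have h1 := hres (hWV.trans V.2) (inf_le_left : W ⊓ W' ≤ _) hW
    have h2 := hres (hWV'.trans V.2) (inf_le_right : W ⊓ W' ≤ _) hW'
    refine ⟨_, inf_le_left.trans hWV, ⟨hyW, hyW'⟩, ?_⟩
    have := Submodule.add_mem _ h1 h2
    simpa using this
  · obtain ⟨W, hWV, hyW, hW⟩ := mem V.2 n y hy
    refine ⟨W, hWV, hyW, ?_⟩
    have := Submodule.smul_mem _ (ores hWV a) hW
    simpa using this
  · obtain ⟨W', hWV, hyW, hW⟩ := mem V.2 s y (h hy)
    refine ⟨W' ⊓ W.1, inf_le_right, ⟨hyW, hy⟩, ?_⟩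
    have := hres (hWV.trans V.2) (inf_le_left : W' ⊓ W.1 ≤ _) hW
    simpa using this

end Graph

end Sections

/-! ### Evaluation of sections of the sheaves of homomorphisms. -/

section Evaluation

variable {Y : Scheme.{u}} {N : TopModule Y} {P M : Y.Modules} {U V V' : Y.Opens}

/-- A continuous homomorphism, as a linear map on the sections over an open subset. -/
def ev (φ : contHomOn N M U) (hV : V ≤ U) : Γ(N.mod, V) →ₗ[Γ(Y, V)] Γ(M, V) :=
  φ.1 ⟨V, hV⟩

lemma ev_res (φ : contHomOn N M U) (hV : V ≤ U) (h : V' ≤ V) (s : Γ(N.mod, V)) :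
    ev φ (h.trans hV) (res N.mod h s) = res M h (ev φ hV s) :=
  φ.2.1 ⟨V, hV⟩ ⟨V', h.trans hV⟩ h s

/-- A homomorphism from a discrete module, as a linear map on the sections over an open subset. -/
def dev (φ : contHomOn (discrete P) M U) (hV : V ≤ U) :
    Γ(P, V) →ₗ[Γ(Y, V)] Γ(M, V) :=
  φ.1 ⟨V, hV⟩

lemma dev_res (φ : contHomOn (discrete P) M U) (hV : V ≤ U) (h : V' ≤ V) (s : Γ(P, V)) :
    dev φ (h.trans hV) (res P h s) = res M h (dev φ hV s) :=
  φ.2.1 ⟨V, hV⟩ ⟨V', h.trans hV⟩ h s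

lemma dev_ext {φ ψ : contHomOn (discrete P) M U}
    (h : ∀ V (hV : V ≤ U) s, dev φ hV s = dev ψ hV s) : φ = ψ :=
  contHomOn_ext h

lemma exists_dev (φ : ∀ V : {V : Y.Opens // V ≤ U}, Γ(P, V.1) →ₗ[Γ(Y, V.1)] Γ(M, V.1))
    (h : ∀ (V W : {V : Y.Opens // V ≤ U}) (h : W.1 ≤ V.1) (s : Γ(P, V.1)),
      φ W (res P h s) = res M h (φ V s)) :
    ∃ ψ : contHomOn (discrete P) M U, ∀ V (hV : V ≤ U), dev ψ hV = φ ⟨V, hV⟩ :=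
  ⟨⟨φ, (mem_contHomOn_discrete _ _ _ _).mpr h⟩, fun _ _ => rfl⟩

end Evaluation

/-! ### Coordinate sequences and modules on which they act divisibly. -/

section Coordinates

variable {X Y : Scheme.{u}} (i : X ⟶ Y)

/-- The push-forward of the structure sheaf as a module. -/
abbrev pushUnit : Y.Modules :=
  (Scheme.Modules.pushforward i).obj (SheafOfModules.unit X.ringCatSheaf)

/-- A sequence `t` of functions on an open subset of `Y` which is regular and cuts out `X`, locally
on `Y`. -/
structure IsCoord {W : Y.Opens} {n : ℕ} (t : Fin n → Γ(Y, W)) : Prop where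
  vanish (j : Fin n) : i.app W (t j) = 0
  gen {V : Y.Opens} (hV : V ≤ W) (s : Γ(Y, V)) : i.app V s = 0 → ∀ y ∈ V,
    ∃ (V' : Y.Opens) (h : V' ≤ V), y ∈ V' ∧
      ores h s ∈ Ideal.span (Set.range fun j => ores (h.trans hV) (t j))
  surj {V : Y.Opens} (hV : V ≤ W) (a : Γ(X, i ⁻¹ᵁ V)) : ∀ y ∈ V,
    ∃ (V' : Y.Opens) (h : V' ≤ V) (s : Γ(Y, V')), y ∈ V' ∧ i.app V' s =
      ores (show i ⁻¹ᵁ V' ≤ i ⁻¹ᵁ V from fun _ hx => h hx) a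
  regular {V : Y.Opens} (hV : V ≤ W) (j : Fin n) (s : Γ(Y, V)) :
    ores hV (t j) * s ∈ Ideal.span ((fun k => ores hV (t k)) '' Set.Iio j) → ∀ y ∈ V,
    ∃ (V' : Y.Opens) (h : V' ≤ V), y ∈ V' ∧
      ores h s ∈ Ideal.span ((fun k => ores (h.trans hV) (t k)) '' Set.Iio j)

/-- A sheaf of modules on which a sequence of functions acts as if it were injective: each `t j`
acts locally surjectively on the sections which are killed by the preceding `t k`. -/
def LocDivisible {W : Y.Opens} {n : ℕ} (t : Fin n → Γ(Y, W)) (J : Y.Modules) : Prop :=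
  ∀ ⦃V : Y.Opens⦄ (hV : V ≤ W) (j : Fin n) (u : Γ(J, V)), (∀ k < j, ores hV (t k) • u = 0) →
    ∀ y ∈ V, ∃ (V' : Y.Opens) (h : V' ≤ V) (v : Γ(J, V')), y ∈ V' ∧
      (∀ k < j, ores (h.trans hV) (t k) • v = 0) ∧ ores (h.trans hV) (t j) • v = res J h u

variable {i}

/-- Induction on the number `m` of conditions. If `b` lifts `c` and is killed by the first `m`
functions, then `t m • b` maps to `0` and comes from a section `a` of the kernel killed by the same
functions. Dividing `a` by `t m` and subtracting the quotient from `b` makes the lift killed by `t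
m` as well. -/
lemma LocDivisible.lift {W : Y.Opens} {n : ℕ} {t : Fin n → Γ(Y, W)} {T : ShortComplex Y.Modules}
    (hT : T.ShortExact) (h : LocDivisible t T.X₁) (m : ℕ) {V : Y.Opens} (hV : V ≤ W)
    (c : Γ(T.X₃, V)) (hc : ∀ k : Fin n, k.1 < m → ores hV (t k) • c = 0) (y : Y) (hy : y ∈ V) :
    ∃ (V' : Y.Opens) (h : V' ≤ V) (b : Γ(T.X₂, V')), y ∈ V' ∧
      (∀ k : Fin n, k.1 < m → ores (h.trans hV) (t k) • b = 0) ∧ T.g.app V' b = res _ h c := by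
  have := hT.epi_g
  have := hT.mono_f
  have hfg {V : Y.Opens} (a : Γ(T.X₁, V)) : T.g.app V (T.f.app V a) = 0 :=
    congr(($T.zero).app V a)
  induction m with
  | zero =>
    obtain ⟨V', h, b, hyV, hb⟩ := isLocSurj_of_epi T.g V c y hy
    exact ⟨V', h, b, hyV, by simp, hb⟩
  | succ m hm =>
    obtain ⟨V', h', b, hyV, hb, hbc⟩ := hm fun k hk => hc k (hk.trans m.lt_succ_self)
    by_cases hmn : m < n
    · obtain ⟨a, ha⟩ := exists_app_eq_of_shortExact hT (ores (h'.trans hV) (t ⟨m, hmn⟩) • b) (by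
        rw [Scheme.Modules.Hom.app_smul, hbc, ← ores_ores hV h', ← res_smul,
          hc ⟨m, hmn⟩ m.lt_succ_self, map_zero])
      obtain ⟨V'', h'', a', hyV', ha', haa⟩ := h (h'.trans hV) ⟨m, hmn⟩ a (fun k hk => by
        apply injective_app_of_mono T.f
        rw [Scheme.Modules.Hom.app_smul, ha, smul_comm, hb k hk, smul_zero, map_zero]) y hyV
      refine ⟨V'', h''.trans h', res _ h'' b - T.f.app V'' a', hyV', fun k hk => ?_, ?_⟩
      · rw [smul_sub, ← Scheme.Modules.Hom.app_smul]
        obtain hk' | hk' := Nat.lt_succ_iff_lt_or_eq.mp hk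
        · rw [ha' k hk', map_zero, sub_zero, ← ores_ores (h'.trans hV) h'', ← res_smul, hb k hk',
            map_zero]
        · obtain rfl : k = ⟨m, hmn⟩ := Fin.ext hk'
          rw [haa, app_res, ha, res_smul, ores_ores, sub_self]
      · rw [map_sub, hfg, sub_zero, app_res, hbc, res_res]
    -- For `m ≥ n` there is no function with index `m`, so the old lift still serves.
    · exact ⟨V', h', b, hyV, fun k _ => hb k (k.2.trans_le (Nat.le_of_not_lt hmn)), hbc⟩

/-- Lift a section of the quotient with its annihilation conditions, divide the lift in the middle
term, and map the result back. -/
lemma LocDivisible.of_shortExact {W : Y.Opens} {n : ℕ} {t : Fin n → Γ(Y, W)}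
    {T : ShortComplex Y.Modules} (hT : T.ShortExact) (h₁ : LocDivisible t T.X₁)
    (h₂ : LocDivisible t T.X₂) : LocDivisible t T.X₃ := by
  intro V hV j c hc y hy
  obtain ⟨V', h', b, hyV, hb, hbc⟩ := h₁.lift hT j.1 hV c (fun k hk => hc k hk) y hy
  obtain ⟨V'', h'', b', hyV', hb', hbb⟩ := h₂ (h'.trans hV) j b (fun k hk => hb k hk) y hyV
  refine ⟨V'', h''.trans h', T.g.app V'' b', hyV', fun k hk => ?_, ?_⟩
  · rw [← Scheme.Modules.Hom.app_smul, hb' k hk, map_zero]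
  · rw [← Scheme.Modules.Hom.app_smul, hbb, app_res, hbc, res_res]

section Injective

variable {W V : Y.Opens} {n : ℕ} (t : Fin n → Γ(Y, W)) (j : Fin n) (hVW : V ≤ W)

/-- The functions which are locally linear combinations of the `t k`, `k < j`. -/
def locSpan {O : Y.Opens} (hO : O ≤ W) : Ideal Γ(Y, O) where
  carrier := {s | ∀ y ∈ O, ∃ (O' : Y.Opens) (h : O' ≤ O), y ∈ O' ∧
    ores h s ∈ Ideal.span ((fun k => ores (h.trans hO) (t k)) '' Set.Iio j)}
  zero_mem' y hy := ⟨O, le_rfl, hy, by simp⟩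
  add_mem' {s s'} hs hs' y hy := by
    obtain ⟨O₁, h₁, hy₁, hs₁⟩ := hs y hy
    obtain ⟨O₂, h₂, hy₂, hs₂⟩ := hs' y hy
    have key {O₁ : Y.Opens} {h₁ : O₁ ≤ O} {O₃ : Y.Opens} (h₃ : O₃ ≤ O₁) {s}
        (hs₁ : ores h₁ s ∈ Ideal.span ((fun k => ores (h₁.trans hO) (t k)) '' Set.Iio j)) :
        ores (h₃.trans h₁) s ∈
          Ideal.span ((fun k => ores ((h₃.trans h₁).trans hO) (t k)) '' Set.Iio j) := by
      have := Ideal.mem_map_of_mem (ores h₃) hs₁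
      rw [Ideal.map_span, ← Set.image_comp] at this
      simpa [Function.comp_def] using this
    refine ⟨O₁ ⊓ O₂, inf_le_left.trans h₁, ⟨hy₁, hy₂⟩, ?_⟩
    rw [map_add]
    exact Ideal.add_mem _ (key inf_le_left hs₁) (key inf_le_right hs₂)
  smul_mem' r s hs y hy := by
    obtain ⟨O₁, h₁, hy₁, hs₁⟩ := hs y hy
    refine ⟨O₁, h₁, hy₁, ?_⟩
    rw [smul_eq_mul, map_mul]
    exact Ideal.mul_mem_left _ _ hs₁

lemma mem_locSpan {O : Y.Opens} (hO : O ≤ W) {k : Fin n} (hk : k < j) :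
    ores hO (t k) ∈ locSpan t j hO := fun y hy =>
  ⟨O, le_rfl, hy, Ideal.subset_span ⟨k, hk, by simp⟩⟩

lemma locSpan_le {O O' : Y.Opens} (hO : O ≤ W) (h : O' ≤ O) :
    locSpan t j hO ≤ (locSpan t j (h.trans hO)).comap (ores h) := by
  intro s hs y hy
  obtain ⟨O₁, h₁, hy₁, hs₁⟩ := hs y (h hy)
  refine ⟨O₁ ⊓ O', inf_le_right, ⟨hy₁, hy⟩, ?_⟩
  have := Ideal.mem_map_of_mem (ores (inf_le_left : O₁ ⊓ O' ≤ O₁)) hs₁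
  rw [Ideal.map_span, ← Set.image_comp] at this
  simpa [Function.comp_def] using this

lemma smul_eq_zero_of_mem_locSpan {J : Y.Modules} {O : Y.Opens} (hO : O ≤ W) {s : Γ(Y, O)}
    (hs : s ∈ locSpan t j hO) {u : Γ(J, O)} (hu : ∀ k < j, ores hO (t k) • u = 0) :
    s • u = 0 := by
  refine eq_zero_of_locally fun y hy => ?_
  obtain ⟨O', h, hy', hs'⟩ := hs y hy
  refine ⟨O', h, hy', ?_⟩
  rw [res_smul]
  have : Ideal.span ((fun k => ores (h.trans hO) (t k)) '' Set.Iio j) ≤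
      LinearMap.ker (LinearMap.toSpanSingleton Γ(Y, O') Γ(J, O') (res J h u)) := by
    refine Ideal.span_le.mpr ?_
    rintro _ ⟨k, hk, rfl⟩
    change ores (h.trans hO) (t k) • res J h u = 0
    rw [← ores_ores hO h, ← res_smul, hu k hk, map_zero]
  exact this hs'

/-- The sections of the extension by zero to `Y` of the quotient of the structure sheaf of `V` by the
functions `t k`, `k < j`. -/
abbrev QuotSec (O : Y.Opens) : Type u :=
  -- The product over the proofs of `O ≤ V` is the quotient when `O ≤ V` and the zero module
  -- otherwise.
  ∀ h : PLift (O ≤ V), Γ(Y, O) ⧸ locSpan t j (h.down.trans hVW)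

open Classical in
/-- The restriction maps of the extension by zero. -/
def quotRes {O O' : Y.Opens} (f : O' ≤ O) : QuotSec t j hVW O →+ QuotSec t j hVW O' where
  toFun x _ := if h' : O ≤ V then
      Ideal.quotientMap _ (ores f) (locSpan_le t j (h'.trans hVW) f) (x ⟨h'⟩) else 0
  map_zero' := by
    funext h
    split_ifs <;> simp
  map_add' x x' := by
    funext h
    simp only [Pi.add_apply]
    split_ifs <;> simp

lemma quotRes_apply {O O' : Y.Opens} (f : O' ≤ O) (hO : O ≤ V) (x : QuotSec t j hVW O)
    (h : PLift (O' ≤ V)) : quotRes t j hVW f x h =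
      Ideal.quotientMap _ (ores f) (locSpan_le t j (hO.trans hVW) f) (x ⟨hO⟩) :=
  dif_pos hO

lemma quotRes_eq_zero {O O' : Y.Opens} (f : O' ≤ O) (hO : ¬ O ≤ V) (x : QuotSec t j hVW O) :
    quotRes t j hVW f x = 0 :=
  funext fun _ => dif_neg hO

/-- The extension by zero, as a presheaf of groups. -/
def quotPresheafAb : Y.Opensᵒᵖ ⥤ Ab.{u} where
  obj O := AddCommGrpCat.of (QuotSec t j hVW O.unop)
  map {O O'} f := AddCommGrpCat.ofHom (quotRes t j hVW f.unop.le)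
  map_id O := by
    refine ConcreteCategory.hom_ext _ _ fun x => funext fun h => ?_
    refine (quotRes_apply t j hVW le_rfl h.down x h).trans ?_
    obtain ⟨s, hs⟩ := Ideal.Quotient.mk_surjective (x h)
    change Ideal.quotientMap _ _ _ (x h) = x h
    rw [← hs, Ideal.quotientMap_mk, ores_refl]
  map_comp {O O' O''} f g := by
    refine ConcreteCategory.hom_ext _ _ fun x => funext fun h => ?_
    change quotRes t j hVW (g.unop.le.trans f.unop.le) x h =
      quotRes t j hVW g.unop.le (quotRes t j hVW f.unop.le x) h
    by_cases hO : O.unop ≤ V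
    · rw [quotRes_apply _ _ _ _ hO, quotRes_apply _ _ _ _ (f.unop.le.trans hO),
        quotRes_apply _ _ _ _ hO]
      obtain ⟨s, hs⟩ := Ideal.Quotient.mk_surjective (x ⟨hO⟩)
      rw [← hs, Ideal.quotientMap_mk, Ideal.quotientMap_mk, Ideal.quotientMap_mk, ores_ores]
    · rw [quotRes_eq_zero _ _ _ _ hO, quotRes_eq_zero _ _ _ _ hO, map_zero]

instance (O : Y.Opensᵒᵖ) :
    Module (Y.ringCatSheaf.obj.obj O) ((quotPresheafAb t j hVW).obj O) :=
  inferInstanceAs (Module Γ(Y, O.unop) (QuotSec t j hVW O.unop))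

/-- The extension by zero, as a presheaf of modules. -/
def quotPresheaf : PresheafOfModules.{u} Y.ringCatSheaf.obj :=
  PresheafOfModules.ofPresheaf (quotPresheafAb t j hVW) (fun {O O'} f r x => by
    funext h
    let r' : Γ(Y, O.unop) := r
    let x' : QuotSec t j hVW O.unop := x
    change quotRes t j hVW f.unop.le (r' • x') h =
      ores f.unop.le r' • quotRes t j hVW f.unop.le x' h
    by_cases hO : O.unop ≤ V
    · rw [quotRes_apply _ _ _ _ hO, quotRes_apply _ _ _ _ hO]
      obtain ⟨s, hs⟩ := Ideal.Quotient.mk_surjective (x' ⟨hO⟩)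
      rw [Pi.smul_apply, ← hs]
      change Ideal.quotientMap _ _ _ (Ideal.Quotient.mk _ (r' * s)) = _
      rw [Ideal.quotientMap_mk, Ideal.quotientMap_mk, map_mul]
      rfl
    · rw [quotRes_eq_zero _ _ _ _ hO, quotRes_eq_zero _ _ _ _ hO]
      exact (smul_zero _).symm)

/-- The multiplication by `t j` on the sections of the extension by zero. -/
def quotSecMul (O : Y.Opens) : QuotSec t j hVW O →ₗ[Γ(Y, O)] QuotSec t j hVW O where
  toFun x h := ores (h.down.trans hVW) (t j) • x h
  map_add' _ _ := funext fun _ => smul_add _ _ _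
  map_smul' r x := funext fun h => smul_comm (ores (h.down.trans hVW) (t j)) r (x h)

/-- The multiplication by `t j` on the extension by zero. -/
def quotMul : quotPresheaf t j hVW ⟶ quotPresheaf t j hVW :=
  PresheafOfModules.homMk (M₁ := quotPresheaf t j hVW) (M₂ := quotPresheaf t j hVW)
    { app O := AddCommGrpCat.ofHom (quotSecMul t j hVW O.unop).toAddMonoidHom
      naturality O O' f := by
        refine ConcreteCategory.hom_ext _ _ fun (x : QuotSec t j hVW O.unop) => funext fun h => ?_
        change ores (h.down.trans hVW) (t j) • quotRes t j hVW f.unop.le x h =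
          quotRes t j hVW f.unop.le (quotSecMul t j hVW O.unop x) h
        by_cases hO : O.unop ≤ V
        · rw [quotRes_apply _ _ _ _ hO, quotRes_apply _ _ _ _ hO]
          obtain ⟨s, hs⟩ := Ideal.Quotient.mk_surjective (x ⟨hO⟩)
          have hm : quotSecMul t j hVW O.unop x ⟨hO⟩ =
              Ideal.Quotient.mk _ (ores (hO.trans hVW) (t j) * s) := by
            rw [map_mul, hs]
            rfl
          rw [hm, ← hs, Ideal.quotientMap_mk, Ideal.quotientMap_mk, map_mul, ores_ores]
          rfl
        · rw [quotRes_eq_zero _ _ _ _ hO, quotRes_eq_zero _ _ _ _ hO]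
          exact smul_zero _ }
    (fun O => (quotSecMul t j hVW O.unop).map_smul)

-- This is regularity of the sequence. Since `locSpan` is already a local condition, the map is
-- injective on the sections of the presheaf, before sheafification.
variable {t} in
lemma mono_quotMul (ht : IsCoord i t) : Mono (quotMul t j hVW) := by
  apply PresheafOfModules.mono_of_injective
  intro O
  rw [injective_iff_map_eq_zero]
  intro (x : QuotSec t j hVW O.unop) (hx : quotSecMul t j hVW O.unop x = 0)
  funext h
  have hx' : ores (h.down.trans hVW) (t j) • x h = 0 := congrFun hx h
  obtain ⟨s, hs⟩ := Ideal.Quotient.mk_surjective (x h)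
  rw [← hs] at hx' ⊢
  have hx'' : ores (h.down.trans hVW) (t j) * s ∈ locSpan t j (h.down.trans hVW) :=
    Ideal.Quotient.eq_zero_iff_mem.mp hx'
  refine Ideal.Quotient.eq_zero_iff_mem.mpr fun y hy => ?_
  obtain ⟨O', h', hy', hO'⟩ := hx'' y hy
  rw [map_mul, ores_ores] at hO'
  obtain ⟨O'', h'', hy'', hO''⟩ := ht.regular (h'.trans (h.down.trans hVW)) j _ hO' y hy'
  refine ⟨O'', h''.trans h', hy'', ?_⟩
  rwa [ores_ores] at hO''

variable {t j} in
/-- The map to the sections of `J` given by a section which is killed by the `t k`, `k < j`. -/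
def quotLift {J : Y.Modules} (u : Γ(J, V)) (hu : ∀ k < j, ores hVW (t k) • u = 0) {O : Y.Opens}
    (h : O ≤ V) : Γ(Y, O) ⧸ locSpan t j (h.trans hVW) →ₗ[Γ(Y, O)] Γ(J, O) :=
  Submodule.liftQ _ (LinearMap.toSpanSingleton Γ(Y, O) Γ(J, O) (res J h u)) fun s hs =>
    smul_eq_zero_of_mem_locSpan t j (h.trans hVW) hs fun k hk => by
      rw [← ores_ores hVW h, ← res_smul, hu k hk, map_zero]

variable {t j} in
lemma quotLift_mk {J : Y.Modules} (u : Γ(J, V)) (hu : ∀ k < j, ores hVW (t k) • u = 0)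
    {O : Y.Opens} (h : O ≤ V) (s : Γ(Y, O)) :
    quotLift hVW u hu h (Ideal.Quotient.mk _ s) = s • res J h u := rfl

open Classical in
variable {t j} in
/-- The map on the sections of the extension by zero given by a section which is killed by the
`t k`, `k < j`. -/
def quotSecDesc {J : Y.Modules} (u : Γ(J, V)) (hu : ∀ k < j, ores hVW (t k) • u = 0)
    (O : Y.Opens) : QuotSec t j hVW O →ₗ[Γ(Y, O)] Γ(J, O) :=
  if h : O ≤ V then quotLift hVW u hu h ∘ₗ LinearMap.proj ⟨h⟩ else 0

variable {t j} in
lemma quotSecDesc_apply {J : Y.Modules} (u : Γ(J, V)) (hu : ∀ k < j, ores hVW (t k) • u = 0)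
    {O : Y.Opens} (h : O ≤ V) (x : QuotSec t j hVW O) :
    quotSecDesc hVW u hu O x = quotLift hVW u hu h (x ⟨h⟩) := by
  rw [quotSecDesc, dif_pos h]
  rfl

variable {t j} in
lemma quotSecDesc_eq_zero {J : Y.Modules} (u : Γ(J, V)) (hu : ∀ k < j, ores hVW (t k) • u = 0)
    {O : Y.Opens} (h : ¬ O ≤ V) : quotSecDesc hVW u hu O = 0 :=
  dif_neg h

variable {t j} in
/-- The morphism from the extension by zero given by a section which is killed by the `t k`,
`k < j`. -/
def quotDesc {J : Y.Modules} (u : Γ(J, V)) (hu : ∀ k < j, ores hVW (t k) • u = 0) :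
    quotPresheaf t j hVW ⟶ J.val :=
  PresheafOfModules.homMk (M₁ := quotPresheaf t j hVW) (M₂ := J.val)
    { app O := AddCommGrpCat.ofHom (quotSecDesc hVW u hu O.unop).toAddMonoidHom
      naturality O O' f := by
        refine ConcreteCategory.hom_ext _ _ fun (x : QuotSec t j hVW O.unop) => ?_
        change quotSecDesc hVW u hu O'.unop (quotRes t j hVW f.unop.le x) =
          res J f.unop.le (quotSecDesc hVW u hu O.unop x)
        by_cases hO : O.unop ≤ V
        · rw [quotSecDesc_apply _ _ _ hO, quotSecDesc_apply _ _ _ (f.unop.le.trans hO),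
            quotRes_apply _ _ _ _ hO]
          obtain ⟨s, hs⟩ := Ideal.Quotient.mk_surjective (x ⟨hO⟩)
          rw [← hs, Ideal.quotientMap_mk, quotLift_mk, quotLift_mk, res_smul, res_res]
        · rw [quotSecDesc_eq_zero _ _ _ hO, quotRes_eq_zero _ _ _ _ hO, map_zero,
            LinearMap.zero_apply, map_zero] }
    (fun O => (quotSecDesc hVW u hu O.unop).map_smul)

/-- A section `u` over `V` killed by the `t k` with `k < j` is a morphism to `J` from the extension
by zero of `𝒪_V / (t k)_{k < j}`. As multiplication by `t j` is a monomorphism there, the morphism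
extends along it, and the image of `1` under the extension is a quotient of `u` by `t j` which is
again killed by the `t k`. -/
lemma LocDivisible.of_injective (ht : IsCoord i t) (J : Y.Modules) [hJ : Injective J] :
    LocDivisible t J := by
  intro V hV j u hu y hy
  have := mono_quotMul j hV ht
  let a := PresheafOfModules.sheafification (𝟙 Y.ringCatSheaf.obj)
  let adj := PresheafOfModules.sheafificationAdjunction (𝟙 Y.ringCatSheaf.obj)
  let Z : Y.Modules := a.obj (quotPresheaf t j hV)
  let f : Z ⟶ J := (adj.homEquiv _ _).symm (quotDesc hV u hu)
  let m : Z ⟶ Z := a.map (quotMul t j hV)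
  have : Mono m := inferInstanceAs (Mono (a.map (quotMul t j hV)))
  let g : Z ⟶ J := Injective.factorThru f m
  have hmg : m ≫ g = f := Injective.comp_factorThru f m
  let g' : quotPresheaf t j hV ⟶ J.val := adj.homEquiv _ _ g
  have hg : quotMul t j hV ≫ g' = quotDesc hV u hu := by
    rw [← (adj.homEquiv _ _).apply_symm_apply (quotDesc hV u hu)]
    refine (adj.homEquiv_naturality_left _ _).symm.trans ?_
    exact congrArg _ hmg
  let e (s : Γ(Y, V)) : QuotSec t j hV V := fun h => Ideal.Quotient.mk _ s
  let G : QuotSec t j hV V →ₗ[Γ(Y, V)] Γ(J, V) := (g'.app (op V)).hom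
  have hs (s : Γ(Y, V)) : s • G (e 1) = G (e s) := by
    rw [← map_smul]
    congr 1
    funext h
    exact congrArg (Ideal.Quotient.mk _) (mul_one s)
  refine ⟨V, le_rfl, G (e 1), hy, fun k hk => ?_, ?_⟩
  · rw [hs]
    have : e (ores hV (t k)) = 0 :=
      funext fun h => Ideal.Quotient.eq_zero_iff_mem.mpr (mem_locSpan t j _ hk)
    rw [this, map_zero]
  · rw [hs, res_refl]
    have h1 : G (quotSecMul t j hV V (e 1)) = quotSecDesc hV u hu V (e 1) :=
      congr(($hg).app (op V) (e 1))
    rw [quotSecDesc_apply hV u hu le_rfl, quotLift_mk, one_smul, res_refl] at h1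
    rw [← h1]
    congr 1
    funext h
    exact congrArg (Ideal.Quotient.mk _) (mul_one (ores hV (t j))).symm

end Injective

section Adapted

/-- The modules on which every sequence of functions in `𝒯` acts injectively. -/
def adaptedClass (𝒯 : ∀ ⦃W : Y.Opens⦄ ⦃n : ℕ⦄, (Fin n → Γ(Y, W)) → Prop) :
    ObjectProperty Y.Modules := fun J =>
  ∀ ⦃W : Y.Opens⦄ ⦃n : ℕ⦄ (t : Fin n → Γ(Y, W)), 𝒯 t → LocDivisible t J

variable (i) in
/-- The unit section. -/
def pushOne (V : Y.Opens) : Γ(pushUnit i, V) := (1 : Γ(X, i ⁻¹ᵁ V))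

lemma res_pushOne {V V' : Y.Opens} (h : V' ≤ V) : res (pushUnit i) h (pushOne i V) = pushOne i V' :=
  map_one (X.presheaf.map (homOfLE (fun _ hx => h hx : i ⁻¹ᵁ V' ≤ i ⁻¹ᵁ V)).op).hom

lemma smul_pushOne {V : Y.Opens} (s : Γ(Y, V)) : s • pushOne i V = i.app V s :=
  mul_one (i.app V s)

variable {W : Y.Opens} {n : ℕ} {t : Fin n → Γ(Y, W)}

lemma IsCoord.exists_smul_pushOne (ht : IsCoord i t) {V : Y.Opens} (hV : V ≤ W)
    (a : Γ(pushUnit i, V)) (y : Y) (hy : y ∈ V) : ∃ (V' : Y.Opens) (h : V' ≤ V) (s : Γ(Y, V')),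
      y ∈ V' ∧ s • pushOne i V' = res (pushUnit i) h a := by
  obtain ⟨V', h, s, hyV, hs⟩ := ht.surj hV a y hy
  exact ⟨V', h, s, hyV, (smul_pushOne s).trans hs⟩

lemma IsCoord.smul_pushOne_eq_zero (ht : IsCoord i t) {V : Y.Opens} (hV : V ≤ W) (k : Fin n) :
    ores hV (t k) • pushOne i V = 0 := by
  rw [smul_pushOne]
  refine (congr($(i.naturality (homOfLE hV).op) (t k))).trans ?_
  refine (congrArg (X.presheaf.map _) (ht.vanish k)).trans ?_
  exact map_zero (X.presheaf.map _).hom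

/-- Locally on `Y` every section of the push-forward is a multiple of `1` by a function on `Y`. -/
lemma IsCoord.hom_ext (ht : IsCoord i t) {J : Y.Modules} {U : Y.Opens} (hU : U ≤ W)
    {φ ψ : contHomOn (discrete (pushUnit i)) J U}
    (h : dev φ le_rfl (pushOne i U) = dev ψ le_rfl (pushOne i U)) : φ = ψ := by
  have key (V : Y.Opens) (hV : V ≤ U) : dev φ hV (pushOne i V) = dev ψ hV (pushOne i V) := by
    rw [← res_pushOne hV, dev_res φ le_rfl hV, dev_res ψ le_rfl hV, h]
  refine dev_ext fun V hV a => eq_of_locally fun y hy => ?_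
  obtain ⟨V', h', s, hyV, hs⟩ := ht.exists_smul_pushOne (hV.trans hU) a y hy
  refine ⟨V', h', hyV, ?_⟩
  rw [← dev_res φ, ← dev_res ψ, ← hs, map_smul, map_smul, key]

/-- A section killed by the sequence is killed by every function which vanishes on `X`, since such a
function is locally a combination of the sequence. Hence `s • 1 ↦ s • b` is a well-defined graph.
With `IsCoord.hom_ext`, homomorphisms from the push-forward are the sections killed by the sequence.
-/
lemma IsCoord.exists_hom (ht : IsCoord i t) {J : Y.Modules} {U : Y.Opens} (hU : U ≤ W)
    (b : Γ(J, U)) (hb : ∀ k, ores hU (t k) • b = 0) :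
    ∃ φ : contHomOn (discrete (pushUnit i)) J U, dev φ le_rfl (pushOne i U) = b := by
  have hkill {V : Y.Opens} (hV : V ≤ U) (s : Γ(Y, V)) (hs : i.app V s = 0) :
      s • res J hV b = 0 := by
    refine eq_zero_of_locally fun y hy => ?_
    obtain ⟨V', h', hyV, hs'⟩ := ht.gen (hV.trans hU) s hs y hy
    refine ⟨V', h', hyV, ?_⟩
    rw [res_smul, res_res]
    have : Ideal.span (Set.range fun k => ores (h'.trans (hV.trans hU)) (t k)) ≤
        LinearMap.ker (LinearMap.toSpanSingleton Γ(Y, V') Γ(J, V') (res J (h'.trans hV) b)) := by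
      refine Ideal.span_le.mpr ?_
      rintro _ ⟨k, rfl⟩
      change ores (h'.trans (hV.trans hU)) (t k) • res J (h'.trans hV) b = 0
      rw [← ores_ores hU (h'.trans hV), ← res_smul, hb k, map_zero]
    exact this hs'
  obtain ⟨φ, hφ, hφr⟩ := exists_family_of_graph (N := pushUnit i) (M := J) (U := U)
    (fun V hV => LinearMap.range ((LinearMap.toSpanSingleton Γ(Y, V) _ (pushOne i V)).prod
      (LinearMap.toSpanSingleton Γ(Y, V) _ (res J hV b)))) (by
      rintro V V' hV h _ _ ⟨s, hs⟩
      obtain ⟨rfl, rfl⟩ := Prod.mk.inj hs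
      refine ⟨ores h s, ?_⟩
      change (ores h s • _, ores h s • _) = (res _ h (s • _), res _ h (s • _))
      rw [res_smul, res_smul, res_pushOne, res_res]) (by
      intro V hV a y hy
      obtain ⟨V', h', s, hyV, hs⟩ := ht.exists_smul_pushOne (hV.trans hU) a y hy
      exact ⟨V', h', _, hyV, s, Prod.ext hs rfl⟩) (by
      rintro V hV m ⟨s, hs⟩
      obtain ⟨h1, rfl⟩ := Prod.mk.inj hs
      exact hkill hV s ((smul_pushOne s).symm.trans h1))
  obtain ⟨ψ, hψ⟩ := exists_dev φ hφ
  refine ⟨ψ, ?_⟩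
  rw [hψ]
  exact hφr U le_rfl _ _ ⟨1, Prod.ext (one_smul _ _) ((one_smul _ _).trans (res_refl _))⟩

lemma sections_pushUnit_eq_zero {V : Y.Opens} (h : i ⁻¹ᵁ V = ⊥) (a : Γ(pushUnit i, V)) : a = 0 := by
  refine ores_eq_of_locally (Y := X) fun x hx => ?_
  rw [h] at hx
  exact hx.elim

/-- Left exactness of `𝓗om`: a homomorphism with values in the kernel of `T.g` factors through
`T.f`, and the factorization is defined by its graph. -/
lemma exact_map_sheafHom (N : Y.Modules) {T : ShortComplex Y.Modules} (hT : T.ShortExact) :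
    (T.map (sheafHom N)).Exact := by
  have := hT.mono_f
  refine exact_of_locally fun U (χ : contHomOn (discrete N) T.X₂ U) hχ y hy => ?_
  have hχ' (V : Y.Opens) (hV : V ≤ U) (a : Γ(N, V)) : T.g.app V (dev χ hV a) = 0 :=
    congr(dev (show contHomOn (discrete N) T.X₃ U from $hχ) hV a)
  obtain ⟨φ, hφ, hφr⟩ := exists_family_of_graph (N := N) (M := T.X₁) (U := U)
    (fun V hV =>
      { carrier := {p | T.f.app V p.2 = dev χ hV p.1}
        zero_mem' := by
          change T.f.app V 0 = dev χ hV 0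
          rw [map_zero, map_zero]
        add_mem' := fun {a b} (ha : T.f.app V a.2 = dev χ hV a.1)
            (hb : T.f.app V b.2 = dev χ hV b.1) => by
          change T.f.app V (a.2 + b.2) = dev χ hV (a.1 + b.1)
          rw [map_add, map_add, ha, hb]
        smul_mem' := fun r a (ha : T.f.app V a.2 = dev χ hV a.1) => by
          change T.f.app V (r • a.2) = dev χ hV (r • a.1)
          rw [Scheme.Modules.Hom.app_smul, map_smul, ha] }) (by
      intro V V' hV h n m (hnm : T.f.app V m = dev χ hV n)
      change T.f.app V' (res _ h m) = dev χ _ (res _ h n)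
      rw [app_res, hnm, dev_res χ]) (by
      intro V hV a y hy
      obtain ⟨m, hm⟩ := exists_app_eq_of_shortExact hT _ (hχ' V hV a)
      refine ⟨V, le_rfl, m, hy, ?_⟩
      change T.f.app V m = dev χ hV (res N le_rfl a)
      rw [hm, res_refl]) (by
      intro V hV m (hm : T.f.app V m = dev χ hV 0)
      exact injective_app_of_mono T.f V (by rw [hm, map_zero, map_zero]))
  obtain ⟨ψ, hψ⟩ := exists_dev φ hφ
  refine ⟨U, le_rfl, ψ, hy, ?_⟩
  refine dev_ext fun V hV a => ?_
  obtain ⟨m, hm⟩ := exists_app_eq_of_shortExact hT _ (hχ' V hV a)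
  change T.f.app V (dev ψ hV a) = dev χ hV a
  rw [hψ, hφr V hV a m hm, hm]

lemma mono_sheafHom_map (N : Y.Modules) {A B : Y.Modules} (g : A ⟶ B) [Mono g] :
    Mono ((sheafHom N).map g) := by
  refine mono_of_injective_app _ fun U φ ψ h => contHomOn_ext fun V hV a => ?_
  exact injective_app_of_mono g V congr(($h : contHomOn (discrete N) B U).1 ⟨V, hV⟩ a)

variable (i) in
/-- If `X` has coordinate sequences locally on `Y`, then the derived functors of `𝓗om(𝒪_X, -)` can
be computed with resolutions by modules on which coordinate sequences act injectively. -/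
theorem isAdapted_sheafHom (𝒯 : ∀ ⦃W : Y.Opens⦄ ⦃n : ℕ⦄, (Fin n → Γ(Y, W)) → Prop)
    (h𝒯 : ∀ ⦃W : Y.Opens⦄ ⦃n : ℕ⦄ (t : Fin n → Γ(Y, W)), 𝒯 t → IsCoord i t)
    (H : ∀ y : Y, (∃ V : Y.Opens, y ∈ V ∧ i ⁻¹ᵁ V = ⊥) ∨
    ∃ (W : Y.Opens) (n : ℕ) (t : Fin n → Γ(Y, W)), y ∈ W ∧ 𝒯 t) :
    IsAdapted (sheafHom (pushUnit i)) (adaptedClass 𝒯) where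
  injective I _ W n t ht := LocDivisible.of_injective t (h𝒯 t ht) I
  of_shortExact hT h₁ h₂ W n t ht := LocDivisible.of_shortExact hT (h₁ t ht) (h₂ t ht)
  map_shortExact {T} hT h₁ _ :=
    { exact := exact_map_sheafHom _ hT
      mono_f := have := hT.mono_f; mono_sheafHom_map _ _
      epi_g := by
        apply IsLocSurj.epi
        intro U (χ : contHomOn (discrete (pushUnit i)) T.X₃ U) y hy
        -- Away from `X` the push-forward has no nonzero sections, so the zero homomorphism is a
        -- lift.
        obtain ⟨V, hyV, hV⟩ | ⟨W, n, t, hyW, h𝒯t⟩ := H y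
        · refine ⟨U ⊓ V, inf_le_left, 0, ⟨hy, hyV⟩, contHomOn_ext fun V' hV' a => ?_⟩
          have : a = 0 := sections_pushUnit_eq_zero
            (le_bot_iff.mp (hV ▸ fun x hx => (hV' hx).2)) a
          rw [this]
          exact (map_zero _).trans (map_zero _).symm
        · have hUW : U ⊓ W ≤ W := inf_le_right
          have ht := h𝒯 t h𝒯t
          -- The image of `1` under `χ` is killed by all `n` functions, and it lifts locally to a
          -- section of `T.X₂` with the same property.
          obtain ⟨V, h, b, hyV, hb, hbc⟩ := LocDivisible.lift hT (h₁ t h𝒯t) n hUW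
            (dev χ inf_le_left (pushOne i (U ⊓ W))) (fun k _ => by
              rw [← map_smul, ht.smul_pushOne_eq_zero, map_zero]) y ⟨hy, hyW⟩
          obtain ⟨φ, hφ⟩ := ht.exists_hom (h.trans hUW) b fun k => hb k k.2
          refine ⟨V, h.trans inf_le_left, φ, hyV, ht.hom_ext (h.trans hUW) ?_⟩
          change T.g.app V (dev φ le_rfl (pushOne i V)) = dev χ (h.trans inf_le_left) _
          rw [hφ, hbc, ← dev_res χ, res_pushOne] }

end Adapted

end Coordinates

/-! ### Étale coordinates and infinitesimal neighbourhoods of the diagonal in a tensor power. -/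

section TensorPower

variable {k A B : Type u} [CommRing k] [CommRing A] [CommRing B] (c : k →+* A)

/-- The ring `B` is the tensor power of the `k`-algebra `A`, via the homomorphisms `ι j`. -/
structure IsTensorPower {n : ℕ} (ι : Fin n → A →+* B) : Prop where
  comp (j j' : Fin n) : (ι j).comp c = (ι j').comp c
  exists_lift {T : Type u} [CommRing T] (g : Fin n → A →+* T) :
    (∀ j j', (g j).comp c = (g j').comp c) → ∃ h : B →+* T, ∀ j, h.comp (ι j) = g j
  hom_ext {T : Type u} [CommRing T] (h h' : B →+* T) :
    (∀ j, h.comp (ι j) = h'.comp (ι j)) → h = h'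

variable {d : ℕ} (x : Fin d → A)

/-- The functions `x` on `Spec A` are étale coordinates over `k`. -/
def IsEtaleCoord : Prop := (MvPolynomial.eval₂Hom c x).Etale

variable {c x}

/-- Uniqueness of infinitesimal lifts: `A` is formally unramified over the polynomial ring in the
coordinates, and the assumptions say that `v` and `w` agree on that ring and modulo a nilpotent
ideal. -/
lemma IsEtaleCoord.hom_ext (hx : IsEtaleCoord c x) {T C : Type u} [CommRing T] [CommRing C]
    (ε : T →+* C) (hε : IsNilpotent (RingHom.ker ε)) {v w : A →+* T} (hc : v.comp c = w.comp c)
    (hvw : ∀ i, v (x i) = w (x i)) (h : ε.comp v = ε.comp w) : v = w := by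
  let := (MvPolynomial.eval₂Hom c x).toAlgebra
  have : Algebra.Etale (MvPolynomial (Fin d) k) A := hx
  let := (v.comp (MvPolynomial.eval₂Hom c x)).toAlgebra
  have h' : v.comp (MvPolynomial.eval₂Hom c x) = w.comp (MvPolynomial.eval₂Hom c x) :=
    MvPolynomial.ringHom_ext (fun r => by simpa using RingHom.congr_fun hc r) (by simpa using hvw)
  let v' : A →ₐ[MvPolynomial (Fin d) k] T := ⟨v, fun _ => rfl⟩
  let w' : A →ₐ[MvPolynomial (Fin d) k] T := ⟨w, fun r => (RingHom.congr_fun h' r).symm⟩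
  exact congrArg AlgHom.toRingHom
    (Algebra.FormallyUnramified.lift_unique_of_ringHom ε hε v' w' h)

/-- Existence of infinitesimal lifts: the prescribed values `y` of the coordinates make `T` an
algebra over the polynomial ring, over which `A` is formally smooth. -/
lemma IsEtaleCoord.exists_lift (hx : IsEtaleCoord c x) {T C : Type u} [CommRing T] [CommRing C]
    (ε : T →+* C) (hε : IsNilpotent (RingHom.ker ε)) (hε' : Function.Surjective ε) (w : A →+* C)
    (c' : k →+* T) (hc : ε.comp c' = w.comp c) (y : Fin d → T) (hy : ∀ i, ε (y i) = w (x i)) :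
    ∃ v : A →+* T, v.comp c = c' ∧ (∀ i, v (x i) = y i) ∧ ε.comp v = w := by
  let := (MvPolynomial.eval₂Hom c x).toAlgebra
  have : Algebra.Etale (MvPolynomial (Fin d) k) A := hx
  let := (MvPolynomial.eval₂Hom c' y).toAlgebra
  let := (ε.comp (MvPolynomial.eval₂Hom c' y)).toAlgebra
  have h' : w.comp (MvPolynomial.eval₂Hom c x) = ε.comp (MvPolynomial.eval₂Hom c' y) :=
    MvPolynomial.ringHom_ext (fun r => by simpa using RingHom.congr_fun hc.symm r)
      (by simpa using fun i => (hy i).symm)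
  let w' : A →ₐ[MvPolynomial (Fin d) k] C := ⟨w, RingHom.congr_fun h'⟩
  let ε' : T →ₐ[MvPolynomial (Fin d) k] C := ⟨ε, fun _ => rfl⟩
  let v := Algebra.FormallySmooth.liftOfSurjective w' ε' hε' hε
  have hv (p : MvPolynomial (Fin d) k) : v (MvPolynomial.eval₂Hom c x p) =
    MvPolynomial.eval₂Hom c' y p := v.commutes p
  refine ⟨v.toRingHom, RingHom.ext fun r => ?_, fun i => ?_, RingHom.ext fun a => ?_⟩
  · simpa using hv (MvPolynomial.C r)
  · simpa using hv (MvPolynomial.X i)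
  · exact Algebra.FormallySmooth.liftOfSurjective_apply w' ε' hε' hε a

variable {n : ℕ} (x)

/-- The homomorphism from the ring of polynomials over the first factor of a tensor power, which
sends the variables to the differences of the coordinates. -/
def polyHom (ι : Fin (n + 1) → A →+* B) : MvPolynomial (Fin n × Fin d) A →+* B :=
  MvPolynomial.eval₂Hom (ι 0) (fun p => ι p.1.succ (x p.2) - ι 0 (x p.2))

@[simp]
lemma polyHom_C (ι : Fin (n + 1) → A →+* B) (a : A) : polyHom x ι (MvPolynomial.C a) = ι 0 a := by
  simp [polyHom]

@[simp]
lemma polyHom_X (ι : Fin (n + 1) → A →+* B) (p : Fin n × Fin d) :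
    polyHom x ι (MvPolynomial.X p) = ι p.1.succ (x p.2) - ι 0 (x p.2) := by
  simp [polyHom]

variable {x} {ι : Fin (n + 1) → A →+* B} {Δ : B →+* A} (hΔ : ∀ j, Δ.comp (ι j) = RingHom.id A)

include hΔ in
lemma comp_polyHom : Δ.comp (polyHom x ι) = MvPolynomial.constantCoeff := by
  have h (j) (a : A) : Δ (ι j a) = a := RingHom.congr_fun (hΔ j) a
  exact MvPolynomial.ringHom_ext (by simp [h]) (by simp [h])

lemma ker_constantCoeff {σ : Type*} : RingHom.ker (MvPolynomial.constantCoeff (R := A) (σ := σ)) =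
    MvPolynomial.idealOfVars σ A := by
  ext p
  rw [← pow_one (MvPolynomial.idealOfVars σ A), MvPolynomial.mem_pow_idealOfVars_iff',
    RingHom.mem_ker, MvPolynomial.constantCoeff_eq]
  refine ⟨fun h m hm => ?_, fun h => h 0 (by simp)⟩
  rwa [(Finsupp.degree_eq_zero_iff m).mp (by omega)]

include hΔ in
/-- The ring of functions on an infinitesimal neighbourhood of the diagonal of a smooth affine
scheme with étale coordinates is a truncated polynomial ring. -/
theorem polyHom_nbhd (hx : IsEtaleCoord c x) (hι : IsTensorPower c ι) (m : ℕ) :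
    (∀ b, ∃ p, b - polyHom x ι p ∈ RingHom.ker Δ ^ (m + 1)) ∧
    ∀ p, polyHom x ι p ∈ RingHom.ker Δ ^ (m + 1) ↔
      p ∈ MvPolynomial.idealOfVars (Fin n × Fin d) A ^ (m + 1) := by
  let J := MvPolynomial.idealOfVars (Fin n × Fin d) A
  let I := RingHom.ker Δ
  let τ := polyHom x ι
  have hJI : J ^ (m + 1) ≤ (I ^ (m + 1)).comap τ := by
    refine le_trans (Ideal.pow_right_mono ?_ _) (Ideal.le_comap_pow τ (m + 1))
    rw [RingHom.comap_ker, comp_polyHom hΔ, ker_constantCoeff]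
  -- An inverse of `polyHom` modulo the powers of the ideals is constructed. The truncated
  -- polynomial ring `T` is an infinitesimal thickening of `A` through the constant coefficient.
  let T := MvPolynomial (Fin n × Fin d) A ⧸ J ^ (m + 1)
  let π : MvPolynomial (Fin n × Fin d) A →+* T := Ideal.Quotient.mk _
  let ε : T →+* A := Ideal.Quotient.lift _ MvPolynomial.constantCoeff fun p hp => by
    rw [← RingHom.mem_ker, ker_constantCoeff]
    exact Ideal.pow_le_self m.succ_ne_zero hp
  have hεπ : ε.comp π = MvPolynomial.constantCoeff := Ideal.Quotient.lift_comp_mk _ _ _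
  have hker : RingHom.ker ε = J.map π := by
    have := ker_constantCoeff (A := A) (σ := Fin n × Fin d)
    rw [← hεπ, ← RingHom.comap_ker] at this
    change _ = (MvPolynomial.idealOfVars (Fin n × Fin d) A).map π
    rw [← this, Ideal.map_comap_of_surjective _ Ideal.Quotient.mk_surjective]
  have hpow : RingHom.ker ε ^ (m + 1) = ⊥ := by
    rw [hker, ← Ideal.map_pow]
    exact Ideal.map_quotient_self _
  have hε' : Function.Surjective ε := fun a => ⟨π (MvPolynomial.C a), by
    rw [← RingHom.comp_apply, hεπ, MvPolynomial.constantCoeff_C]⟩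
  -- The factor with index `l + 1` is sent to `T` by the lift of the identity of `A` with `x i ↦ x i
  -- + X (l, i)`. This is forced if the difference of coordinates is to correspond to the variable.
  have hv (l : Fin n) := hx.exists_lift ε ⟨m + 1, hpow⟩ hε' (RingHom.id A)
    ((π.comp MvPolynomial.C).comp c)
    (by
      rw [← RingHom.comp_assoc, ← RingHom.comp_assoc, hεπ]
      ext; simp)
    (fun i => π (MvPolynomial.C (x i) + MvPolynomial.X (l, i)))
    (fun i => by rw [← RingHom.comp_apply, hεπ]; simp)
  choose v hvc hvx hvε using hv
  obtain ⟨ρ, hρ⟩ := hι.exists_lift (Fin.cons (π.comp MvPolynomial.C) v : Fin (n + 1) → A →+* T) (by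
    have (j : Fin (n + 1)) : ((Fin.cons (π.comp MvPolynomial.C) v : Fin (n + 1) → A →+* T) j).comp c
        = (π.comp MvPolynomial.C).comp c := by
      induction j using Fin.cases with
      | zero => rfl
      | succ l => exact hvc l
    intro j j'
    rw [this, this])
  have hρ0 : ρ.comp (ι 0) = π.comp MvPolynomial.C := hρ 0
  have hρs (l : Fin n) : ρ.comp (ι l.succ) = v l := hρ l.succ
  have hερ : ε.comp ρ = Δ := by
    refine hι.hom_ext _ _ fun j => ?_
    rw [hΔ, RingHom.comp_assoc]
    induction j using Fin.cases with
    | zero =>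
      rw [hρ0, ← RingHom.comp_assoc, hεπ]
      ext; simp
    | succ l => rw [hρs, hvε]
  have hρI : I ^ (m + 1) ≤ RingHom.ker ρ := by
    have : I ≤ (RingHom.ker ε).comap ρ := by rw [RingHom.comap_ker, hερ]
    refine ((Ideal.pow_right_mono this _).trans (Ideal.le_comap_pow ρ (m + 1))).trans ?_
    rw [hpow]
    rfl
  have hρτ : ρ.comp τ = π := by
    refine MvPolynomial.ringHom_ext (fun a => ?_) fun p => ?_
    · rw [RingHom.comp_apply, polyHom_C]
      exact RingHom.congr_fun hρ0 a
    · rw [RingHom.comp_apply, polyHom_X, map_sub]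
      have h1 := RingHom.congr_fun (hρs p.1) (x p.2)
      have h2 := RingHom.congr_fun hρ0 (x p.2)
      simp only [RingHom.comp_apply] at h1 h2
      rw [h1, h2, hvx, map_add, add_sub_cancel_left]
  have h2 (p) : τ p ∈ I ^ (m + 1) ↔ p ∈ J ^ (m + 1) := by
    refine ⟨fun h => ?_, fun h => hJI h⟩
    rw [← Ideal.Quotient.eq_zero_iff_mem]
    exact (RingHom.congr_fun hρτ p).symm.trans (hρI h)
  refine ⟨fun b => ?_, h2⟩
  let Q := B ⧸ I ^ (m + 1)
  let κ : B →+* Q := Ideal.Quotient.mk _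
  let τ' : T →+* Q := Ideal.quotientMap _ τ hJI
  have hτ' : τ'.comp π = κ.comp τ := Ideal.quotientMap_comp_mk _
  let δ : Q →+* A := Ideal.Quotient.lift _ Δ fun b hb =>
    (Ideal.pow_le_self m.succ_ne_zero : I ^ (m + 1) ≤ I) hb
  have hδκ : δ.comp κ = Δ := Ideal.Quotient.lift_comp_mk _ _ _
  have hδ : IsNilpotent (RingHom.ker δ) := by
    refine ⟨m + 1, ?_⟩
    have : RingHom.ker δ = I.map κ := by
      have h : (RingHom.ker δ).comap κ = I := by rw [RingHom.comap_ker, hδκ]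
      exact (Ideal.map_comap_of_surjective κ Ideal.Quotient.mk_surjective _).symm.trans
        (congrArg _ h)
    rw [this, ← Ideal.map_pow]
    exact Ideal.map_quotient_self _
  have hδτ : δ.comp τ' = ε := by
    refine Ideal.Quotient.ringHom_ext ?_
    change (δ.comp τ').comp π = ε.comp π
    rw [RingHom.comp_assoc, hτ', ← RingHom.comp_assoc, hδκ, hεπ, comp_polyHom hΔ]
  -- The other composite is the identity by uniqueness of infinitesimal lifts, checked on each
  -- factor: both sides take the same values on coordinates and agree on the diagonal.
  have key : τ'.comp ρ = κ := by
    have h0 : (τ'.comp ρ).comp (ι 0) = κ.comp (ι 0) := by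
      rw [RingHom.comp_assoc, hρ0, ← RingHom.comp_assoc, hτ']
      ext a
      simp [τ]
    refine hι.hom_ext _ _ fun j => ?_
    induction j using Fin.cases with
    | zero => exact h0
    | succ l =>
      refine hx.hom_ext δ hδ ?_ (fun i => ?_) ?_
      · ext r
        have h1 := RingHom.congr_fun (hι.comp l.succ 0) r
        simp only [RingHom.comp_apply] at h1 ⊢
        rw [h1]
        exact RingHom.congr_fun h0 (c r)
      · have h1 := RingHom.congr_fun (hρs l) (x i)
        have h2 := RingHom.congr_fun hτ' (MvPolynomial.C (x i) + MvPolynomial.X (l, i))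
        simp only [RingHom.comp_apply] at h1 h2 ⊢
        rw [h1, hvx, h2]
        simp [τ]
      · rw [RingHom.comp_assoc, ← RingHom.comp_assoc, hδτ, hρs, hvε, ← RingHom.comp_assoc, hδκ, hΔ]
  obtain ⟨p, hp⟩ := Ideal.Quotient.mk_surjective (ρ b)
  refine ⟨p, ?_⟩
  rw [← Ideal.Quotient.eq_zero_iff_mem, map_sub, sub_eq_zero]
  refine (RingHom.congr_fun key b).symm.trans (Eq.trans ?_ (RingHom.congr_fun hτ' p))
  exact congrArg τ' hp.symm

-- The ideal is generated by the differences between the factors of finitely many algebra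
-- generators: modulo these differences all factors agree with the first one, so that the quotient
-- map factors through `Δ`.
include hΔ in
lemma fg_ker_of_isTensorPower (hc : c.FiniteType) (hι : IsTensorPower c ι) :
    (RingHom.ker Δ).FG := by
  let := c.toAlgebra
  have : Algebra.FiniteType k A := hc
  obtain ⟨s, hs⟩ := ‹Algebra.FiniteType k A›
  let G : Ideal B := Ideal.span (Set.range fun p : Fin n × s => ι p.1.succ p.2 - ι 0 p.2)
  suffices h : RingHom.ker Δ = G by
    rw [h]
    exact ⟨(Set.finite_range _).toFinset, by rw [Set.Finite.coe_toFinset]⟩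
  have hΔ' (j) (a : A) : Δ (ι j a) = a := RingHom.congr_fun (hΔ j) a
  refine le_antisymm (fun b hb => ?_) (Ideal.span_le.mpr ?_)
  · have key (l : Fin n) (a : A) : Ideal.Quotient.mk G (ι l.succ a) = Ideal.Quotient.mk G (ι 0 a) := by
      have ha : a ∈ Algebra.adjoin k (s : Set A) := hs ▸ Algebra.mem_top
      induction ha using Algebra.adjoin_induction with
      | mem a ha =>
        rw [Ideal.Quotient.mk_eq_mk_iff_sub_mem]
        exact Ideal.subset_span ⟨(l, ⟨a, ha⟩), rfl⟩
      | algebraMap r => exact congrArg _ (RingHom.congr_fun (hι.comp l.succ 0) r)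
      | add a a' _ _ h h' => rw [map_add, map_add, map_add, map_add, h, h']
      | mul a a' _ _ h h' => rw [map_mul, map_mul, map_mul, map_mul, h, h']
    have h : Ideal.Quotient.mk G = ((Ideal.Quotient.mk G).comp (ι 0)).comp Δ := by
      refine hι.hom_ext _ _ fun j => ?_
      ext a
      simp only [RingHom.comp_apply, hΔ']
      induction j using Fin.cases with
      | zero => rfl
      | succ l => exact key l a
    rw [← Ideal.Quotient.eq_zero_iff_mem, h, RingHom.comp_apply, RingHom.mem_ker.mp hb, map_zero]
  · rintro _ ⟨p, rfl⟩
    simp [hΔ']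

lemma IsEtaleCoord.finiteType (hx : IsEtaleCoord c x) : c.FiniteType := by
  let := (MvPolynomial.eval₂Hom c x).toAlgebra
  have : Algebra.Etale (MvPolynomial (Fin d) k) A := hx
  have h : (MvPolynomial.eval₂Hom c x).FiniteType :=
    (inferInstance : Algebra.FiniteType (MvPolynomial (Fin d) k) A)
  have h' : (MvPolynomial.C (R := k) (σ := Fin d)).FiniteType :=
    (RingHom.finiteType_algebraMap (A := k) (B := MvPolynomial (Fin d) k)).mpr inferInstance
  have := h.comp h'
  rwa [MvPolynomial.eval₂Hom_comp_C] at this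

include hΔ in
/-- The differences of étale coordinates generate the ideal of the diagonal in a neighbourhood of the
diagonal. -/
lemma exists_mul_mem_span (hx : IsEtaleCoord c x) (hι : IsTensorPower c ι) :
    ∃ r, Δ r = 1 ∧ ∀ b ∈ RingHom.ker Δ, r * b ∈
      Ideal.span (Set.range fun p : Fin n × Fin d => ι p.1.succ (x p.2) - ι 0 (x p.2)) := by
  let G := Ideal.span (Set.range fun p : Fin n × Fin d => ι p.1.succ (x p.2) - ι 0 (x p.2))
  have hG : (MvPolynomial.idealOfVars (Fin n × Fin d) A).map (polyHom x ι) = G := by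
    rw [Ideal.map_span, ← Set.range_comp]
    congr 2
    ext p
    simp
  -- The first order neighbourhood, that is, `m = 1` in `polyHom_nbhd`, shows that the coordinate
  -- differences generate the ideal modulo its square.
  have hle : RingHom.ker Δ ≤ G ⊔ RingHom.ker Δ • RingHom.ker Δ := by
    intro b hb
    obtain ⟨p, hp⟩ := (polyHom_nbhd hΔ hx hι 1).1 b
    have h1 : polyHom x ι p ∈ RingHom.ker Δ := by
      rw [← sub_sub_cancel b (polyHom x ι p)]
      exact Ideal.sub_mem _ hb (Ideal.pow_le_self two_ne_zero hp)
    have h2 : p ∈ MvPolynomial.idealOfVars (Fin n × Fin d) A := by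
      rw [← ker_constantCoeff, ← comp_polyHom hΔ]
      exact h1
    have h3 : polyHom x ι p ∈ G := hG ▸ Ideal.mem_map_of_mem _ h2
    rw [← sub_add_cancel b (polyHom x ι p)]
    refine Submodule.add_mem _ (Submodule.mem_sup_right ?_) (Submodule.mem_sup_left h3)
    rw [smul_eq_mul, ← pow_two]
    exact hp
  -- Nakayama's lemma: for a finitely generated ideal, generation modulo the square becomes
  -- generation after multiplication by some `r` congruent to `1`.
  obtain ⟨r, hr, hr'⟩ := Submodule.exists_sub_one_mem_and_smul_le_of_fg_of_le_sup
    (fg_ker_of_isTensorPower hΔ hx.finiteType hι) le_rfl hle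
  refine ⟨r, ?_, fun b hb => hr' (Submodule.smul_mem_pointwise_smul b r _ hb)⟩
  rw [RingHom.mem_ker, map_sub, map_one, sub_eq_zero] at hr
  exact hr

end TensorPower

/-! ### Regularity of the sequence of coordinate differences, by flatness. -/

section Flat

variable {k A B : Type u} [CommRing k] [CommRing A] [CommRing B] {c : k →+* A} {d : ℕ}
  {x : Fin d → A} {ι : Fin 2 → A →+* B}

open TensorProduct in
/-- Flatness is stable under base change. -/
lemma flat_of_isPushout {P R A B : Type u} [CommRing P] [CommRing R] [CommRing A] [CommRing B]
    (φ : P →+* R) (g : P →+* A) (τ : R →+* B) (v : A →+* B) (hcomm : τ.comp φ = v.comp g)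
    (hg : g.Flat)
    (hlift : ∀ {T : Type u} [CommRing T] (a : R →+* T) (b : A →+* T), a.comp φ = b.comp g →
      ∃ h : B →+* T, h.comp τ = a ∧ h.comp v = b)
    (hext : ∀ {T : Type u} [CommRing T] (h h' : B →+* T), h.comp τ = h'.comp τ →
      h.comp v = h'.comp v → h = h') : τ.Flat := by
  let := φ.toAlgebra
  let := g.toAlgebra
  let := τ.toAlgebra
  let := (τ.comp φ).toAlgebra
  have : IsScalarTower P R B := .of_algebraMap_eq fun _ => rfl
  have : Module.Flat P A := hg
  obtain ⟨h, hτ, hv⟩ := hlift (algebraMap R (R ⊗[P] A))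
    (Algebra.TensorProduct.includeRight : A →ₐ[P] R ⊗[P] A).toRingHom (by
      ext r
      change algebraMap P R r ⊗ₜ[P] (1 : A) = (1 : R) ⊗ₜ[P] (algebraMap P A r)
      rw [Algebra.algebraMap_eq_smul_one, Algebra.algebraMap_eq_smul_one, tmul_smul, smul_tmul'])
  have hv' (a : A) : h (v a) = 1 ⊗ₜ[P] a := RingHom.congr_fun hv a
  let h' : B →ₐ[R] R ⊗[P] A := ⟨h, RingHom.congr_fun hτ⟩
  let l : R ⊗[P] A →ₐ[R] B := Algebra.TensorProduct.lift (Algebra.ofId R B)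
    (⟨v, RingHom.congr_fun hcomm.symm⟩ : A →ₐ[P] B) fun _ _ => Commute.all _ _
  have hl0 (p : R) : l (p ⊗ₜ 1) = τ p := by
    simp [l]
    rfl
  have hl1 (a : A) : l (1 ⊗ₜ a) = v a := by
    simp [l]
  have e : R ⊗[P] A ≃ₐ[R] B := AlgEquiv.ofAlgHom l h'
    (by
      have : l.toRingHom.comp h = RingHom.id B := by
        refine hext _ _ ?_ ?_
        · rw [RingHom.comp_assoc, hτ]
          ext p
          exact l.commutes p
        · ext a
          change l (h (v a)) = v a
          rw [hv', hl1]
      exact AlgHom.ext (RingHom.congr_fun this))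
    (by
      refine Algebra.TensorProduct.ext (AlgHom.ext fun p => ?_) (AlgHom.ext fun a => ?_)
      · change h (l (p ⊗ₜ 1)) = p ⊗ₜ 1
        rw [hl0]
        exact RingHom.congr_fun hτ p
      · change h (l (1 ⊗ₜ a)) = 1 ⊗ₜ a
        rw [hl1, hv'])
  exact Module.Flat.of_linearEquiv e.toLinearEquiv.symm

/-- For two factors, `polyHom` is the base change of the étale map `k[X] → A` along `X i ↦ x i + X
(0, i)`, so it is flat. -/
lemma flat_polyHom (hx : IsEtaleCoord c x) (hι : IsTensorPower c ι) : (polyHom x ι).Flat := by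
  let φ : MvPolynomial (Fin d) k →+* MvPolynomial (Fin 1 × Fin d) A :=
    MvPolynomial.eval₂Hom (MvPolynomial.C.comp c)
      (fun i => MvPolynomial.C (x i) + MvPolynomial.X (0, i))
  let g : MvPolynomial (Fin d) k →+* A := MvPolynomial.eval₂Hom c x
  refine flat_of_isPushout φ g _ (ι 1) ?_ ?_ (fun {T} _ a b h => ?_) fun {T} _ h h' h0 h1 => ?_
  · refine MvPolynomial.ringHom_ext (fun r => ?_) fun i => ?_
    · simpa [g, φ] using RingHom.congr_fun (hι.comp 0 1) r
    · simp [g, φ]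
  · let := g.toAlgebra
    have : Algebra.Etale (MvPolynomial (Fin d) k) A := hx
    exact (inferInstance : Module.Flat (MvPolynomial (Fin d) k) A)
  · have hab : (a.comp MvPolynomial.C).comp c = b.comp c := by
      ext r
      simpa [g, φ] using RingHom.congr_fun h (MvPolynomial.C r)
    have hab' (i : Fin d) : a (MvPolynomial.C (x i)) + a (MvPolynomial.X (0, i)) = b (x i) := by
      simpa [g, φ] using RingHom.congr_fun h (MvPolynomial.X i)
    obtain ⟨ψ, hψ⟩ := hι.exists_lift ![a.comp MvPolynomial.C, b] (by
      intro j j'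
      fin_cases j <;> fin_cases j' <;> simp [hab])
    have h0 (s : A) : ψ (ι 0 s) = a (MvPolynomial.C s) := RingHom.congr_fun (hψ 0) s
    have h1 (s : A) : ψ (ι 1 s) = b s := RingHom.congr_fun (hψ 1) s
    refine ⟨ψ, MvPolynomial.ringHom_ext (fun s => ?_) fun p => ?_, RingHom.ext h1⟩
    · simp [h0]
    · obtain ⟨l, i⟩ := p
      obtain rfl : l = 0 := Subsingleton.elim _ _
      simp [h0, h1, ← hab']
  · refine hι.hom_ext _ _ fun j => ?_
    fin_cases j
    · ext s
      simpa using RingHom.congr_fun h0 (MvPolynomial.C s)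
    · exact h1

/-- Multiplication by `r` is injective on `R / J`, hence on its tensor product with the flat algebra
`S`, which is `S / J S`. -/
lemma mem_map_of_flat {R S : Type*} [CommRing R] [CommRing S] {φ : R →+* S} (hφ : φ.Flat)
    (J : Ideal R) (r : R) (hr : ∀ p, r * p ∈ J → p ∈ J) (s : S) (hs : φ r * s ∈ J.map φ) :
    s ∈ J.map φ := by
  let := φ.toAlgebra
  have : Module.Flat R S := hφ
  let μ : (R ⧸ J) →ₗ[R] (R ⧸ J) := LinearMap.lsmul R (R ⧸ J) r
  have hμ : Function.Injective μ := by
    rw [injective_iff_map_eq_zero]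
    intro p hp
    obtain ⟨p, rfl⟩ := Ideal.Quotient.mk_surjective p
    exact Ideal.Quotient.eq_zero_iff_mem.mpr (hr p (Ideal.Quotient.eq_zero_iff_mem.mp hp))
  have hμ' := Module.Flat.rTensor_preserves_injective_linearMap (M := S) μ hμ
  have hμr : μ.rTensor S = LinearMap.lsmul R _ r := by
    refine TensorProduct.ext' fun p s => ?_
    exact (TensorProduct.smul_tmul' r p s).symm
  let e := TensorProduct.quotTensorEquivQuotSMul S J
  have hmap : (J • ⊤ : Submodule R S) = (J.map φ).restrictScalars R := Ideal.smul_top_eq_map J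
  have h1 : Submodule.Quotient.mk (p := (J • ⊤ : Submodule R S)) s = 0 := by
    apply e.symm.injective
    rw [map_zero]
    apply hμ'
    rw [hμr, map_zero, LinearMap.lsmul_apply, ← map_smul, ← Submodule.Quotient.mk_smul,
      (Submodule.Quotient.mk_eq_zero _).mpr, map_zero]
    rw [hmap, Submodule.restrictScalars_mem]
    exact hs
  rw [Submodule.Quotient.mk_eq_zero, hmap] at h1
  exact h1

/-- Membership in an ideal generated by variables is a condition on each monomial, and
multiplication by a variable outside `T` does not affect it. -/
lemma mem_span_X_of_mul_mem {σ : Type*} (T : Set σ) {j : σ} (hj : j ∉ T) (p : MvPolynomial σ A)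
    (hp : MvPolynomial.X j * p ∈ Ideal.span (MvPolynomial.X '' T)) :
    p ∈ Ideal.span (MvPolynomial.X '' T) := by
  rw [MvPolynomial.mem_ideal_span_X_image] at hp ⊢
  intro m hm
  obtain ⟨i, hi, hmi⟩ := hp (Finsupp.single j 1 + m) (by
    rw [MvPolynomial.mem_support_iff, MvPolynomial.coeff_X_mul]
    exact MvPolynomial.mem_support_iff.mp hm)
  refine ⟨i, hi, ?_⟩
  have : i ≠ j := fun h => hj (h ▸ hi)
  simpa [Finsupp.single_apply, this.symm] using hmi

/-- The differences of étale coordinates are a regular sequence. -/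
lemma mem_span_of_mul_mem_span (hx : IsEtaleCoord c x) (hι : IsTensorPower c ι) {S : Type u}
    [CommRing S] {ψ : B →+* S} (hψ : ψ.Flat) (j : Fin d) (s : S)
    (hs : ψ (ι 1 (x j) - ι 0 (x j)) * s ∈
      Ideal.span ((fun i => ψ (ι 1 (x i) - ι 0 (x i))) '' Set.Iio j)) :
    s ∈ Ideal.span ((fun i => ψ (ι 1 (x i) - ι 0 (x i))) '' Set.Iio j) := by
  have hflat := (flat_polyHom hx hι).comp hψ
  let T : Set (Fin 1 × Fin d) := {p | p.2 < j}
  have hT : (Ideal.span (MvPolynomial.X '' T)).map (ψ.comp (polyHom x ι)) =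
      Ideal.span ((fun i => ψ (ι 1 (x i) - ι 0 (x i))) '' Set.Iio j) := by
    rw [Ideal.map_span, ← Set.image_comp]
    congr 1
    ext b
    constructor
    · rintro ⟨⟨l, i⟩, hi, rfl⟩
      obtain rfl : l = 0 := Subsingleton.elim _ _
      exact ⟨i, hi, by simp⟩
    · rintro ⟨i, hi, rfl⟩
      exact ⟨(0, i), hi, by simp⟩
  rw [← hT] at hs ⊢
  refine mem_map_of_flat hflat _ (MvPolynomial.X (0, j))
    (fun p hp => mem_span_X_of_mul_mem T (lt_irrefl j) p hp) s ?_
  simpa using hs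

end Flat

/-! ### Fibre powers of `X` and the affine open subsets `W^n`. -/

section Powers

variable {S X : Scheme.{u}} (f : X ⟶ S)

@[simp]
lemma proj_comp {n : ℕ} (j : Fin n) : proj f j ≫ f = base f n :=
  WidePullback.π_arrow _ _

/-- The morphism to a power of `X` given by its components. -/
def powerLift {n : ℕ} {Z : Scheme.{u}} (b : Z ⟶ S) (g : Fin n → (Z ⟶ X)) (h : ∀ j, g j ≫ f = b) :
    Z ⟶ power f n :=
  WidePullback.lift b g h

@[simp]
lemma powerLift_proj {n : ℕ} {Z : Scheme.{u}} (b : Z ⟶ S) (g : Fin n → (Z ⟶ X))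
    (h : ∀ j, g j ≫ f = b) (j : Fin n) : powerLift f b g h ≫ proj f j = g j :=
  WidePullback.lift_π _ _ _ _ _

@[simp]
lemma powerLift_base {n : ℕ} {Z : Scheme.{u}} (b : Z ⟶ S) (g : Fin n → (Z ⟶ X))
    (h : ∀ j, g j ≫ f = b) : powerLift f b g h ≫ base f n = b :=
  WidePullback.lift_base _ _ _ _

/-- The zeroth power. -/
def powerZeroIso : power f 0 ≅ S where
  hom := base f 0
  inv := powerLift f (𝟙 S) Fin.elim0 (fun j => j.elim0)
  hom_inv_id := power_hom_ext (fun j => j.elim0) (by simp)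
  inv_hom_id := by simp

/-- The powers as iterated fibre products. -/
def powerSuccIso (n : ℕ) : power f (n + 1) ≅ pullback (base f n) f where
  hom := pullback.lift (powerLift f (base f (n + 1)) (fun j => proj f j.castSucc) (by simp))
    (proj f (Fin.last n)) (by simp)
  inv := powerLift f (pullback.snd (base f n) f ≫ f)
    (Fin.lastCases (pullback.snd _ _) (fun j => pullback.fst _ _ ≫ proj f j)) (by
      intro j
      induction j using Fin.lastCases with
      | last => simp
      | cast j => simp [pullback.condition])
  hom_inv_id := by
    refine power_hom_ext (fun j => ?_) (by simp [pullback.lift_snd_assoc])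
    induction j using Fin.lastCases with
    | last => simp [pullback.lift_snd]
    | cast j => simp [pullback.lift_fst_assoc]
  inv_hom_id := by
    refine pullback.hom_ext (power_hom_ext (fun j => ?_) ?_) ?_
    · simp [pullback.lift_fst_assoc]
    · simp [pullback.lift_snd_assoc, pullback.condition]
    · simp [pullback.lift_snd]

instance isSeparated_base [IsSeparated f] (n : ℕ) : IsSeparated (base f n) := by
  induction n with
  | zero => exact inferInstanceAs (IsSeparated (powerZeroIso f).hom)
  | succ n h =>
    have : base f (n + 1) = (powerSuccIso f n).hom ≫ pullback.fst _ _ ≫ base f n := by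
      simp [powerSuccIso, pullback.lift_fst_assoc]
    rw [this]
    infer_instance

instance isSeparated_proj [IsSeparated f] {n : ℕ} (j : Fin n) : IsSeparated (proj f j) := by
  have : IsSeparated (proj f j ≫ f) := by
    rw [proj_comp]
    infer_instance
  exact .of_comp (proj f j) f

/-- The diagonal is a section of the first projection, which is separated. The projection requires
at least one factor, whence `n + 1`. -/
instance isClosedImmersion_diag [IsSeparated f] (n : ℕ) : IsClosedImmersion (diag f (n + 1)) := by
  have : IsClosedImmersion (diag f (n + 1) ≫ proj f 0) := by
    rw [diag_proj]
    infer_instance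
  exact .of_comp (diag f (n + 1)) (proj f 0)

lemma isAffine_power [IsAffine S] [IsAffine X] (n : ℕ) : IsAffine (power f n) := by
  induction n with
  | zero => exact .of_isIso (powerZeroIso f).hom
  | succ n h => exact .of_isIso (powerSuccIso f n).hom

/-- The open subset `W^n` of `X^n`. -/
def cube (n : ℕ) (W : X.Opens) : (power f n).Opens :=
  ⟨{y | ∀ j, proj f j y ∈ W}, by
    simp only [Set.ofPred_forall]
    exact isOpen_iInter_of_finite fun j => (proj f j ⁻¹ᵁ W).2⟩

lemma cube_le {n : ℕ} (W : X.Opens) (j : Fin n) : cube f n W ≤ proj f j ⁻¹ᵁ W := fun _ h => h j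

lemma le_preimage_cube {n : ℕ} {Z : Scheme.{u}} (g : Z ⟶ power f n) {V : Z.Opens} {W : X.Opens}
    (h : ∀ j, V ≤ (g ≫ proj f j) ⁻¹ᵁ W) : V ≤ g ⁻¹ᵁ cube f n W := fun z hz j => by
  have := h j hz
  simpa using this

lemma diag_preimage_cube {n : ℕ} (W : X.Opens) : diag f (n + 1) ⁻¹ᵁ cube f (n + 1) W = W := by
  refine le_antisymm (fun z hz => ?_) (le_preimage_cube f _ fun j => by rw [diag_proj]; rfl)
  have h : (diag f (n + 1) ≫ proj f 0) z ∈ W := by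
    rw [Scheme.Hom.comp_apply]
    exact hz 0
  rw [diag_proj] at h
  simpa using h

/-- The open subset is isomorphic to the fibre power of the affine scheme `W` over the affine base.
-/
lemma isAffineOpen_cube [IsAffine S] (n : ℕ) {W : X.Opens} (hW : IsAffineOpen W) :
    IsAffineOpen (cube f n W) := by
  have : IsAffine W := hW
  have := isAffine_power (W.ι ≫ f) n
  let g : power (W.ι ≫ f) n ⟶ power f n :=
    powerLift f (base _ n) (fun j => proj (W.ι ≫ f) j ≫ W.ι) (by simp)
  have hg : Set.range g ⊆ Set.range (cube f n W).ι := by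
    rw [Scheme.Opens.range_ι]
    rintro _ ⟨y, rfl⟩ j
    rw [← Scheme.Hom.comp_apply, powerLift_proj, Scheme.Hom.comp_apply]
    exact ((proj (W.ι ≫ f) j) y).2
  have hp (j : Fin n) : Set.range ((cube f n W).ι ≫ proj f j) ⊆ Set.range W.ι := by
    rw [Scheme.Opens.range_ι]
    rintro _ ⟨y, rfl⟩
    rw [Scheme.Hom.comp_apply]
    exact y.2 j
  let e : (cube f n W : Scheme) ≅ power (W.ι ≫ f) n :=
    { hom := powerLift _ ((cube f n W).ι ≫ base f n)
        (fun j => IsOpenImmersion.lift W.ι ((cube f n W).ι ≫ proj f j) (hp j)) (by simp)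
      inv := IsOpenImmersion.lift (cube f n W).ι g hg
      hom_inv_id := by
        rw [← cancel_mono (cube f n W).ι, Category.assoc, IsOpenImmersion.lift_fac,
          Category.id_comp]
        refine power_hom_ext (fun j => ?_) ?_
        · rw [Category.assoc, powerLift_proj, ← Category.assoc, powerLift_proj,
            IsOpenImmersion.lift_fac]
        · rw [Category.assoc, powerLift_base, powerLift_base]
      inv_hom_id := by
        refine power_hom_ext (fun j => ?_) ?_
        · rw [Category.assoc, powerLift_proj, ← cancel_mono W.ι, Category.assoc,
            IsOpenImmersion.lift_fac, ← Category.assoc, IsOpenImmersion.lift_fac, powerLift_proj,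
            Category.id_comp]
        · rw [Category.assoc, powerLift_base, ← Category.assoc, IsOpenImmersion.lift_fac,
            powerLift_base, Category.id_comp] }
  have : IsIso e.hom := e.isIso_hom
  exact IsAffine.of_isIso (X := (cube f n W : Scheme)) e.hom

lemma appLE_SpecMap_fromSpec {T : Type u} [CommRing T] {W : X.Opens} (hW : IsAffineOpen W)
    (φ : Γ(X, W) →+* T) (h : ⊤ ≤ (Spec.map (CommRingCat.ofHom φ) ≫ hW.fromSpec) ⁻¹ᵁ W) :
    (Spec.map (CommRingCat.ofHom φ) ≫ hW.fromSpec).appLE W ⊤ h ≫ (Scheme.ΓSpecIso (.of T)).hom =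
      CommRingCat.ofHom φ := by
  have h1 : (hW.fromSpec).appLE W ⊤ hW.fromSpec_preimage_self.ge =
      (Scheme.ΓSpecIso Γ(X, W)).inv := by
    rw [Scheme.Hom.appLE, hW.fromSpec_app_self, Category.assoc, ← Functor.map_comp]
    exact (congrArg _ ((Spec Γ(X, W)).presheaf.map_id _)).trans (Category.comp_id _)
  have h2 := Scheme.Hom.appLE_comp_appLE (Spec.map (CommRingCat.ofHom φ)) hW.fromSpec W ⊤ ⊤
    hW.fromSpec_preimage_self.ge le_rfl
  have h3 : (Spec.map (CommRingCat.ofHom φ)).appLE ⊤ ⊤ le_rfl ≫ _ = _ :=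
    (congrArg (· ≫ _) (Scheme.Hom.appLE_eq_app _)).trans
      (Scheme.ΓSpecIso_naturality (CommRingCat.ofHom φ))
  rw [← h2, h1, Category.assoc]
  exact (congrArg _ h3).trans (Iso.inv_hom_id_assoc _ _)

/-- The homomorphisms from the functions on `W` to the functions on `W^n`. -/
def slotHom {n : ℕ} (W : X.Opens) (j : Fin n) : Γ(X, W) →+* Γ(power f n, cube f n W) :=
  ((proj f j).appLE W (cube f n W) (cube_le f W j)).hom

/-- Homomorphisms from the functions on the affine scheme `W^n` to `T` are the morphisms from `Spec
T` to `W^n`, i.e. families of morphisms to `W` with the same composite to the base. As `W` maps to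
the affine `U`, these are families of homomorphisms from `Γ(X, W)` which agree on `Γ(S, U)`. -/
lemma isTensorPower_cube [IsAffine S] {n : ℕ} {W : X.Opens} (hW : IsAffineOpen W) {U : S.Opens}
    (hU : IsAffineOpen U) (e : W ≤ f ⁻¹ᵁ U) :
    IsTensorPower (f.appLE U W e).hom (slotHom f (n := n + 1) W) where
  comp j j' := by
    have h (j : Fin (n + 1)) := Scheme.Hom.appLE_comp_appLE (proj f j) f U W
      (cube f (n + 1) W) e (cube_le f W j)
    have h' : f.appLE U W e ≫ (proj f j).appLE W (cube f (n + 1) W) (cube_le f W j) =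
        f.appLE U W e ≫ (proj f j').appLE W (cube f (n + 1) W) (cube_le f W j') := by
      rw [h, h]
      simp only [proj_comp]
    exact congrArg CommRingCat.Hom.hom h'
  exists_lift {T} _ g hg := by
    let g' (j : Fin (n + 1)) : Spec (.of T) ⟶ X := Spec.map (CommRingCat.ofHom (g j)) ≫ hW.fromSpec
    have hg' (j) : g' j ≫ f = Spec.map (CommRingCat.ofHom ((g 0).comp (f.appLE U W e).hom)) ≫
        hU.fromSpec := by
      rw [← hg j 0, CommRingCat.ofHom_comp, Spec.map_comp, CommRingCat.ofHom_hom, Category.assoc,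
        Category.assoc, IsAffineOpen.SpecMap_appLE_fromSpec]
    let G := powerLift f _ g' hg'
    have hg'' (j) : ⊤ ≤ g' j ⁻¹ᵁ W := fun z _ => by
      change (g' j) z ∈ W
      rw [Scheme.Hom.comp_apply]
      exact hW.range_fromSpec.le ⟨_, rfl⟩
    have hG : ⊤ ≤ G ⁻¹ᵁ cube f (n + 1) W := le_preimage_cube f _ fun j => by
      rw [powerLift_proj]
      exact hg'' j
    refine ⟨((Scheme.ΓSpecIso (.of T)).hom.hom).comp (G.appLE (cube f (n + 1) W) ⊤ hG).hom,
      fun j => ?_⟩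
    have h := Scheme.Hom.appLE_comp_appLE G (proj f j) W (cube f (n + 1) W) ⊤ (cube_le f W j) hG
    have h' : (G ≫ proj f j).appLE W ⊤ (by rw [powerLift_proj]; exact hg'' j) =
        (g' j).appLE W ⊤ (hg'' j) := by
      simp only [G, powerLift_proj]
    refine congrArg CommRingCat.Hom.hom (Eq.trans ?_ (appLE_SpecMap_fromSpec hW (g j) (hg'' j)))
    rw [← h', ← h, Category.assoc]
    rfl
  hom_ext {T} _ h h' H := by
    have : Spec.map (CommRingCat.ofHom h) ≫ (isAffineOpen_cube f (n + 1) hW).fromSpec =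
        Spec.map (CommRingCat.ofHom h') ≫ (isAffineOpen_cube f (n + 1) hW).fromSpec := by
      have hj (j : Fin (n + 1)) (h : Γ(power f (n + 1), cube f (n + 1) W) →+* T) :
          Spec.map (CommRingCat.ofHom h) ≫ (isAffineOpen_cube f (n + 1) hW).fromSpec ≫ proj f j =
            Spec.map (CommRingCat.ofHom (h.comp (slotHom f W j))) ≫ hW.fromSpec := by
        rw [CommRingCat.ofHom_comp, Spec.map_comp, Category.assoc,
          ← IsAffineOpen.SpecMap_appLE_fromSpec (proj f j) hW _ (cube_le f W j)]
        rfl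
      have hj' (j : Fin (n + 1)) : (Spec.map (CommRingCat.ofHom h) ≫
          (isAffineOpen_cube f (n + 1) hW).fromSpec) ≫ proj f j =
          (Spec.map (CommRingCat.ofHom h') ≫
            (isAffineOpen_cube f (n + 1) hW).fromSpec) ≫ proj f j := by
        rw [Category.assoc, Category.assoc, hj, hj, H]
      refine power_hom_ext hj' ?_
      rw [← proj_comp f 0, ← Category.assoc, ← Category.assoc, hj' 0]
    rw [cancel_mono] at this
    exact CommRingCat.hom_ext_iff.mp (Spec.map_injective this)

end Powers

/-! ### Étale charts and coordinate sequences for the diagonal. -/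

section Charts

lemma appLE_of_eq_id {X : Scheme.{u}} {g : X ⟶ X} (hg : g = 𝟙 X) {U V : X.Opens}
    (h : V ≤ g ⁻¹ᵁ U) (h' : V ≤ U) : (g.appLE U V h).hom = ores h' := by
  subst hg
  exact congrArg CommRingCat.Hom.hom ((congrArg (· ≫ _) (Scheme.Hom.id_app _)).trans
    (Category.id_comp _))

variable {S X : Scheme.{u}} (f : X ⟶ S)

/-- Étale coordinates on an affine open subset. -/
structure IsChart {d : ℕ} (W : X.Opens) (x : Fin d → Γ(X, W)) : Prop where
  isAffineOpen : IsAffineOpen W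
  exists_coord : ∃ (U : S.Opens) (_ : IsAffineOpen U) (e : W ≤ f ⁻¹ᵁ U),
    IsEtaleCoord (f.appLE U W e).hom x

/-- A standard smooth algebra is étale over a polynomial ring; the coordinates are the images of the
variables. -/
lemma exists_isChart [Smooth f] (z : X) :
    ∃ (W : X.Opens) (d : ℕ) (x : Fin d → Γ(X, W)), z ∈ W ∧ IsChart f W x := by
  obtain ⟨U, hU, V, hV, hz, e, h⟩ := Smooth.exists_isStandardSmooth f z
  obtain ⟨d, g, hg, hg'⟩ := h.exists_etale_mvPolynomial
  refine ⟨V, d, fun i => g (MvPolynomial.X i), hz, hV, U, hU, e, ?_⟩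
  have : MvPolynomial.eval₂Hom (f.appLE U V e).hom (fun i => g (MvPolynomial.X i)) = g :=
    MvPolynomial.ringHom_ext (fun r => by rw [← hg]; simp) (by simp)
  rwa [IsEtaleCoord, this]

variable {f}

/-- Restriction between affine open subsets is étale, and étale homomorphisms compose. -/
lemma IsChart.res {d : ℕ} {W : X.Opens} {x : Fin d → Γ(X, W)} (hx : IsChart f W x) {W' : X.Opens}
    (hW' : IsAffineOpen W') (h : W' ≤ W) : IsChart f W' (fun i => ores h (x i)) := by
  obtain ⟨hW, U, hU, e, he⟩ := hx
  refine ⟨hW', U, hU, h.trans e, ?_⟩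
  have h1 : (ores h : Γ(X, W) →+* Γ(X, W')).Etale := by
    have h2 : ((𝟙 X : X ⟶ X).appLE W W' h).hom.Etale :=
      HasRingHomProperty.appLE (P := @Etale) (𝟙 X) inferInstance ⟨W, hW⟩ ⟨W', hW'⟩ h
    rwa [appLE_of_eq_id rfl h h] at h2
  have h2 : MvPolynomial.eval₂Hom (f.appLE U W' (h.trans e)).hom (fun i => ores h (x i)) =
      (ores h).comp (MvPolynomial.eval₂Hom (f.appLE U W e).hom x) := by
    refine MvPolynomial.ringHom_ext (fun r => ?_) (by simp)
    simp only [MvPolynomial.coe_eval₂Hom, MvPolynomial.eval₂_C, RingHom.comp_apply]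
    exact congr($(Scheme.Hom.appLE_map f e (homOfLE h).op).hom r).symm
  rw [IsEtaleCoord, h2]
  exact RingHom.Etale.stableUnderComposition _ _ he h1

variable (f)

lemma exists_isChart_le [Smooth f] {V : X.Opens} {z : X} (hz : z ∈ V) :
    ∃ (W : X.Opens) (d : ℕ) (x : Fin d → Γ(X, W)), z ∈ W ∧ W ≤ V ∧ IsChart f W x := by
  obtain ⟨W, d, x, hzW, hx⟩ := exists_isChart f z
  obtain ⟨_, ⟨W', hW', rfl⟩, hzW', hle⟩ := X.isBasis_affineOpens.exists_subset_of_mem_open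
    (show z ∈ (V ⊓ W : X.Opens) from ⟨hz, hzW⟩) (V ⊓ W).2
  exact ⟨W', d, _, hzW', fun y hy => (hle hy).1,
    hx.res hW' (fun y hy => (hle hy).2 : W' ≤ W)⟩

/-- The restriction to the diagonal of functions on `W^n`. -/
def diagHom (n : ℕ) (W : X.Opens) : Γ(power f (n + 1), cube f (n + 1) W) →+* Γ(X, W) :=
  ((diag f (n + 1)).appLE (cube f (n + 1) W) W (diag_preimage_cube f W).ge).hom

lemma diagHom_comp_slotHom (n : ℕ) (W : X.Opens) (j : Fin (n + 1)) :
    (diagHom f n W).comp (slotHom f W j) = RingHom.id _ := by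
  have h := Scheme.Hom.appLE_comp_appLE (diag f (n + 1)) (proj f j) W (cube f (n + 1) W) W
    (cube_le f W j) (diag_preimage_cube f W).ge
  refine (congrArg CommRingCat.Hom.hom h).trans ?_
  rw [appLE_of_eq_id (diag_proj f j) _ le_rfl]
  ext a
  exact ores_refl a

/-- The differences of coordinates. -/
def coordDiff {d : ℕ} {W : X.Opens} (x : Fin d → Γ(X, W)) (j : Fin d) :
    Γ(power f 2, cube f 2 W) :=
  slotHom f W 1 (x j) - slotHom f W 0 (x j)

lemma span_coordDiff {d : ℕ} {W : X.Opens} (x : Fin d → Γ(X, W)) :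
    Ideal.span (Set.range fun p : Fin 1 × Fin d => slotHom f W p.1.succ (x p.2) -
      slotHom f W 0 (x p.2)) = Ideal.span (Set.range (coordDiff f x)) := by
  congr 1
  ext s
  constructor
  · rintro ⟨⟨l, i⟩, rfl⟩
    obtain rfl : l = 0 := Subsingleton.elim _ _
    exact ⟨i, rfl⟩
  · rintro ⟨i, rfl⟩
    exact ⟨(0, i), rfl⟩

lemma isUnit_ores_basicOpen {Y : Scheme.{u}} {U V : Y.Opens} (r : Γ(Y, U)) (h : V ≤ U)
    (h' : V ≤ Y.basicOpen r) : IsUnit (ores h r) := by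
  have h1 : IsUnit (ores (Y.basicOpen_le r) r) := RingedSpace.isUnit_res_basicOpen _ r
  have := h1.map (ores h')
  rwa [ores_ores] at this

lemma app_ores {Z Y : Scheme.{u}} (g : Z ⟶ Y) {U V : Y.Opens} (h : V ≤ U) (s : Γ(Y, U)) :
    g.app V (ores h s) = ores (show g ⁻¹ᵁ V ≤ g ⁻¹ᵁ U from fun _ hx => h hx) (g.app U s) :=
  congr($(g.naturality (homOfLE h).op) s)

variable {f} in
/-- The diagonal embedding of a smooth scheme has coordinate sequences. -/
lemma IsChart.exists_isCoord [IsAffine S] [IsSeparated f] {d : ℕ} {V : X.Opens}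
    {x : Fin d → Γ(X, V)} (hx : IsChart f V x) :
    ∃ (W : (power f 2).Opens) (h : W ≤ cube f 2 V), V ≤ diag f 2 ⁻¹ᵁ W ∧
      IsCoord (diag f 2) (fun j => ores h (coordDiff f x j)) := by
  obtain ⟨hV, U, hU, e, hx⟩ := hx
  have hι := isTensorPower_cube f (n := 1) hV hU e
  have hC := isAffineOpen_cube f 2 hV
  obtain ⟨r, hr, hr'⟩ := exists_mul_mem_span (diagHom_comp_slotHom f 1 V) hx hι
  rw [span_coordDiff] at hr'
  let Y := power f 2
  have hW : Y.basicOpen r ≤ cube f 2 V := Y.basicOpen_le r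
  -- On the basic open subset of `r` the coordinate differences generate the ideal of the diagonal,
  -- and it contains the diagonal of `V` since `r` restricts to `1`.
  refine ⟨Y.basicOpen r, hW, fun z hz => ?_, ?_⟩
  · have h1 : z ∈ X.basicOpen (diagHom f 1 V r) := by
      rw [hr, Scheme.basicOpen_of_isUnit _ isUnit_one]
      exact hz
    have h2 : X.basicOpen (diagHom f 1 V r) ≤ X.basicOpen ((diag f 2).app _ r) := by
      change X.basicOpen (X.presheaf.map _ _) ≤ _
      rw [Scheme.basicOpen_res]
      exact inf_le_right
    rw [Scheme.preimage_basicOpen]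
    exact h2 h1
  have hvan (j : Fin d) : (diag f 2).app (cube f 2 V) (coordDiff f x j) = 0 := by
    have h1 : diagHom f 1 V (coordDiff f x j) = 0 := by
      have h2 (l) := RingHom.congr_fun (diagHom_comp_slotHom f 1 V l) (x j)
      simp only [RingHom.comp_apply] at h2
      rw [coordDiff, map_sub, h2, h2, sub_self]
    have h3 := congrArg (ores (diag_preimage_cube f V (n := 1)).le) h1
    rw [map_zero] at h3
    refine Eq.trans ?_ h3
    change _ = ores _ (ores _ ((diag f 2).app _ _))
    rw [ores_ores, ores_refl]
  constructor
  · intro j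
    rw [app_ores, hvan, map_zero]
  · intro O hO s hs y hy
    -- On a smaller basic open subset `s` is a fraction with numerator `c` and denominator a power
    -- of `b`. After multiplication by a further power of `b`, the numerator vanishes on the whole
    -- diagonal of `V`, and then `r` times it lies in the span. Both `b` and `r` are units on the
    -- basic open subset.
    obtain ⟨b, hb, hyb⟩ := hC.exists_basicOpen_le ⟨y, hy⟩ (hW (hO hy))
    refine ⟨Y.basicOpen b, hb, hyb, ?_⟩
    have := hC.isLocalization_basicOpen b
    obtain ⟨m, c, hc⟩ := IsLocalization.Away.surj b (ores hb s)
    have hbC : Y.basicOpen b ≤ cube f 2 V := Y.basicOpen_le b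
    change ores hb s * (ores hbC b) ^ m = ores hbC c at hc
    have hc0 : (diag f 2).app _ (ores hbC c) = 0 := by
      rw [← hc, map_mul, app_ores, hs, map_zero, zero_mul]
    rw [app_ores] at hc0
    have hpre := Scheme.preimage_basicOpen (diag f 2) b
    obtain ⟨N, hN⟩ := exists_pow_mul_eq_zero_of_res_basicOpen_eq_zero_of_isCompact X
      (U := diag f 2 ⁻¹ᵁ cube f 2 V) (by
        rw [diag_preimage_cube]
        exact hV.isCompact) ((diag f 2).app _ c) ((diag f 2).app _ b) (by
        have h1 := congrArg (ores hpre.ge) hc0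
        rw [map_zero, ores_ores] at h1
        exact h1)
    have hker : b ^ N * c ∈ RingHom.ker (diagHom f 1 V) := by
      rw [RingHom.mem_ker]
      change ores _ ((diag f 2).app _ (b ^ N * c)) = 0
      rw [map_mul, map_pow, hN, map_zero]
    have hmem := Ideal.mem_map_of_mem (ores hbC) (hr' _ hker)
    rw [Ideal.map_span, ← Set.range_comp] at hmem
    have hbu : IsUnit (ores hbC b) := isUnit_ores_basicOpen b hbC le_rfl
    have hru : IsUnit (ores hbC r) := isUnit_ores_basicOpen r hbC (hb.trans hO)
    rw [map_mul, map_mul, map_pow, ← hc, Ideal.unit_mul_mem_iff_mem _ hru,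
      Ideal.unit_mul_mem_iff_mem _ (hbu.pow N), mul_comm,
      Ideal.unit_mul_mem_iff_mem _ (hbu.pow m)] at hmem
    convert hmem using 3
    funext j
    simp
  · intro O hO a y hy
    by_cases hyd : y ∈ Set.range (diag f 2)
    · obtain ⟨z, rfl⟩ := hyd
      -- At a point of the diagonal the function `a` is extended by pull-back along the first
      -- projection.
      let O' : Y.Opens := O ⊓ proj f (0 : Fin 2) ⁻¹ᵁ (diag f 2 ⁻¹ᵁ O)
      have hz : (diag f 2 ≫ proj f (0 : Fin 2)) z ∈ diag f 2 ⁻¹ᵁ O := by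
        rw [diag_proj]
        simpa using hy
      refine ⟨O', inf_le_left, (proj f (0 : Fin 2)).appLE _ O' inf_le_right a,
        ⟨hy, by rwa [Scheme.Hom.comp_apply] at hz⟩, ?_⟩
      have h1 := Scheme.Hom.appLE_comp_appLE (diag f 2) (proj f (0 : Fin 2)) (diag f 2 ⁻¹ᵁ O) O'
        (diag f 2 ⁻¹ᵁ O') inf_le_right le_rfl
      have h2 := congr(CommRingCat.Hom.hom $h1 a)
      rw [appLE_of_eq_id (diag_proj f (0 : Fin 2)) _
        (show diag f 2 ⁻¹ᵁ O' ≤ diag f 2 ⁻¹ᵁ O from fun w hw => hw.1)] at h2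
      rw [Scheme.Hom.appLE_eq_app] at h2
      exact h2
    · have hcl : IsClosed (Set.range (diag f 2)) := (diag f (1 + 1)).isClosedEmbedding.isClosed_range
      refine ⟨O ⊓ ⟨(Set.range (diag f 2))ᶜ, hcl.isOpen_compl⟩, inf_le_left, 0, ⟨hy, hyd⟩, ?_⟩
      refine ores_eq_of_locally fun z hz => ?_
      exact (hz.2 ⟨z, rfl⟩).elim
  · intro O hO j s hs y hy
    obtain ⟨b, hb, hyb⟩ := hC.exists_basicOpen_le ⟨y, hy⟩ (hW (hO hy))
    refine ⟨Y.basicOpen b, hb, hyb, ?_⟩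
    have := hC.isLocalization_basicOpen b
    have hbC : Y.basicOpen b ≤ cube f 2 V := Y.basicOpen_le b
    -- Regularity is proved for flat algebras over the functions on `V × V`, so it applies to the
    -- localization at `b`.
    have hflat : (ores hbC : Γ(Y, cube f 2 V) →+* Γ(Y, Y.basicOpen b)).Flat := by
      have : Module.Flat Γ(Y, cube f 2 V) Γ(Y, Y.basicOpen b) :=
        IsLocalization.flat _ (Submonoid.powers b)
      exact (RingHom.flat_algebraMap_iff (R := Γ(Y, cube f 2 V))
        (S := Γ(Y, Y.basicOpen b))).mpr this
    have hs' := Ideal.mem_map_of_mem (ores hb) hs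
    rw [Ideal.map_span, ← Set.image_comp, map_mul] at hs'
    simp only [Function.comp_def, ores_ores] at hs' ⊢
    exact mem_span_of_mul_mem_span hx hι hflat j _ hs'

end Charts

/-! ### Powers of a finitely generated ideal in an adic limit. -/

section AdicLimit

/-- In the limit of the quotients by the powers of a finitely generated ideal, the kernels of the
projections are the powers of the ideal. -/
lemma ker_eq_map_pow {B C : Type*} [CommRing B] [CommRing C] (t : B →+* C) {I : Ideal B}
    (hI : I.FG) {A : ℕ → Type*} [∀ k, CommRing (A k)] (π : ∀ k, C →+* A k)
    (hsurj : ∀ k, Function.Surjective ((π k).comp t))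
    (hker : ∀ k, RingHom.ker ((π k).comp t) = I ^ (k + 1))
    (hext : ∀ c, (∀ k, π k c = 0) → c = 0)
    (hlift : ∀ b : ℕ → B, (∀ k, b (k + 1) - b k ∈ I ^ (k + 1)) → ∃ c, ∀ k, π k c = π k (t (b k)))
    (hcomp : ∀ {k l}, k ≤ l → RingHom.ker (π l) ≤ RingHom.ker (π k)) (m : ℕ) :
    RingHom.ker (π m) = I.map t ^ (m + 1) := by
  have hker' (k) (b : B) : π k (t b) = 0 ↔ b ∈ I ^ (k + 1) := by
    rw [← hker]
    rfl
  refine le_antisymm (fun c hc => ?_) ?_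
  -- An element `c` of the kernel of `π m` is approximated by the images of `b k`. Successive
  -- differences from `b m` on lie in higher and higher multiples of `I ^ (m + 1)`.
  · choose b hb using fun k => hsurj k (π k c)
    change ∀ k, π k (t (b k)) = _ at hb
    have hbk {k l} (h : k ≤ l) : π k (t (b l)) = π k c := by
      rw [← sub_eq_zero, ← map_sub]
      refine hcomp h ?_
      rw [RingHom.mem_ker, map_sub, hb, sub_self]
    have hd (j : ℕ) : b (m + j + 1) - b (m + j) ∈ I ^ j • I ^ (m + 1) := by
      rw [smul_eq_mul, ← pow_add, show j + (m + 1) = m + j + 1 by omega, ← hker', map_sub, map_sub,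
        hb, hbk (Nat.le_succ _), sub_self]
    -- Here finite generation enters: the differences are combinations of fixed generators `g i` of
    -- `I ^ (m + 1)` with coefficients `h j i` in `I ^ j`, and for each of the finitely many `i` the
    -- coefficients are summed to one element `c' i` of the limit.
    obtain ⟨r, g, hg⟩ := Submodule.fg_iff_exists_fin_generating_family.mp (hI.pow (n := m + 1))
    rw [← hg] at hd
    choose h hhI hh using fun j => (Submodule.mem_ideal_smul_span_iff_exists_sum _ g _).mp (hd j)
    have hs (i : Fin r) := hlift (fun k => ∑ j ∈ Finset.range (k + 1), h j i) fun k => by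
      rw [Finset.sum_range_succ _ (k + 1), add_sub_cancel_left]
      exact hhI _ _
    choose c' hc' using hs
    have hbm : b m ∈ I ^ (m + 1) := by
      rw [← hker', hb]
      exact hc
    have hgI (i : Fin r) : g i ∈ I ^ (m + 1) := by
      rw [← hg]
      exact Ideal.subset_span ⟨i, rfl⟩
    -- The telescoping sum of the differences, rearranged by generators.
    have hsum : c = t (b m) + ∑ i, t (g i) * c' i := by
      rw [← sub_eq_zero]
      refine hext _ fun k => ?_
      have h1 : ∑ i, g i * ∑ j ∈ Finset.range (k + 1), h j i = b (m + (k + 1)) - b m := by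
        simp_rw [Finset.mul_sum]
        refine Eq.trans ?_ (Finset.sum_range_sub (fun j => b (m + j)) (k + 1))
        rw [Finset.sum_comm]
        refine Finset.sum_congr rfl fun j _ => ?_
        rw [← add_assoc m j 1, ← hh, Finsupp.sum_fintype _ _ (by simp)]
        simp [mul_comm]
      have h2 : π k (∑ i, t (g i) * c' i) = π k (t (b (m + (k + 1)) - b m)) := by
        rw [← h1]
        simp only [map_sum, map_mul, hc']
      rw [map_sub, map_add, h2, map_sub, map_sub, hbk (show k ≤ m + (k + 1) by omega)]
      abel
    rw [hsum, ← Ideal.map_pow]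
    exact Ideal.add_mem _ (Ideal.mem_map_of_mem t hbm) (Ideal.sum_mem _ fun i _ =>
      Ideal.mul_mem_right _ _ (Ideal.mem_map_of_mem t (hgI i)))
  · rw [← Ideal.map_pow, Ideal.map_le_iff_le_comap]
    exact fun b hb => (hker' m b).mpr hb

end AdicLimit

/-! ### Functions on the infinitesimal neighbourhoods of the diagonal. -/

section Nbhds

variable {S X : Scheme.{u}} (f : X ⟶ S) [IsSeparated f] {n : ℕ}

/-- The support of a power of an ideal sheaf is the support of the ideal sheaf, and the diagonal is
closed. -/
lemma exists_diag_eq_nbhdι (k : ℕ) (z : nbhd f (n + 1) k) :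
    ∃ x, diag f (n + 1) x = nbhdι f (n + 1) k z := by
  have h : nbhdι f (n + 1) k z ∈ ((diagIdeal f (n + 1) ^ (k + 1)).support : Set _) := by
    rw [← Scheme.IdealSheafData.range_subschemeι]
    exact ⟨z, rfl⟩
  rw [Scheme.IdealSheafData.support_pow_succ, diagIdeal, Scheme.Hom.support_ker,
    (diag f (n + 1)).isClosedEmbedding.isClosed_range.closure_eq] at h
  exact h

-- The neighbourhood has the same points as the diagonal, so an open subset of it is determined by
-- an open subset of `X`, and any projection could be used to describe it.
variable {f} in
lemma nbhd_preimage_le {V : (power f (n + 1)).Opens} {U : X.Opens} (h : U ≤ diag f (n + 1) ⁻¹ᵁ V)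
    (k : ℕ) : (nbhdι f (n + 1) k ≫ proj f 0) ⁻¹ᵁ U ≤ nbhdι f (n + 1) k ⁻¹ᵁ V := by
  intro z hz
  obtain ⟨x, hx⟩ := exists_diag_eq_nbhdι f k z
  have hz' : (nbhdι f (n + 1) k ≫ proj f 0) z ∈ U := hz
  rw [Scheme.Hom.comp_apply, ← hx, ← Scheme.Hom.comp_apply, diag_proj] at hz'
  change nbhdι f (n + 1) k z ∈ V
  rw [← hx]
  exact h hz'

variable {f} in
/-- The restriction of functions to an infinitesimal neighbourhood of the diagonal. -/
def nbhdRes {V : (power f (n + 1)).Opens} {U : X.Opens} (h : U ≤ diag f (n + 1) ⁻¹ᵁ V) (k : ℕ) :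
    Γ(power f (n + 1), V) →+* Γ(nbhd f (n + 1) k, (nbhdι f (n + 1) k ≫ proj f 0) ⁻¹ᵁ U) :=
  ((nbhdι f (n + 1) k).appLE V _ (nbhd_preimage_le h k)).hom

lemma nbhd_preimage_cube (W : X.Opens) (k : ℕ) :
    (nbhdι f (n + 1) k ≫ proj f 0) ⁻¹ᵁ W = nbhdι f (n + 1) k ⁻¹ᵁ cube f (n + 1) W := by
  refine le_antisymm (nbhd_preimage_le (diag_preimage_cube f W).ge k) fun z hz => ?_
  have hz' : proj f 0 (nbhdι f (n + 1) k z) ∈ W := cube_le f W 0 hz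
  rwa [← Scheme.Hom.comp_apply] at hz'

variable [IsAffine S]

lemma nbhdRes_cube_surjective {W : X.Opens} (hW : IsAffineOpen W) (k : ℕ) :
    Function.Surjective (nbhdRes (n := n) (diag_preimage_cube f W).ge k) := by
  intro s
  obtain ⟨t, ht⟩ := (diagIdeal f (n + 1) ^ (k + 1)).subschemeι_app_surjective
    ⟨_, isAffineOpen_cube f (n + 1) hW⟩ (ores (nbhd_preimage_cube f W k).ge s)
  refine ⟨t, ?_⟩
  have := congrArg (ores (nbhd_preimage_cube f W k).le) ht
  rw [ores_ores, ores_refl] at this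
  exact this

/-- Over the affine open subset `W^(n+1)` a power of the ideal sheaf of the diagonal has the power
of the ideal as its sections. -/
lemma ker_nbhdRes_cube {W : X.Opens} (hW : IsAffineOpen W) (k : ℕ) :
    RingHom.ker (nbhdRes (n := n) (diag_preimage_cube f W).ge k) =
      RingHom.ker (diagHom f n W) ^ (k + 1) := by
  have hC := isAffineOpen_cube f (n + 1) hW
  have h1 : RingHom.ker (diagHom f n W) = (diagIdeal f (n + 1)).ideal ⟨_, hC⟩ := by
    rw [diagIdeal, Scheme.Hom.ker_apply]
    ext s
    rw [RingHom.mem_ker, RingHom.mem_ker]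
    change ores _ ((diag f (n + 1)).app _ s) = 0 ↔ (diag f (n + 1)).app _ s = 0
    refine ⟨fun h => ?_, fun h => by rw [h, map_zero]⟩
    have := congrArg (ores (diag_preimage_cube f (n := n) W).le) h
    rwa [ores_ores, ores_refl, map_zero] at this
  have h2 := (diagIdeal f (n + 1) ^ (k + 1)).ker_subschemeι_app ⟨_, hC⟩
  rw [h1]
  refine Eq.trans ?_ h2
  ext s
  rw [RingHom.mem_ker, RingHom.mem_ker]
  change ores _ ((nbhdι f (n + 1) k).app _ s) = 0 ↔ (nbhdι f (n + 1) k).app _ s = 0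
  refine ⟨fun h => ?_, fun h => by rw [h, map_zero]⟩
  have := congrArg (ores (nbhd_preimage_cube f W k).ge) h
  rwa [ores_ores, ores_refl, map_zero] at this

end Nbhds

/-! ### Sections of the complete bar resolution as compatible families on the neighbourhoods. -/

section BarSections

variable {S X : Scheme.{u}} (f : X ⟶ S)

/-- The ring of sections of the complete bar resolution. -/
abbrev Bar (q : SimplexCategoryᵒᵖ) (U : X.Opens) : CommRingCat.{u} :=
  ((completeBar f).obj q).obj.obj (op U)

/-- The ring of functions on an infinitesimal neighbourhood of the diagonal. -/
abbrev NbhdSec (n k : ℕ) (U : X.Opens) : CommRingCat.{u} :=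
  Γ(nbhd f (n + 1) k, (nbhdι f (n + 1) k ≫ proj f 0) ⁻¹ᵁ U)

lemma appLE_appLE {Z Y T : Scheme.{u}} {g : Z ⟶ Y} {h : Y ⟶ T} {k : Z ⟶ T} (e : g ≫ h = k)
    {U : T.Opens} {V : Y.Opens} {W : Z.Opens} (e₁ : V ≤ h ⁻¹ᵁ U) (e₂ : W ≤ g ⁻¹ᵁ V)
    (e₃ : W ≤ k ⁻¹ᵁ U) (s : Γ(T, U)) :
    (g.appLE V W e₂).hom ((h.appLE U V e₁).hom s) = (k.appLE U W e₃).hom s := by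
  subst e
  exact congr(CommRingCat.Hom.hom $(Scheme.Hom.appLE_comp_appLE g h U V W e₁ e₂) s)

lemma ores_appLE {Z Y : Scheme.{u}} {g : Z ⟶ Y} {U : Y.Opens} {V W : Z.Opens} (e : V ≤ g ⁻¹ᵁ U)
    (h : W ≤ V) (s : Γ(Y, U)) :
    ores h ((g.appLE U V e).hom s) = (g.appLE U W (h.trans e)).hom s :=
  congr(CommRingCat.Hom.hom $(Scheme.Hom.appLE_map g e (homOfLE h).op) s)

lemma appLE_ores {Z Y : Scheme.{u}} {g : Z ⟶ Y} {U V : Y.Opens} {W : Z.Opens} (h : V ≤ U)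
    (e : W ≤ g ⁻¹ᵁ V) (s : Γ(Y, U)) :
    (g.appLE V W e).hom (ores h s) = (g.appLE U W (e.trans (g.preimage_mono h))).hom s :=
  congr(CommRingCat.Hom.hom $(Scheme.Hom.map_appLE g e (homOfLE h).op) s)

lemma nbhd_preimage_mono (n k : ℕ) {U V : X.Opens} (h : V ≤ U) :
    (nbhdι f (n + 1) k ≫ proj f 0) ⁻¹ᵁ V ≤ (nbhdι f (n + 1) k ≫ proj f 0) ⁻¹ᵁ U :=
  fun _ hz => h hz

lemma nbhdMap_preimage_le {m n : ℕ} {σ : Fin (n + 1) → Fin (m + 1)} (hσ : σ 0 = 0) {k k' : ℕ}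
    (h : k ≤ k') (U : X.Opens) : (nbhdι f (m + 1) k ≫ proj f 0) ⁻¹ᵁ U ≤
      nbhdMap f σ h ⁻¹ᵁ ((nbhdι f (n + 1) k' ≫ proj f 0) ⁻¹ᵁ U) := by
  rw [← Scheme.Hom.comp_preimage, nbhdMap_nbhdι_assoc, powerMap_proj, hσ]

/-- The pull-back of functions on infinitesimal neighbourhoods of the diagonal. -/
def nbhdPull {m n : ℕ} {σ : Fin (n + 1) → Fin (m + 1)} (hσ : σ 0 = 0) {k k' : ℕ}
    (h : k ≤ k') (U : X.Opens) : NbhdSec f n k' U →+* NbhdSec f m k U :=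
  ((nbhdMap f σ h).appLE _ _ (nbhdMap_preimage_le f hσ h U)).hom

lemma nbhdPull_nbhdPull {l m n : ℕ} {σ : Fin (n + 1) → Fin (m + 1)} (hσ : σ 0 = 0)
    {τ : Fin (m + 1) → Fin (l + 1)} (hτ : τ 0 = 0) {ρ : Fin (n + 1) → Fin (l + 1)} (hρ : ρ 0 = 0)
    (e : τ ∘ σ = ρ) {k k' k'' : ℕ} (h : k ≤ k') (h' : k' ≤ k'') (U : X.Opens)
    (s : NbhdSec f n k'' U) :
    nbhdPull f hτ h U (nbhdPull f hσ h' U s) = nbhdPull f hρ (h.trans h') U s := by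
  subst e
  exact appLE_appLE (nbhdMap_comp f τ σ h h').symm _ _ _ s

lemma nbhdPull_ores {m n : ℕ} {σ : Fin (n + 1) → Fin (m + 1)} (hσ : σ 0 = 0) {k k' : ℕ}
    (h : k ≤ k') {U V : X.Opens} (hV : V ≤ U) (s : NbhdSec f n k' U) :
    nbhdPull f hσ h V (ores (nbhd_preimage_mono f n k' hV) s) =
      ores (nbhd_preimage_mono f m k hV) (nbhdPull f hσ h U s) := by
  rw [nbhdPull, nbhdPull, appLE_ores, ores_appLE]

/-- The restriction of a section of the bar resolution to an infinitesimal neighbourhood. -/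
def barProj (q : SimplexCategoryᵒᵖ) (k : ℕ) (U : X.Opens) :
    Bar f q U →+* NbhdSec f (q.unop.len + 1) k U :=
  ((limit.π (((nbhds f).obj q.unop).op ⋙ pushStruct X) (op k)).hom.app (op U)).hom

instance : HasLimitsOfShape ℕᵒᵖ (TopCat.Sheaf CommRingCat.{u} X) :=
  inferInstanceAs (HasLimitsOfShape ℕᵒᵖ (Sheaf (Opens.grothendieckTopology X) CommRingCat.{u}))

/-- The functor of sections over an open subset. -/
def sheafSections (U : X.Opens) : TopCat.Sheaf CommRingCat.{u} X ⥤ CommRingCat.{u} :=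
  sheafToPresheaf (Opens.grothendieckTopology X) CommRingCat.{u} ⋙ (evaluation _ _).obj (op U)

instance (U : X.Opens) : PreservesLimitsOfShape ℕᵒᵖ (sheafSections U) :=
  inferInstanceAs (PreservesLimitsOfShape ℕᵒᵖ
    (sheafToPresheaf (Opens.grothendieckTopology X) CommRingCat.{u} ⋙ (evaluation _ _).obj (op U)))

/-- The sections of the bar resolution as a limit. -/
def isLimitBar (q : SimplexCategoryᵒᵖ) (U : X.Opens) :
    IsLimit ((sheafSections U).mapCone
      (limit.cone (((nbhds f).obj q.unop).op ⋙ pushStruct X))) :=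
  isLimitOfPreserves _ (limit.isLimit _)

variable {f}

lemma bar_ext {q : SimplexCategoryᵒᵖ} {U : X.Opens} {a b : Bar f q U}
    (h : ∀ k, barProj f q k U a = barProj f q k U b) : a = b :=
  Concrete.isLimit_ext _ (isLimitBar f q U) a b fun ⟨k⟩ => h k

lemma barProj_comp_map (q : SimplexCategoryᵒᵖ) (U : X.Opens) {k l : ℕ} (h : k ≤ l) :
    CommRingCat.ofHom (barProj f q l U) ≫
      ((pushStruct X).map (((nbhds f).obj q.unop).map (homOfLE h)).op).hom.app (op U) =
      CommRingCat.ofHom (barProj f q k U) :=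
  ((sheafSections U).mapCone
    (limit.cone (((nbhds f).obj q.unop).op ⋙ pushStruct X))).w (homOfLE h).op

lemma nbhdPull_barProj {q : SimplexCategoryᵒᵖ} {U : X.Opens} (a : Bar f q U) {k l : ℕ}
    (h : k ≤ l) : nbhdPull f (σ := id) rfl h U (barProj f q l U a) = barProj f q k U a :=
  have w : (((pushStruct X).map (((nbhds f).obj q.unop).map (homOfLE h)).op).hom.app (op U)).hom
      (barProj f q l U a) = barProj f q k U a := congr($(barProj_comp_map q U h).hom a)
  w

/-- The cone given by a compatible family of homomorphisms. -/
def barCone {T : Type u} [CommRing T] {q : SimplexCategoryᵒᵖ} {U : X.Opens}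
    (t : ∀ k, T →+* NbhdSec f (q.unop.len + 1) k U)
    (ht : ∀ (k l : ℕ) (h : k ≤ l) (x : T), nbhdPull f (σ := id) rfl h U (t l x) = t k x) :
    Cone ((((nbhds f).obj q.unop).op ⋙ pushStruct X) ⋙ sheafSections U) where
  pt := .of T
  π :=
    { app k := CommRingCat.ofHom (t k.unop)
      naturality k l h := by
        ext x
        exact (ht _ _ h.unop.le x).symm }

/-- Compatible families of homomorphisms define a homomorphism to the bar resolution. -/
def barLift {T : Type u} [CommRing T] {q : SimplexCategoryᵒᵖ} {U : X.Opens}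
    (t : ∀ k, T →+* NbhdSec f (q.unop.len + 1) k U)
    (ht : ∀ (k l : ℕ) (h : k ≤ l) (x : T), nbhdPull f (σ := id) rfl h U (t l x) = t k x) :
    T →+* Bar f q U :=
  ((isLimitBar f q U).lift (barCone t ht)).hom

@[simp]
lemma barProj_barLift {T : Type u} [CommRing T] {q : SimplexCategoryᵒᵖ} {U : X.Opens}
    (t : ∀ k, T →+* NbhdSec f (q.unop.len + 1) k U)
    (ht : ∀ (k l : ℕ) (h : k ≤ l) (x : T), nbhdPull f (σ := id) rfl h U (t l x) = t k x) (k : ℕ) (x : T) :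
    barProj f q k U (barLift t ht x) = t k x :=
  have w : CommRingCat.ofHom (barLift t ht) ≫ CommRingCat.ofHom (barProj f q k U) =
      CommRingCat.ofHom (t k) := (isLimitBar f q U).fac (barCone t ht) (op k)
  congr($(w).hom x)

lemma exists_barProj_eq {q : SimplexCategoryᵒᵖ} {U : X.Opens}
    (s : ∀ k, NbhdSec f (q.unop.len + 1) k U)
    (hs : ∀ {k l : ℕ} (h : k ≤ l), nbhdPull f (σ := id) rfl h U (s l) = s k) :
    ∃ a, ∀ k, barProj f q k U a = s k := by
  -- An element of a ring is a homomorphism from the polynomial ring in one variable over `ℤ`, so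
  -- the universal property of the limit yields elements as well.
  let t (k : ℕ) : MvPolynomial (ULift.{u} Unit) (ULift.{u} ℤ) →+* NbhdSec f (q.unop.len + 1) k U :=
    MvPolynomial.eval₂Hom ((Int.castRingHom _).comp ULift.ringEquiv.toRingHom) fun _ => s k
  have ht (k) : t k (MvPolynomial.X ⟨()⟩) = s k := MvPolynomial.eval₂Hom_X' _ _ _
  suffices H : ∀ (k l : ℕ) (h : k ≤ l) (x), nbhdPull f (σ := id) rfl h U (t l x) = t k x from
    ⟨barLift t H (MvPolynomial.X ⟨()⟩), fun k => by rw [barProj_barLift, ht]⟩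
  intro k l h x
  refine RingHom.congr_fun (f := (nbhdPull f (σ := id) rfl h U).comp (t l)) ?_ x
  refine MvPolynomial.ringHom_ext (fun r => ?_) fun i => ?_
  · simp [t]
  · exact (congrArg _ (ht l)).trans ((hs h).trans (ht k).symm)

/-- Restriction of sections of the bar resolution. -/
def bres {q : SimplexCategoryᵒᵖ} {U V : X.Opens} (h : V ≤ U) : Bar f q U →+* Bar f q V :=
  (((completeBar f).obj q).obj.map (homOfLE h).op).hom

@[simp]
lemma bres_bres {q : SimplexCategoryᵒᵖ} {U V W : X.Opens} (h : V ≤ U) (h' : W ≤ V)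
    (b : Bar f q U) : bres h' (bres h b) = bres (h'.trans h) b :=
  congr($(((completeBar f).obj q).obj.map_comp (homOfLE h).op (homOfLE h').op).hom b).symm

@[simp]
lemma bres_refl {q : SimplexCategoryᵒᵖ} {U : X.Opens} (b : Bar f q U) : bres le_rfl b = b :=
  congr($(((completeBar f).obj q).obj.map_id (op U)).hom b)

lemma barProj_bres {q : SimplexCategoryᵒᵖ} {U V : X.Opens} (h : V ≤ U) (b : Bar f q U) (k : ℕ) :
    barProj f q k V (bres h b) =
      ores (nbhd_preimage_mono f _ k h) (barProj f q k U b) :=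
  congr($((limit.π (((nbhds f).obj q.unop).op ⋙ pushStruct X) (op k)).hom.naturality
    (homOfLE h).op).hom b)

/-- The pull-back of sections of the bar resolution. -/
def barPull {p q : SimplexCategoryᵒᵖ} {σ : Fin (p.unop.len + 2) → Fin (q.unop.len + 2)}
    (hσ : σ 0 = 0) (U : X.Opens) : Bar f p U →+* Bar f q U :=
  barLift (fun k => (nbhdPull f hσ (le_refl k) U).comp (barProj f p k U)) (by
    intro k l h b
    simp only [RingHom.comp_apply]
    rw [nbhdPull_nbhdPull f hσ (τ := id) rfl hσ rfl, ← nbhdPull_barProj b h,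
      nbhdPull_nbhdPull f (σ := id) rfl hσ hσ rfl])

@[simp]
lemma barProj_barPull {p q : SimplexCategoryᵒᵖ} {σ : Fin (p.unop.len + 2) → Fin (q.unop.len + 2)}
    (hσ : σ 0 = 0) {U : X.Opens} (b : Bar f p U) (k : ℕ) :
    barProj f q k U (barPull hσ U b) = nbhdPull f hσ le_rfl U (barProj f p k U b)  := by
  rw [barPull, barProj_barLift]
  rfl

lemma barPull_barPull {p q r : SimplexCategoryᵒᵖ}
    {σ : Fin (p.unop.len + 2) → Fin (q.unop.len + 2)} (hσ : σ 0 = 0)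
    {τ : Fin (q.unop.len + 2) → Fin (r.unop.len + 2)} (hτ : τ 0 = 0)
    {ρ : Fin (p.unop.len + 2) → Fin (r.unop.len + 2)} (hρ : ρ 0 = 0) (h : τ ∘ σ = ρ)
    {U : X.Opens} (b : Bar f p U) : barPull hτ U (barPull hσ U b) = barPull hρ U b := by
  subst h
  refine bar_ext fun k => ?_
  rw [barProj_barPull, barProj_barPull, barProj_barPull,
    nbhdPull_nbhdPull f hσ hτ hρ rfl]

lemma barPull_id {p : SimplexCategoryᵒᵖ} {σ : Fin (p.unop.len + 2) → Fin (p.unop.len + 2)}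
    (hσ : σ 0 = 0) (h : σ = id) {U : X.Opens} (b : Bar f p U) : barPull hσ U b = b := by
  subst h
  exact bar_ext fun k => by rw [barProj_barPull, nbhdPull_barProj]

lemma bres_barPull {p q : SimplexCategoryᵒᵖ} {σ : Fin (p.unop.len + 2) → Fin (q.unop.len + 2)}
    (hσ : σ 0 = 0) {U V : X.Opens} (h : V ≤ U) (b : Bar f p U) :
    bres h (barPull hσ U b) = barPull hσ V (bres h b) := by
  refine bar_ext fun k => ?_
  rw [barProj_bres, barProj_barPull, barProj_barPull, barProj_bres, nbhdPull_ores f hσ le_rfl h]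

lemma completeBar_map_comp_barProj {p q : SimplexCategoryᵒᵖ} (θ : p ⟶ q) (U : X.Opens) (k : ℕ) :
    ((completeBar f).map θ).hom.app (op U) ≫ CommRingCat.ofHom (barProj f q k U) =
      CommRingCat.ofHom (barProj f p k U) ≫
        ((pushStruct X).map (((nbhds f).map θ.unop).app k).op).hom.app (op U) :=
  congrArg (sheafSections U).map (limMap_π
    (Functor.whiskerRight (NatTrans.op ((nbhds f).map θ.unop)) (pushStruct X)) (op k))

lemma barProj_comp_completeBar_map {p q : SimplexCategoryᵒᵖ} (θ : p ⟶ q) (U : X.Opens) (k : ℕ) :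
    (barProj f q k U).comp (((completeBar f).map θ).hom.app (op U)).hom =
      (((pushStruct X).map (((nbhds f).map θ.unop).app k).op).hom.app (op U)).hom.comp
        (barProj f p k U) :=
  congrArg CommRingCat.Hom.hom (completeBar_map_comp_barProj θ U k)

lemma pushStruct_map_nbhds {p q : SimplexCategory} (θ : p ⟶ q) (U : X.Opens) (k : ℕ) :
    (((pushStruct X).map (((nbhds f).map θ).app k).op).hom.app (op U)).hom =
      nbhdPull f (slots_zero θ) le_rfl U := rfl

/-- This replaces the categorical simplicial structure by explicit pull-backs. The map `barPull` is
also available for maps of slots which fix only the first slot and do not come from the simplex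
category; the contraction needs them. -/
lemma completeBar_map_app {p q : SimplexCategoryᵒᵖ} (θ : p ⟶ q) (U : X.Opens) (b : Bar f p U) :
    (((completeBar f).map θ).hom.app (op U)).hom b = barPull (slots_zero θ.unop) U b := by
  refine bar_ext fun k => ?_
  rw [barProj_barPull, ← pushStruct_map_nbhds]
  exact RingHom.congr_fun (barProj_comp_completeBar_map θ U k) b

/-- The augmentation of the bar resolution on sections. -/
def barAug (q : SimplexCategoryᵒᵖ) (U : X.Opens) : Bar f q U →+* Γ(X, U) :=
  ((augmentation f q).hom.app (op U)).hom

lemma mem_barIdeal {q : SimplexCategoryᵒᵖ} {U : X.Opens} {b : Bar f q U} :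
    b ∈ barIdeal f q U ↔ barAug q U b = 0 := Iff.rfl

lemma barAug_bres {q : SimplexCategoryᵒᵖ} {U V : X.Opens} (h : V ≤ U) (b : Bar f q U) :
    barAug q V (bres h b) = ores h (barAug q U b) :=
  congr($((augmentation f q).hom.naturality (homOfLE h).op).hom b)

lemma le_toNbhd_preimage (n k : ℕ) (U : X.Opens) :
    U ≤ toNbhd f (n + 1) k ⁻¹ᵁ ((nbhdι f (n + 1) k ≫ proj f 0) ⁻¹ᵁ U) := by
  rw [← Scheme.Hom.comp_preimage, toNbhd_nbhdι_assoc, diag_proj]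
  rfl

/-- The augmentation is defined on the zeroth neighbourhood but can be computed on any of them,
because the embeddings of the diagonal are compatible. -/
lemma barAug_eq (q : SimplexCategoryᵒᵖ) {U : X.Opens} (b : Bar f q U) (k : ℕ) : barAug q U b =
    ((toNbhd f (q.unop.len + 2) k).appLE _ U (le_toNbhd_preimage _ k U)).hom
      (barProj f q k U b) := by
  have h0 : barAug q U b = ((toNbhd f (q.unop.len + 2) 0).appLE _ U
      (le_toNbhd_preimage _ 0 U)).hom (barProj f q 0 U b) := rfl
  rw [h0, ← nbhdPull_barProj b (Nat.zero_le k)]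
  exact appLE_appLE (toNbhd_nbhdMap f _ _) _ _ _ _

lemma barAug_barPull {p q : SimplexCategoryᵒᵖ} {σ : Fin (p.unop.len + 2) → Fin (q.unop.len + 2)}
    (hσ : σ 0 = 0) {U : X.Opens} (b : Bar f p U) :
    barAug q U (barPull hσ U b) = barAug p U b := by
  rw [barAug_eq q _ 0, barAug_eq p _ 0, barProj_barPull]
  exact appLE_appLE (toNbhd_nbhdMap f _ _) _ _ _ _

variable [IsSeparated f]

lemma nbhdPull_nbhdRes {m n : ℕ} {σ : Fin (n + 1) → Fin (m + 1)} (hσ : σ 0 = 0) {k k' : ℕ}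
    (h : k ≤ k') {V : (power f (n + 1)).Opens} {V' : (power f (m + 1)).Opens} {U : X.Opens}
    (hV : U ≤ diag f (n + 1) ⁻¹ᵁ V) (hV' : U ≤ diag f (m + 1) ⁻¹ᵁ V')
    (e : V' ≤ powerMap f σ ⁻¹ᵁ V) (s : Γ(power f (n + 1), V)) :
    nbhdPull f hσ h U (nbhdRes hV k' s) = nbhdRes hV' k (((powerMap f σ).appLE V V' e).hom s) := by
  have h1 := nbhd_preimage_le hV' k
  rw [nbhdPull, nbhdRes, nbhdRes,
    appLE_appLE (k := nbhdι f (m + 1) k ≫ powerMap f σ) (nbhdMap_nbhdι f σ h) _ _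
      (show _ ≤ (nbhdι f (m + 1) k ≫ powerMap f σ) ⁻¹ᵁ V from fun _ hz => e (h1 hz)),
    appLE_appLE rfl]

lemma nbhdPull_id_nbhdRes {n : ℕ} {V : (power f (n + 1)).Opens} {U : X.Opens}
    (hV : U ≤ diag f (n + 1) ⁻¹ᵁ V) {k k' : ℕ} (h : k ≤ k') (s : Γ(power f (n + 1), V)) :
    nbhdPull f (σ := id) rfl h U (nbhdRes hV k' s) = nbhdRes hV k s := by
  rw [nbhdPull_nbhdRes rfl h hV hV (by rw [powerMap_id]; rfl),
    appLE_of_eq_id (powerMap_id f _) _ le_rfl, ores_refl]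

/-- The image in the bar resolution of functions on the powers of `X`. -/
def toBar (q : SimplexCategoryᵒᵖ) {V : (power f (q.unop.len + 2)).Opens} {U : X.Opens}
    (h : U ≤ diag f (q.unop.len + 2) ⁻¹ᵁ V) : Γ(power f (q.unop.len + 2), V) →+* Bar f q U :=
  barLift (fun k => nbhdRes h k) (fun _ _ => nbhdPull_id_nbhdRes h)

@[simp]
lemma barProj_toBar (q : SimplexCategoryᵒᵖ) {V : (power f (q.unop.len + 2)).Opens} {U : X.Opens}
    (h : U ≤ diag f (q.unop.len + 2) ⁻¹ᵁ V) (s : Γ(power f (q.unop.len + 2), V)) (k : ℕ) :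
    barProj f q k U (toBar q h s) = nbhdRes h k s  := by
  rw [toBar, barProj_barLift]

lemma bres_toBar (q : SimplexCategoryᵒᵖ) {V : (power f (q.unop.len + 2)).Opens} {U U' : X.Opens}
    (h : U ≤ diag f (q.unop.len + 2) ⁻¹ᵁ V) (h' : U' ≤ U) (s : Γ(power f (q.unop.len + 2), V)) :
    bres h' (toBar q h s) = toBar q (h'.trans h) s := by
  refine bar_ext fun k => ?_
  rw [barProj_bres, barProj_toBar, barProj_toBar]
  exact ores_appLE _ _ _

lemma toBar_ores (q : SimplexCategoryᵒᵖ) {V V' : (power f (q.unop.len + 2)).Opens} {U : X.Opens}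
    (h : U ≤ diag f (q.unop.len + 2) ⁻¹ᵁ V') (h' : V' ≤ V) (s : Γ(power f (q.unop.len + 2), V)) :
    toBar q h (ores h' s) = toBar q (h.trans ((diag f (q.unop.len + 2)).preimage_mono h')) s := by
  refine bar_ext fun k => ?_
  rw [barProj_toBar, barProj_toBar]
  exact appLE_ores _ _ _

lemma barPull_toBar {p q : SimplexCategoryᵒᵖ} {σ : Fin (p.unop.len + 2) → Fin (q.unop.len + 2)}
    (hσ : σ 0 = 0) {V : (power f (p.unop.len + 2)).Opens} {V' : (power f (q.unop.len + 2)).Opens}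
    {U : X.Opens} (h : U ≤ diag f (p.unop.len + 2) ⁻¹ᵁ V)
    (h' : U ≤ diag f (q.unop.len + 2) ⁻¹ᵁ V') (e : V' ≤ powerMap f σ ⁻¹ᵁ V)
    (s : Γ(power f (p.unop.len + 2), V)) :
    barPull hσ U (toBar p h s) = toBar q h' (((powerMap f σ).appLE V V' e).hom s) := by
  refine bar_ext fun k => ?_
  rw [barProj_barPull, barProj_toBar, barProj_toBar, nbhdPull_nbhdRes hσ le_rfl h h' e]

lemma barAug_toBar (q : SimplexCategoryᵒᵖ) {V : (power f (q.unop.len + 2)).Opens} {U : X.Opens}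
    (h : U ≤ diag f (q.unop.len + 2) ⁻¹ᵁ V) (s : Γ(power f (q.unop.len + 2), V)) :
    barAug q U (toBar q h s) = ((diag f (q.unop.len + 2)).appLE V U h).hom s := by
  rw [barAug_eq q _ 0, barProj_toBar]
  exact appLE_appLE (toNbhd_nbhdι f _ _) _ _ _ _

end BarSections

/-! ### The bar resolution over a chart: polynomials in the coordinate differences. -/

section BarCharts

variable {S X : Scheme.{u}} {f : X ⟶ S}

lemma barIdeal_le_comap_bres (q : SimplexCategoryᵒᵖ) {U V : X.Opens} (h : V ≤ U) (m : ℕ) :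
    barIdeal f q U ^ m ≤ (barIdeal f q V ^ m).comap (bres h) := by
  refine le_trans (Ideal.pow_right_mono (fun b hb => ?_) m) (Ideal.le_comap_pow _ m)
  rw [Ideal.mem_comap, mem_barIdeal, barAug_bres, mem_barIdeal.mp hb, map_zero]

lemma barIdeal_le_comap_barPull {p q : SimplexCategoryᵒᵖ}
    {σ : Fin (p.unop.len + 2) → Fin (q.unop.len + 2)} (hσ : σ 0 = 0) (U : X.Opens) (m : ℕ) :
    barIdeal f p U ^ m ≤ (barIdeal f q U ^ m).comap (barPull hσ U) := by
  refine le_trans (Ideal.pow_right_mono (fun b hb => ?_) m) (Ideal.le_comap_pow _ m)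
  rw [Ideal.mem_comap, mem_barIdeal, barAug_barPull, mem_barIdeal.mp hb]

lemma barPull_mem_pow {p q : SimplexCategoryᵒᵖ} {σ : Fin (p.unop.len + 2) → Fin (q.unop.len + 2)}
    (hσ : σ 0 = 0) {U : X.Opens} {m : ℕ} {b : Bar f p U} (hb : b ∈ barIdeal f p U ^ m) :
    barPull hσ U b ∈ barIdeal f q U ^ m := by
  have := barIdeal_le_comap_barPull (f := f) (q := q) hσ U m hb
  rwa [Ideal.mem_comap] at this

lemma bres_mem_pow {q : SimplexCategoryᵒᵖ} {U V : X.Opens} (h : V ≤ U) {m : ℕ} {b : Bar f q U}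
    (hb : b ∈ barIdeal f q U ^ m) : bres h b ∈ barIdeal f q V ^ m := by
  have := barIdeal_le_comap_bres (f := f) q h m hb
  rwa [Ideal.mem_comap] at this

lemma le_diag_preimage_proj {n : ℕ} (j : Fin n) (U : X.Opens) :
    U ≤ diag f n ⁻¹ᵁ (proj f j ⁻¹ᵁ U) := by
  rw [← Scheme.Hom.comp_preimage, diag_proj]
  rfl

variable [IsSeparated f]

/-- The homomorphism from functions on `X` to the bar resolution given by a tensor factor. -/
def slotBar (q : SimplexCategoryᵒᵖ) (U : X.Opens) (j : Fin (q.unop.len + 2)) :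
    Γ(X, U) →+* Bar f q U :=
  (toBar q (le_diag_preimage_proj j U)).comp ((proj f j).appLE U _ le_rfl).hom

lemma toBar_appLE_proj (q : SimplexCategoryᵒᵖ) {U U' : X.Opens} (j : Fin (q.unop.len + 2))
    {V : (power f (q.unop.len + 2)).Opens} (h : U' ≤ diag f (q.unop.len + 2) ⁻¹ᵁ V)
    (e : V ≤ proj f j ⁻¹ᵁ U) (h' : U' ≤ U) (a : Γ(X, U)) :
    toBar q h (((proj f j).appLE U V e).hom a) = bres h' (slotBar q U j a) := by
  rw [slotBar, RingHom.comp_apply, bres_toBar]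
  have : ((proj f j).appLE U V e).hom a = ores e (((proj f j).appLE U _ le_rfl).hom a) := by
    rw [ores_appLE]
  rw [this, toBar_ores]

lemma slotBar_eq_toBar (q : SimplexCategoryᵒᵖ) {U : X.Opens} (j : Fin (q.unop.len + 2))
    {V : (power f (q.unop.len + 2)).Opens} (h : U ≤ diag f (q.unop.len + 2) ⁻¹ᵁ V)
    (e : V ≤ proj f j ⁻¹ᵁ U) (a : Γ(X, U)) :
    slotBar q U j a = toBar q h (((proj f j).appLE U V e).hom a) := by
  rw [toBar_appLE_proj q j h e le_rfl, bres_refl]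

lemma bres_slotBar (q : SimplexCategoryᵒᵖ) {U V : X.Opens} (h : V ≤ U)
    (j : Fin (q.unop.len + 2)) (a : Γ(X, U)) :
    bres h (slotBar (f := f) q U j a) = slotBar q V j (ores h a) := by
  rw [slotBar_eq_toBar q j (le_diag_preimage_proj j V) le_rfl, appLE_ores,
    toBar_appLE_proj q j _ _ h]

lemma barPull_slotBar {p q : SimplexCategoryᵒᵖ} {σ : Fin (p.unop.len + 2) → Fin (q.unop.len + 2)}
    (hσ : σ 0 = 0) (U : X.Opens) (j : Fin (p.unop.len + 2)) (a : Γ(X, U)) :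
    barPull hσ U (slotBar (f := f) p U j a) = slotBar q U (σ j) a := by
  have e : proj f (σ j) ⁻¹ᵁ U ≤ powerMap f σ ⁻¹ᵁ (proj f j ⁻¹ᵁ U) := by
    rw [← Scheme.Hom.comp_preimage, powerMap_proj]
  rw [slotBar, RingHom.comp_apply, barPull_toBar hσ _ (le_diag_preimage_proj (σ j) U) e,
    appLE_appLE (powerMap_proj f σ j) _ _ le_rfl]
  rfl

lemma barAug_slotBar (q : SimplexCategoryᵒᵖ) (U : X.Opens) (j : Fin (q.unop.len + 2))
    (a : Γ(X, U)) : barAug q U (slotBar (f := f) q U j a) = a := by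
  rw [slotBar, RingHom.comp_apply, barAug_toBar, appLE_appLE (diag_proj f j) _ _ (le_refl U),
    appLE_of_eq_id rfl (le_refl U) le_rfl, ores_refl]

lemma toBar_comp_slotHom (q : SimplexCategoryᵒᵖ) (W : X.Opens) (j : Fin (q.unop.len + 2))
    (a : Γ(X, W)) : toBar q (diag_preimage_cube f W).ge (slotHom f W j a) = slotBar q W j a := by
  rw [slotBar_eq_toBar q j (diag_preimage_cube f W).ge (cube_le f W j)]
  rfl

lemma toBar_comp_polyHom (q : SimplexCategoryᵒᵖ) {W : X.Opens} {d : ℕ} (x : Fin d → Γ(X, W)) :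
    (toBar q (diag_preimage_cube f W).ge).comp (polyHom x (slotHom f W)) =
      polyHom x (slotBar (f := f) q W) := by
  refine MvPolynomial.ringHom_ext (fun a => ?_) fun p => ?_
  · rw [RingHom.comp_apply, polyHom_C, polyHom_C, toBar_comp_slotHom]
  · rw [RingHom.comp_apply, polyHom_X, polyHom_X, map_sub, toBar_comp_slotHom, toBar_comp_slotHom]

lemma bres_polyHom (q : SimplexCategoryᵒᵖ) {W W' : X.Opens} (h : W' ≤ W) {d : ℕ}
    (x : Fin d → Γ(X, W)) (p : MvPolynomial (Fin (q.unop.len + 1) × Fin d) Γ(X, W)) :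
    bres h (polyHom x (slotBar (f := f) q W) p) =
      polyHom (fun i => ores h (x i)) (slotBar q W') (p.map (ores h)) := by
  refine RingHom.congr_fun (f := (bres h).comp (polyHom x (slotBar (f := f) q W)))
    (g := (polyHom (fun i => ores h (x i)) (slotBar q W')).comp (MvPolynomial.map (ores h))) ?_ p
  refine MvPolynomial.ringHom_ext (fun a => ?_) fun p => ?_
  · rw [RingHom.comp_apply, RingHom.comp_apply, polyHom_C, MvPolynomial.map_C, polyHom_C,
      bres_slotBar]
  · rw [RingHom.comp_apply, RingHom.comp_apply, polyHom_X, MvPolynomial.map_X, polyHom_X, map_sub,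
      bres_slotBar, bres_slotBar]

variable [IsAffine S]

/-- The sections over `W` are the limit of the quotients by the powers of the finitely generated
ideal of the diagonal in `W^(q+2)`, so `ker_eq_map_pow` applies. Consequently the filtration by
neighbourhoods is the adic one. -/
lemma IsChart.ker_barProj {d : ℕ} {W : X.Opens} {x : Fin d → Γ(X, W)} (hx : IsChart f W x)
    (q : SimplexCategoryᵒᵖ) (m : ℕ) : RingHom.ker (barProj f q m W) = barIdeal f q W ^ (m + 1) := by
  obtain ⟨hW, U, hU, e, hx⟩ := hx
  have hι := isTensorPower_cube f (n := q.unop.len + 1) hW hU e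
  have hΔ := diagHom_comp_slotHom f (q.unop.len + 1) W
  have key := ker_eq_map_pow (toBar q (diag_preimage_cube f W).ge)
    (fg_ker_of_isTensorPower hΔ hx.finiteType hι) (fun k => barProj f q k W)
    (fun k s => by
      obtain ⟨t, ht⟩ := nbhdRes_cube_surjective f hW k s
      exact ⟨t, (barProj_toBar _ _ _ _).trans ht⟩)
    (fun k => by
      rw [← ker_nbhdRes_cube f hW k]
      ext s
      rw [RingHom.mem_ker, RingHom.mem_ker, RingHom.comp_apply, barProj_toBar])
    (fun c hc => bar_ext fun k => by rw [hc, map_zero])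
    (fun b hb => by
      obtain ⟨c, hc⟩ := exists_barProj_eq (f := f) (q := q)
        (fun k => nbhdRes (diag_preimage_cube f W).ge k (b k)) (fun {k l} h => by
          rw [nbhdPull_id_nbhdRes]
          induction l, h using Nat.le_induction with
          | base => rfl
          | succ l h ih =>
            rw [← ih, ← sub_eq_zero, ← map_sub]
            have := Ideal.pow_le_pow_right (Nat.succ_le_succ h) (hb l)
            rwa [← ker_nbhdRes_cube f hW k] at this)
      exact ⟨c, fun k => by rw [hc, barProj_toBar]⟩)
    (fun {k l} h b hb => by
      rw [RingHom.mem_ker, ← nbhdPull_barProj b h, RingHom.mem_ker.mp hb, map_zero])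
  -- The zeroth neighbourhood is the diagonal itself, so the kernel of `barProj` for `m = 0` is the
  -- ideal which defines the topology.
  have h0 : RingHom.ker (barProj f q 0 W) = barIdeal f q W := by
    ext b
    rw [RingHom.mem_ker, mem_barIdeal]
    obtain ⟨s, hs⟩ := nbhdRes_cube_surjective f hW 0 (barProj f q 0 W b)
    have h1 : barAug q W b = diagHom f _ W s := by
      have : barAug q W b = barAug q W (toBar q (diag_preimage_cube f W).ge s) := by
        rw [barAug_eq q b 0, barAug_eq q _ 0, barProj_toBar, hs]
      rw [this, barAug_toBar]
      rfl
    have h2 := ker_nbhdRes_cube f (n := q.unop.len + 1) hW 0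
    rw [zero_add, pow_one] at h2
    rw [h1, ← hs]
    exact congr(s ∈ $h2).to_iff
  have h1 := key 0
  rw [h0, zero_add, pow_one] at h1
  rw [key, h1]

/-- Polynomials in the coordinate differences are dense for the adic topology. Only the
approximation to a given order is needed, never the full power series. -/
lemma IsChart.exists_sub_polyHom_mem {d : ℕ} {W : X.Opens} {x : Fin d → Γ(X, W)}
    (hx : IsChart f W x) (q : SimplexCategoryᵒᵖ) (b : Bar f q W) (m : ℕ) :
    ∃ p, b - polyHom x (slotBar q W) p ∈ barIdeal f q W ^ m := by
  rcases m with _ | m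
  · exact ⟨0, by simp⟩
  rw [← hx.ker_barProj]
  obtain ⟨hW, U, hU, e, hx⟩ := hx
  have hι := isTensorPower_cube f (n := q.unop.len + 1) hW hU e
  obtain ⟨s, hs⟩ := nbhdRes_cube_surjective f hW m (barProj f q m W b)
  obtain ⟨p, hp⟩ := (polyHom_nbhd (diagHom_comp_slotHom f (q.unop.len + 1) W) hx hι m).1 s
  refine ⟨p, ?_⟩
  rw [← ker_nbhdRes_cube f hW m, RingHom.mem_ker, map_sub, sub_eq_zero] at hp
  rw [← toBar_comp_polyHom, RingHom.mem_ker, map_sub, RingHom.comp_apply, barProj_toBar, ← hs, hp,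
    sub_self]

/-- The order of vanishing on the diagonal of a polynomial in the differences is its order as a
polynomial, which makes approximations unique up to higher order. -/
lemma IsChart.polyHom_mem_iff {d : ℕ} {W : X.Opens} {x : Fin d → Γ(X, W)}
    (hx : IsChart f W x) (q : SimplexCategoryᵒᵖ) (m : ℕ)
    (p : MvPolynomial (Fin (q.unop.len + 1) × Fin d) Γ(X, W)) :
    polyHom x (slotBar q W) p ∈ barIdeal f q W ^ m ↔ p ∈ MvPolynomial.idealOfVars _ _ ^ m := by
  rcases m with _ | m
  · simp
  rw [← hx.ker_barProj]
  obtain ⟨hW, U, hU, e, hx⟩ := hx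
  have hι := isTensorPower_cube f (n := q.unop.len + 1) hW hU e
  rw [← (polyHom_nbhd (diagHom_comp_slotHom f (q.unop.len + 1) W) hx hι m).2 p,
    ← ker_nbhdRes_cube f hW m, ← toBar_comp_polyHom, RingHom.mem_ker, RingHom.comp_apply,
    barProj_toBar, RingHom.mem_ker]

end BarCharts

/-! ### Continuity for adic topologies and its locality. -/

section Continuity

lemma continuous_adic_discrete_iff {A B : Type*} [CommRing A] [AddCommGroup B] (I : Ideal A)
    (g : A →+ B) : Continuous[I.adicTopology, ⊥] g ↔ ∃ m : ℕ, ∀ a ∈ I ^ m, g a = 0 := by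
  let := I.adicTopology
  let : TopologicalSpace B := ⊥
  have : DiscreteTopology B := ⟨rfl⟩
  refine ⟨fun h => ?_, fun ⟨m, hm⟩ => ?_⟩
  · have h1 : g ⁻¹' {0} ∈ 𝓝 (0 : A) := h.continuousAt.preimage_mem_nhds (by
      rw [map_zero]
      exact (isOpen_discrete _).mem_nhds rfl)
    obtain ⟨m, -, hm⟩ := I.hasBasis_nhds_zero_adic.mem_iff.mp h1
    exact ⟨m, fun a ha => hm ha⟩
  · refine continuous_of_continuousAt_zero g ?_
    rw [ContinuousAt, map_zero]
    refine Filter.Tendsto.mono_right (y := pure 0) ?_ (pure_le_nhds 0)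
    rw [Filter.tendsto_pure]
    exact Filter.mem_of_superset (I.hasBasis_nhds_zero_adic.mem_of_mem (i := m) trivial)
      fun a ha => hm a ha

variable {Y : Scheme.{u}} {N : TopModule Y} {M : Y.Modules} {U : Y.Opens}

/-- The continuity of homomorphisms is a local property. -/
lemma mem_contHomOn_of_locally
    (φ : ∀ V : {V : Y.Opens // V ≤ U}, Γ(N.mod, V.1) →ₗ[Γ(Y, V.1)] Γ(M, V.1))
    (hφ : ∀ (V W : {V : Y.Opens // V ≤ U}) (h : W.1 ≤ V.1) (s : Γ(N.mod, V.1)),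
      φ W (res N.mod h s) = res M h (φ V s))
    (H : ∀ y ∈ U, ∃ (V : Y.Opens) (h : V ≤ U), y ∈ V ∧ ∀ (W : Y.affineOpens) (hW : W.1 ≤ V),
      Continuous[N.top W, ⊥] (φ ⟨W.1, hW.trans h⟩)) : φ ∈ contHomOn N M U := by
  choose V hV hy hc using fun y : U => H y.1 y.2
  -- The restrictions are sections of the sheaf of continuous homomorphisms, and their gluing in
  -- this sheaf is `φ`.
  let s (y : U) : contHomOn N M (V y) := ⟨fun W => φ ⟨W.1, W.2.trans (hV y)⟩,
    fun W W' h s => hφ ⟨W.1, _⟩ ⟨W'.1, _⟩ h s, fun W hW => hc y W hW⟩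
  obtain ⟨χ, hχ⟩ := exists_glue (M := contHomObj N M) V hV hy s fun y z W h h' => rfl
  let χ' : contHomOn N M U := χ
  have hχ' (y : U) (W : Y.Opens) (hW : W ≤ V y) (a : Γ(N.mod, W)) :
      ev χ' (hW.trans (hV y)) a = φ ⟨W, hW.trans (hV y)⟩ a :=
    congr(ev (show contHomOn N M (V y) from $(hχ y)) hW a)
  have : χ'.1 = φ := by
    funext W
    refine LinearMap.ext fun a => eq_of_locally fun y hyW => ?_
    refine ⟨W.1 ⊓ V ⟨y, W.2 hyW⟩, inf_le_left, ⟨hyW, hy _⟩, ?_⟩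
    have h1 := hχ' ⟨y, W.2 hyW⟩ (W.1 ⊓ V ⟨y, W.2 hyW⟩) inf_le_right (res N.mod inf_le_left a)
    rw [ev_res χ' W.2 inf_le_left] at h1
    exact h1.trans (hφ W ⟨_, inf_le_left.trans W.2⟩ inf_le_left a)
  rw [← this]
  exact χ'.2

end Continuity

/-! ### Continuous homomorphisms on the bar resolution as cosimplicial modules on the product. -/

section BarHom

variable {S X : Scheme.{u}} (f : X ⟶ S) [IsSeparated f]

/-- The structure homomorphism of the bar resolution given by the first tensor factor. -/
def fromFirst (q : SimplexCategoryᵒᵖ) : X.sheaf ⟶ (completeBar f).obj q :=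
  ⟨{ app U := CommRingCat.ofHom (slotBar q U.unop 0)
     naturality U V i := by
      ext a
      exact (bres_slotBar q i.unop.le 0 a).symm }⟩

/-- The complete bar resolution as a topologized module. -/
def barModule (q : SimplexCategoryᵒᵖ) : TopModule X where
  mod := algebraModule (fromFirst f q)
  top V := (barIdeal f q V.1).adicTopology
  continuous_res h := continuous_adicTopology (bres h) _ _ (by
    have := barIdeal_le_comap_bres (f := f) q h 1
    rwa [pow_one, pow_one] at this)

variable {f} {p q : SimplexCategoryᵒᵖ} {M : X.Modules} {U V : X.Opens}

/-- A continuous homomorphism on the bar resolution, as a map on the sections over an open subset. -/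
def bev (φ : contHomOn (barModule f q) M U) (hV : V ≤ U) : Bar f q V →+ Γ(M, V) :=
  (φ.1 ⟨V, hV⟩).toAddMonoidHom

lemma bev_bres (φ : contHomOn (barModule f q) M U) (hV : V ≤ U) {V' : X.Opens} (h : V' ≤ V)
    (b : Bar f q V) : bev φ (h.trans hV) (bres h b) = res M h (bev φ hV b) :=
  φ.2.1 ⟨V, hV⟩ ⟨V', h.trans hV⟩ h b

lemma bev_slotBar_mul (φ : contHomOn (barModule f q) M U) (hV : V ≤ U) (a : Γ(X, V))
    (b : Bar f q V) : bev φ hV (slotBar q V 0 a * b) = a • bev φ hV b :=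
  (φ.1 ⟨V, hV⟩).map_smul a b

lemma bev_ext {φ ψ : contHomOn (barModule f q) M U}
    (h : ∀ V (hV : V ≤ U) b, bev φ hV b = bev ψ hV b) : φ = ψ :=
  contHomOn_ext h

lemma bev_add (φ ψ : contHomOn (barModule f q) M U) (hV : V ≤ U) (b : Bar f q V) :
    bev (φ + ψ) hV b = bev φ hV b + bev ψ hV b := rfl

lemma bev_zero (hV : V ≤ U) (b : Bar f q V) :
    bev (0 : contHomOn (barModule f q) M U) hV b = 0 := rfl

lemma bev_contHomRes {U' : X.Opens} (h : U' ≤ U) (φ : contHomOn (barModule f q) M U) (hV : V ≤ U')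
    (b : Bar f q V) : bev (contHomRes h φ) hV b = bev φ (hV.trans h) b := rfl

lemma exists_bev_eq_zero (φ : contHomOn (barModule f q) M U) (hV : V ≤ U) (hV' : IsAffineOpen V) :
    ∃ m : ℕ, ∀ b ∈ barIdeal f q V ^ m, bev φ hV b = 0 :=
  (continuous_adic_discrete_iff _ (bev φ hV)).mp (φ.2.2 ⟨V, hV'⟩ hV)

/-- The continuous homomorphism on the bar resolution given by a family of maps. -/
def mkBarHom (g : ∀ V : X.Opens, V ≤ U → (Bar f q V →+ Γ(M, V)))
    (hres : ∀ {V V' : X.Opens} (hV : V ≤ U) (h : V' ≤ V) (b : Bar f q V),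
      g V' (h.trans hV) (bres h b) = res M h (g V hV b))
    (hsmul : ∀ {V : X.Opens} (hV : V ≤ U) (a : Γ(X, V)) (b : Bar f q V),
      g V hV (slotBar q V 0 a * b) = a • g V hV b)
    (hcont : ∀ {V : X.Opens} (hV : V ≤ U), IsAffineOpen V →
      ∃ m : ℕ, ∀ b ∈ barIdeal f q V ^ m, g V hV b = 0) :
    contHomOn (barModule f q) M U :=
  ⟨fun V => { g V.1 V.2 with map_smul' := hsmul V.2 }, fun V _ h b => hres V.2 h b,
    fun V h => (continuous_adic_discrete_iff _ (g V.1 h)).mpr (hcont h V.2)⟩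

lemma exists_bev_barPull_eq_zero (φ : contHomOn (barModule f q) M U)
    {σ : Fin (p.unop.len + 2) → Fin (q.unop.len + 2)} (hσ : σ 0 = 0) (hV : V ≤ U)
    (hV' : IsAffineOpen V) :
    ∃ m : ℕ, ∀ b ∈ barIdeal f p V ^ m, bev φ hV (barPull hσ V b) = 0 :=
  (exists_bev_eq_zero φ hV hV').imp fun _ hm b hb =>
    hm (barPull hσ V b) (barPull_mem_pow hσ hb)

/-- Precomposition with the pull-back of sections of the bar resolution. -/
def barPrecompFun {σ : Fin (p.unop.len + 2) → Fin (q.unop.len + 2)} (hσ : σ 0 = 0)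
    (φ : contHomOn (barModule f q) M U) :
    contHomOn (barModule f p) M U :=
  mkBarHom (fun V hV => (bev φ hV).comp (barPull (f := f) hσ V).toAddMonoidHom)
    (fun {V V'} hV h b => by
      change bev φ _ (barPull hσ V' (bres h b)) = res M h (bev φ hV (barPull hσ V b))
      rw [← bres_barPull, bev_bres φ hV h])
    (fun {V} hV a b => by
      change bev φ hV (barPull hσ V (slotBar p V 0 a * b)) = a • bev φ hV (barPull hσ V b)
      rw [map_mul (barPull hσ V), barPull_slotBar, hσ, bev_slotBar_mul])
    (fun {_} hV hV' => exists_bev_barPull_eq_zero φ hσ hV hV')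

lemma bev_barPrecompFun {σ : Fin (p.unop.len + 2) → Fin (q.unop.len + 2)} (hσ : σ 0 = 0)
    (φ : contHomOn (barModule f q) M U) (hV : V ≤ U) (b : Bar f p V) :
    bev (barPrecompFun hσ φ) hV b = bev φ hV (barPull hσ V b) := rfl

/-- Precomposition with the pull-back of sections of the bar resolution. -/
def barPrecomp {σ : Fin (p.unop.len + 2) → Fin (q.unop.len + 2)} (hσ : σ 0 = 0) :
    contHomOn (barModule f q) M U →+ contHomOn (barModule f p) M U where
  toFun := barPrecompFun hσ
  map_zero' := bev_ext fun V hV b => by rw [bev_barPrecompFun, bev_zero, bev_zero]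
  map_add' φ ψ := bev_ext fun V hV b => by
    rw [bev_barPrecompFun, bev_add, bev_add, bev_barPrecompFun, bev_barPrecompFun]

lemma bev_barPrecomp {σ : Fin (p.unop.len + 2) → Fin (q.unop.len + 2)} (hσ : σ 0 = 0)
    (φ : contHomOn (barModule f q) M U) (hV : V ≤ U) (b : Bar f p V) :
    bev (barPrecomp hσ φ) hV b = bev φ hV (barPull hσ V b) := rfl

/-- Postcomposition with a homomorphism of modules. -/
def barPostcomp {M' : X.Modules} (g : M ⟶ M') :
    contHomOn (barModule f q) M U →+ contHomOn (barModule f q) M' U :=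
  ((contHomMap (𝟙 (barModule f q)) g).app U).hom

lemma bev_barPostcomp {M' : X.Modules} (g : M ⟶ M') (φ : contHomOn (barModule f q) M U)
    (hV : V ≤ U) (b : Bar f q V) : bev (barPostcomp g φ) hV b = g.app V (bev φ hV b) := rfl

lemma barPrecomp_contHomRes {σ : Fin (p.unop.len + 2) → Fin (q.unop.len + 2)} (hσ : σ 0 = 0)
    {U' : X.Opens} (h : U' ≤ U) {M' : X.Modules} (g : M ⟶ M')
    (φ : contHomOn (barModule f q) M U) :
    barPrecomp hσ (barPostcomp g (contHomRes h φ)) =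
      contHomRes h (barPrecomp hσ (barPostcomp g φ)) := by
  refine bev_ext fun V hV b => ?_
  rw [bev_barPrecomp, bev_barPostcomp, bev_contHomRes, bev_contHomRes, bev_barPrecomp,
    bev_barPostcomp]

/-- The action of the functions on `X ×_S X` on the bar resolution by the two outer factors. -/
def barAct (q : SimplexCategoryᵒᵖ) {V : (power f 2).Opens} {U : X.Opens}
    (h : U ≤ diag f 2 ⁻¹ᵁ V) : Γ(power f 2, V) →+* Bar f q U :=
  (barPull (slots_zero (fromZero q).unop) U).comp (toBar (op (SimplexCategory.mk 0)) h)

lemma bres_barAct (q : SimplexCategoryᵒᵖ) {V : (power f 2).Opens} {U U' : X.Opens}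
    (h : U ≤ diag f 2 ⁻¹ᵁ V) (h' : U' ≤ U) (s : Γ(power f 2, V)) :
    bres h' (barAct q h s) = barAct q (h'.trans h) s := by
  rw [barAct, RingHom.comp_apply, bres_barPull, bres_toBar]
  rfl

lemma barAct_ores (q : SimplexCategoryᵒᵖ) {V V' : (power f 2).Opens} {U : X.Opens}
    (h : U ≤ diag f 2 ⁻¹ᵁ V') (h' : V' ≤ V) (s : Γ(power f 2, V)) :
    barAct q h (ores h' s) = barAct q (h.trans ((diag f 2).preimage_mono h')) s :=
  congrArg (barPull _ U) (toBar_ores (op (SimplexCategory.mk 0)) h h' s)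

/-- The outer factors are given by the map to the terminal object `[0]`, so every simplicial
operator respects them. This is why the cosimplicial operators are linear over the functions on `X
×_S X`. -/
lemma barPull_barAct {p q : SimplexCategory} (θ : p ⟶ q) {V : (power f 2).Opens} {U : X.Opens}
    (h : U ≤ diag f 2 ⁻¹ᵁ V) (s : Γ(power f 2, V)) :
    barPull (p := op q) (q := op p) (slots_zero θ) U (barAct (op q) h s) = barAct (op p) h s := by
  refine barPull_barPull (slots_zero (fromZero (op q)).unop) (slots_zero θ)
    (slots_zero (fromZero (op p)).unop) ?_ _
  rw [← slots_comp]
  exact congrArg slots (SimplexCategory.isTerminalZero.hom_ext _ _)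

variable (q M) in
/-- The sections over `V` of the module on `X ×_S X` of continuous homomorphisms on the bar
resolution which are linear for the first factor. -/
def BarHomSec (V : (power f 2).Opens) : Type u := contHomOn (barModule f q) M (diag f 2 ⁻¹ᵁ V)

instance (V : (power f 2).Opens) : AddCommGroup (BarHomSec q M V) :=
  inferInstanceAs (AddCommGroup (contHomOn (barModule f q) M (diag f 2 ⁻¹ᵁ V)))

/-- Multiplication by a global section of the bar resolution. -/
def barScale {V : (power f 2).Opens} (s : Γ(power f 2, V))
    (φ : contHomOn (barModule f q) M (diag f 2 ⁻¹ᵁ V)) :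
    contHomOn (barModule f q) M (diag f 2 ⁻¹ᵁ V) :=
  mkBarHom (fun _ hU => (bev φ hU).comp (AddMonoidHom.mulLeft (barAct q hU s)))
    (fun {U U'} hU h b => by
      change bev φ _ (barAct q _ s * bres h b) = res M h (bev φ hU (barAct q hU s * b))
      rw [← bev_bres φ hU h, map_mul (bres h), bres_barAct])
    (fun {U} hU a b => by
      change bev φ hU (barAct q hU s * (slotBar q U 0 a * b)) = a • bev φ hU (barAct q hU s * b)
      rw [mul_left_comm, bev_slotBar_mul])
    (fun {U} hU hU' => by
      obtain ⟨m, hm⟩ := exists_bev_eq_zero φ hU hU'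
      exact ⟨m, fun b hb => hm _ (Ideal.mul_mem_left _ _ hb)⟩)

lemma bev_barScale {V : (power f 2).Opens} (s : Γ(power f 2, V))
    (φ : contHomOn (barModule f q) M (diag f 2 ⁻¹ᵁ V)) (hU : U ≤ diag f 2 ⁻¹ᵁ V) (b : Bar f q U) :
    bev (barScale s φ) hU b = bev φ hU (barAct q hU s * b) := rfl

/-- A function on the product acts before the homomorphism is applied, through both outer factors.
The first factor thus acts as on `M`, while the action of the last factor uses the ring structure of
the bar resolution. -/
instance (V : (power f 2).Opens) : Module Γ(power f 2, V) (BarHomSec q M V) where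
  smul s φ := barScale s φ
  one_smul φ := by
    let φ' : contHomOn (barModule f q) M (diag f 2 ⁻¹ᵁ V) := φ
    refine bev_ext fun U hU b => ?_
    change bev φ' hU (barAct q hU 1 * b) = bev φ' hU b
    rw [map_one, one_mul]
  mul_smul r s φ := by
    let φ' : contHomOn (barModule f q) M (diag f 2 ⁻¹ᵁ V) := φ
    refine bev_ext fun U hU b => ?_
    change bev φ' hU (barAct q hU (r * s) * b) = bev φ' hU (barAct q hU s * (barAct q hU r * b))
    rw [map_mul (barAct q hU), mul_comm (barAct q hU r), mul_assoc]
  smul_zero _ := rfl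
  smul_add _ _ _ := rfl
  add_smul r s φ := by
    let φ' : contHomOn (barModule f q) M (diag f 2 ⁻¹ᵁ V) := φ
    refine bev_ext fun U hU b => ?_
    change bev φ' hU (barAct q hU (r + s) * b) =
      bev φ' hU (barAct q hU r * b) + bev φ' hU (barAct q hU s * b)
    rw [map_add (barAct q hU), add_mul, map_add]
  zero_smul φ := by
    let φ' : contHomOn (barModule f q) M (diag f 2 ⁻¹ᵁ V) := φ
    refine bev_ext fun U hU b => ?_
    change bev φ' hU (barAct q hU 0 * b) = 0
    rw [map_zero, zero_mul, map_zero]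

/-- The presheaf underlying the module of continuous homomorphisms on the bar resolution. -/
def barHomPresheaf (q : SimplexCategoryᵒᵖ) (M : X.Modules) : (power f 2).Opensᵒᵖ ⥤ Ab.{u} :=
  (Opens.map (diag f 2).base).op ⋙ contHomPresheaf (barModule f q) M

lemma isSheaf_barHomPresheaf (q : SimplexCategoryᵒᵖ) (M : X.Modules) :
    TopCat.Presheaf.IsSheaf (barHomPresheaf (f := f) q M) :=
  TopCat.Sheaf.pushforward_sheaf_of_sheaf (diag f 2).base (isSheaf_contHomPresheaf _ M)

instance (V : (power f 2).Opensᵒᵖ) : Module ((power f 2).ringCatSheaf.obj.obj V)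
    ((barHomPresheaf (f := f) q M).obj V) :=
  inferInstanceAs (Module Γ(power f 2, V.unop) (BarHomSec q M V.unop))

variable (f) in
/-- The module on `X ×_S X` of continuous homomorphisms on the bar resolution which are linear
for the first factor. -/
def barHomObj (q : SimplexCategoryᵒᵖ) (M : X.Modules) : (power f 2).Modules where
  val := PresheafOfModules.ofPresheaf (barHomPresheaf q M) (fun {V V'} i r φ =>
    bev_ext fun W hW b => by
      let r' : Γ(power f 2, V.unop) := r
      let φ' : contHomOn (barModule f q) M (diag f 2 ⁻¹ᵁ V.unop) := φ
      have hW' : W ≤ diag f 2 ⁻¹ᵁ V.unop := hW.trans ((diag f 2).preimage_mono i.unop.le)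
      change bev φ' hW' (barAct q hW' r' * b) =
        bev φ' hW' (barAct q hW (ores i.unop.le r') * b)
      rw [barAct_ores])
  isSheaf := isSheaf_barHomPresheaf q M

/-- The functoriality of the module of continuous homomorphisms on the bar resolution. -/
def barHomMap {p q : SimplexCategory} {M M' : X.Modules} (θ : p ⟶ q) (g : M ⟶ M') :
    barHomObj f (op p) M ⟶ barHomObj f (op q) M' where
  val := PresheafOfModules.homMk (M₁ := (barHomObj f (op p) M).val)
    (M₂ := (barHomObj f (op q) M').val)
    { app V := AddCommGrpCat.ofHom ((barPrecomp (slots_zero θ)).comp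
        (barPostcomp (U := diag f 2 ⁻¹ᵁ V.unop) g))
      naturality V V' i := by
        refine ConcreteCategory.hom_ext _ _ fun φ => ?_
        exact barPrecomp_contHomRes (slots_zero θ) ((diag f 2).preimage_mono i.unop.le) g φ } (fun V r φ => bev_ext fun W hW b => by
        let r' : Γ(power f 2, V.unop) := r
        let φ' : contHomOn (barModule f (op p)) M (diag f 2 ⁻¹ᵁ V.unop) := φ
        change g.app W (bev φ' hW (barAct _ hW r' * barPull (slots_zero θ) W b)) =
          g.app W (bev φ' hW (barPull (slots_zero θ) W (barAct _ hW r' * b)))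
        rw [map_mul (barPull (slots_zero θ) W), barPull_barAct])

variable (f) in
/-- The cosimplicial modules of continuous homomorphisms on the bar resolution. -/
def barHom : X.Modules ⥤ CosimplicialObject (power f 2).Modules where
  obj M :=
    { obj p := barHomObj f (op p) M
      map θ := barHomMap θ (𝟙 M)
      map_id p := by
        ext V φ
        refine bev_ext fun W hW b => ?_
        let φ' : contHomOn (barModule f (op p)) M (diag f 2 ⁻¹ᵁ V) := φ
        change bev φ' hW (barPull (slots_zero _) W b) = bev φ' hW b
        rw [barPull_id _ (slots_id p)]
      map_comp {p q r} θ η := by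
        ext V φ
        refine bev_ext fun W hW b => ?_
        let φ' : contHomOn (barModule f (op p)) M (diag f 2 ⁻¹ᵁ V) := φ
        change bev φ' hW (barPull (slots_zero _) W b) =
          bev φ' hW (barPull (slots_zero θ) W (barPull (slots_zero η) W b))
        rw [barPull_barPull _ _ _ (slots_comp θ η).symm] }
  map g :=
    { app p := barHomMap (𝟙 p) g
      naturality p q θ := by
        ext V φ
        refine bev_ext fun W hW b => ?_
        let φ' : contHomOn (barModule f (op p)) _ (diag f 2 ⁻¹ᵁ V) := φ
        change g.app W (bev φ' hW (barPull (slots_zero θ) W (barPull (slots_zero (𝟙 q)) W b))) =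
          g.app W (bev φ' hW (barPull (slots_zero (𝟙 p)) W (barPull (slots_zero θ) W b)))
        rw [barPull_id _ (slots_id q), barPull_id _ (slots_id p)] }
  map_id M := by
    ext p V φ
    refine bev_ext fun W hW b => ?_
    let φ' : contHomOn (barModule f (op p)) M (diag f 2 ⁻¹ᵁ V) := φ
    change bev φ' hW (barPull (slots_zero _) W b) = bev φ' hW b
    rw [barPull_id _ (slots_id p)]
  map_comp {M M' M''} g h := by
    ext p V φ
    refine bev_ext fun W hW b => ?_
    let φ' : contHomOn (barModule f (op p)) M (diag f 2 ⁻¹ᵁ V) := φ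
    change h.app W (g.app W (bev φ' hW (barPull (slots_zero (𝟙 p)) W b))) =
      h.app W (g.app W (bev φ' hW (barPull (slots_zero (𝟙 p)) W (barPull (slots_zero (𝟙 p)) W b))))
    rw [barPull_id _ (slots_id p) (barPull _ _ _)]

end BarHom

/-! ### Division of polynomials by a variable. -/

section DivX

variable {σ R : Type*} [CommRing R]

/-- The division of polynomials by a variable. -/
def divX (i : σ) : MvPolynomial σ R →ₗ[R] MvPolynomial σ R where
  toFun p := p.divMonomial (Finsupp.single i 1)
  map_add' p p' := MvPolynomial.add_divMonomial p p' _
  map_smul' r p := by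
    ext m
    simp

lemma coeff_divX (i : σ) (p : MvPolynomial σ R) (m : σ →₀ ℕ) :
    (divX i p).coeff m = p.coeff (Finsupp.single i 1 + m) :=
  MvPolynomial.coeff_divMonomial _ _ _

/-- Division loses exactly one order of vanishing; hence the exponents `k + 1` in the approximations
below. -/
lemma divX_mem {i : σ} {p : MvPolynomial σ R} {k : ℕ}
    (hp : p ∈ MvPolynomial.idealOfVars σ R ^ (k + 1)) :
    divX i p ∈ MvPolynomial.idealOfVars σ R ^ k := by
  rw [MvPolynomial.mem_pow_idealOfVars_iff'] at hp ⊢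
  intro m hm
  rw [coeff_divX]
  apply hp
  rw [map_add, Finsupp.degree_single]
  omega

lemma divX_X_mul_self (i : σ) (p : MvPolynomial σ R) : divX i (MvPolynomial.X i * p) = p :=
  MvPolynomial.divMonomial_monomial_mul _ _

/-- Linearity over the other variables. It lets the quotient of a homomorphism inherit annihilation
by those variables. -/
lemma divX_X_mul_of_ne {i j : σ} (h : j ≠ i) (p : MvPolynomial σ R) :
    divX i (MvPolynomial.X j * p) = MvPolynomial.X j * divX i p := by
  classical
  ext m
  rw [coeff_divX, MvPolynomial.coeff_X_mul', MvPolynomial.coeff_X_mul', coeff_divX]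
  have h1 : (Finsupp.single i 1 + m : σ →₀ ℕ) j = m j := by
    rw [Finsupp.add_apply, Finsupp.single_eq_of_ne h, zero_add]
  simp only [Finsupp.mem_support_iff, h1]
  by_cases hj : m j = 0
  · rw [if_neg (not_not.mpr hj), if_neg (not_not.mpr hj)]
  · rw [if_pos hj, if_pos hj]
    congr 1
    ext l
    simp only [Finsupp.tsub_apply, Finsupp.add_apply]
    by_cases hl : l = j
    · subst hl
      rw [Finsupp.single_eq_of_ne h]
      simp
    · rw [Finsupp.single_eq_of_ne (a := j) hl]
      simp

lemma map_divX {R' : Type*} [CommRing R'] (g : R →+* R') (i : σ) (p : MvPolynomial σ R) :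
    (divX i p).map g = divX i (p.map g) := by
  ext m
  rw [MvPolynomial.coeff_map, coeff_divX, coeff_divX, MvPolynomial.coeff_map]

end DivX

/-! ### Division of continuous homomorphisms by coordinate differences. -/

section BarDivision

variable {S X : Scheme.{u}} {f : X ⟶ S} [IsSeparated f] {q : SimplexCategoryᵒᵖ} {M : X.Modules}
  {U V : X.Opens} {d : ℕ}

/-- Polynomials in the coordinate differences as sections of the bar resolution. -/
def barPoly (q : SimplexCategoryᵒᵖ) (x : Fin d → Γ(X, V)) {W : X.Opens} (h : W ≤ V) :
    MvPolynomial (Fin (q.unop.len + 1) × Fin d) Γ(X, W) →+* Bar f q W :=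
  polyHom (fun i => ores h (x i)) (slotBar q W)

lemma bres_barPoly (x : Fin d → Γ(X, V)) {W W' : X.Opens} (h : W ≤ V) (h' : W' ≤ W)
    (p : MvPolynomial (Fin (q.unop.len + 1) × Fin d) Γ(X, W)) :
    bres h' (barPoly (f := f) q x h p) = barPoly q x (h'.trans h) (p.map (ores h')) := by
  rw [barPoly, bres_polyHom]
  simp only [ores_ores]
  rfl

lemma barPoly_C (x : Fin d → Γ(X, V)) {W : X.Opens} (h : W ≤ V) (a : Γ(X, W)) :
    barPoly (f := f) q x h (MvPolynomial.C a) = slotBar q W 0 a :=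
  polyHom_C _ _ _

lemma bev_barPoly_C_mul (φ : contHomOn (barModule f q) M U) {W : X.Opens} (hW : W ≤ U)
    (x : Fin d → Γ(X, V)) (h : W ≤ V) (a : Γ(X, W)) (b : Bar f q W) :
    bev φ hW (barPoly q x h (MvPolynomial.C a) * b) = a • bev φ hW b := by
  rw [barPoly, polyHom_C, bev_slotBar_mul]

lemma bev_barPoly_smul (φ : contHomOn (barModule f q) M U) {W : X.Opens} (hW : W ≤ U)
    (x : Fin d → Γ(X, V)) (h : W ≤ V) (a : Γ(X, W))
    (p : MvPolynomial (Fin (q.unop.len + 1) × Fin d) Γ(X, W)) :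
    bev φ hW (barPoly q x h (a • p)) = a • bev φ hW (barPoly q x h p) := by
  rw [MvPolynomial.smul_eq_C_mul, map_mul (barPoly q x h), bev_barPoly_C_mul]

section Relation

variable (φ : contHomOn (barModule f q) M U) (x : Fin d → Γ(X, V)) (hUV : U ≤ V)
  (i : Fin (q.unop.len + 1) × Fin d)

/-- The graph of the quotient of a continuous homomorphism by a coordinate difference. -/
def IsBarQuot {W : X.Opens} (hW : W ≤ U) (n : Bar f q W) (m : Γ(M, W)) : Prop :=
  -- The quotient sends `n` to the value of `φ` on the quotient by `X i` of a polynomial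
  -- approximating `n`. If `φ` kills order `k`, the approximation must hold to order `k + 1`. Such
  -- `k` and `p` are available only on affine open subsets, over all of which the condition is
  -- imposed.
  ∀ (W' : X.Opens) (h : W' ≤ W), IsAffineOpen W' → ∀ (k : ℕ)
    (p : MvPolynomial (Fin (q.unop.len + 1) × Fin d) Γ(X, W')),
    (∀ b ∈ barIdeal f q W' ^ k, bev φ (h.trans hW) b = 0) →
    bres h n - barPoly q x (h.trans (hW.trans hUV)) p ∈ barIdeal f q W' ^ (k + 1) →
    res M h m = bev φ (h.trans hW) (barPoly q x (h.trans (hW.trans hUV)) (divX i p))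

variable {φ x hUV i}

lemma IsBarQuot.res {W W' : X.Opens} {hW : W ≤ U} {n : Bar f q W} {m : Γ(M, W)}
    (hnm : IsBarQuot φ x hUV i hW n m) (h : W' ≤ W) :
    IsBarQuot φ x hUV i (h.trans hW) (bres h n) (ContHochschild.res M h m) := by
  intro W'' h' hW'' k p hk hp
  rw [res_res]
  rw [bres_bres] at hp
  exact hnm W'' (h'.trans h) hW'' k p hk hp

end Relation

variable [IsAffine S]

lemma IsChart.exists_sub_barPoly_mem {x : Fin d → Γ(X, V)} (hx : IsChart f V x) {W : X.Opens}
    (h : W ≤ V) (hW : IsAffineOpen W) (b : Bar f q W) (m : ℕ) :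
    ∃ p, b - barPoly q x h p ∈ barIdeal f q W ^ m :=
  (hx.res hW h).exists_sub_polyHom_mem q b m

lemma IsChart.barPoly_mem_iff {x : Fin d → Γ(X, V)} (hx : IsChart f V x) {W : X.Opens}
    (h : W ≤ V) (hW : IsAffineOpen W) (m : ℕ)
    (p : MvPolynomial (Fin (q.unop.len + 1) × Fin d) Γ(X, W)) :
    barPoly (f := f) q x h p ∈ barIdeal f q W ^ m ↔ p ∈ MvPolynomial.idealOfVars _ _ ^ m :=
  (hx.res hW h).polyHom_mem_iff q m p

/-- If a continuous homomorphism vanishes on an ideal of sections, then it vanishes on the ideal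
generated by the restrictions of these sections. -/
lemma IsChart.bev_mul_bres_eq_zero {x : Fin d → Γ(X, V)} (hx : IsChart f V x)
    (φ : contHomOn (barModule f q) M U) (hV : V ≤ U) (𝔞 : Ideal (Bar f q V))
    (h𝔞 : ∀ a ∈ 𝔞, bev φ hV a = 0) {W : X.Opens} (h : W ≤ V) (hW : IsAffineOpen W)
    (b : Bar f q W) {a : Bar f q V} (ha : a ∈ 𝔞) : bev φ (h.trans hV) (b * bres h a) = 0 := by
  obtain ⟨k, hk⟩ := exists_bev_eq_zero φ (h.trans hV) hW
  obtain ⟨p, hp⟩ := hx.exists_sub_barPoly_mem h hW b k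
  have h1 := hk _ (Ideal.mul_mem_right (bres h a) _ hp)
  rw [sub_mul, map_sub, sub_eq_zero] at h1
  rw [h1]
  clear h1 hp
  -- After approximation, `b` is a polynomial. Its coefficients live only on `W`, but they pass
  -- through `φ` by linearity; its variables are restrictions from `V` and can be absorbed into `a`.
  induction p using MvPolynomial.induction_on generalizing a with
  | C r => rw [bev_barPoly_C_mul, bev_bres φ hV h, h𝔞 a ha, map_zero, smul_zero]
  | add p p' hp hp' => rw [map_add (barPoly q x h), add_mul, map_add, hp ha, hp' ha, add_zero]
  | mul_X p i hp =>
    have h2 := hp (Ideal.mul_mem_left 𝔞 (barPoly q x le_rfl (MvPolynomial.X i)) ha)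
    rw [map_mul (bres h), bres_barPoly, MvPolynomial.map_X, ← mul_assoc,
      ← map_mul (barPoly q x h)] at h2
    exact h2

section Relation

variable {φ : contHomOn (barModule f q) M U} {x : Fin d → Γ(X, V)} {hUV : U ≤ V}
  {i : Fin (q.unop.len + 1) × Fin d}

/-- Two approximations of the same section differ by a polynomial of order at least `k + 1`. Its
quotient by a variable has order at least `k`, where `φ` vanishes. -/
lemma IsChart.bev_barPoly_divX_eq (hx : IsChart f V x) {W : X.Opens} (hWU : W ≤ U)
    (hW : IsAffineOpen W) {k k' : ℕ} (hk : ∀ b ∈ barIdeal f q W ^ k, bev φ hWU b = 0)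
    {b b' : Bar f q W} {p p' : MvPolynomial (Fin (q.unop.len + 1) × Fin d) Γ(X, W)}
    (hp : b - barPoly q x (hWU.trans hUV) p ∈ barIdeal f q W ^ (k + 1))
    (hp' : b' - barPoly q x (hWU.trans hUV) p' ∈ barIdeal f q W ^ (k' + 1)) (hkk : k ≤ k')
    (hb : b = b') :
    bev φ hWU (barPoly q x (hWU.trans hUV) (divX i p)) =
      bev φ hWU (barPoly q x (hWU.trans hUV) (divX i p')) := by
  subst hb
  have h1 := Ideal.sub_mem _ (Ideal.pow_le_pow_right (Nat.succ_le_succ hkk) hp') hp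
  rw [sub_sub_sub_cancel_left, ← map_sub (barPoly q x (hWU.trans hUV)),
    hx.barPoly_mem_iff _ hW] at h1
  have h2 := hk _ ((hx.barPoly_mem_iff (hWU.trans hUV) hW k _).mpr (divX_mem (i := i) h1))
  rwa [map_sub, map_sub (barPoly q x (hWU.trans hUV)), map_sub, sub_eq_zero] at h2

lemma IsChart.isBarQuot_of_isAffineOpen (hx : IsChart f V x) {W : X.Opens} (hWU : W ≤ U)
    (hW : IsAffineOpen W) {k : ℕ} (hk : ∀ b ∈ barIdeal f q W ^ k, bev φ hWU b = 0)
    {b : Bar f q W} {p : MvPolynomial (Fin (q.unop.len + 1) × Fin d) Γ(X, W)}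
    (hp : b - barPoly q x (hWU.trans hUV) p ∈ barIdeal f q W ^ (k + 1)) :
    IsBarQuot φ x hUV i hWU b (bev φ hWU (barPoly q x (hWU.trans hUV) (divX i p))) := by
  intro W' h hW' k' p' hk' hp'
  -- The vanishing orders `k` on `W` and `k'` on `W'` are unrelated; an approximation good enough
  -- for both mediates.
  obtain ⟨p'', hp''⟩ := hx.exists_sub_barPoly_mem (hWU.trans hUV) hW b (max k k' + 1)
  rw [hx.bev_barPoly_divX_eq (hUV := hUV) hWU hW hk hp hp'' (le_max_left _ _) rfl, ← bev_bres φ hWU h,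
    bres_barPoly, map_divX]
  have h1 := bres_mem_pow h hp''
  rw [map_sub (bres h), bres_barPoly] at h1
  exact (hx.bev_barPoly_divX_eq (hUV := hUV) (h.trans hWU) hW' hk' hp' h1
    (le_max_right _ _) rfl).symm

lemma IsChart.exists_isBarQuot (hx : IsChart f V x) {W : X.Opens} (hWU : W ≤ U)
    (hW : IsAffineOpen W) (b : Bar f q W) : ∃ (k : ℕ)
      (p : MvPolynomial (Fin (q.unop.len + 1) × Fin d) Γ(X, W)),
      (∀ b ∈ barIdeal f q W ^ k, bev φ hWU b = 0) ∧
      b - barPoly q x (hWU.trans hUV) p ∈ barIdeal f q W ^ (k + 1) ∧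
      IsBarQuot φ x hUV i hWU b (bev φ hWU (barPoly q x (hWU.trans hUV) (divX i p))) := by
  obtain ⟨k, hk⟩ := exists_bev_eq_zero φ hWU hW
  obtain ⟨p, hp⟩ := hx.exists_sub_barPoly_mem (hWU.trans hUV) hW b (k + 1)
  exact ⟨k, p, hk, hp, hx.isBarQuot_of_isAffineOpen hWU hW hk hp⟩

lemma IsChart.isBarQuot_add (hx : IsChart f V x) {W : X.Opens} {hWU : W ≤ U} {n n' : Bar f q W}
    {m m' : Γ(M, W)} (h : IsBarQuot φ x hUV i hWU n m) (h' : IsBarQuot φ x hUV i hWU n' m') :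
    IsBarQuot φ x hUV i hWU (n + n') (m + m') := by
  intro W' hW' hW'' k p hk hp
  obtain ⟨p₁, hp₁⟩ := hx.exists_sub_barPoly_mem (hW'.trans (hWU.trans hUV)) hW'' (bres hW' n) (k + 1)
  have h2 : bres hW' n' - barPoly q x (hW'.trans (hWU.trans hUV)) (p - p₁) ∈
      barIdeal f q W' ^ (k + 1) := by
    have := Ideal.sub_mem _ hp hp₁
    rw [map_add (bres hW')] at this
    rw [map_sub (barPoly q x _)]
    convert this using 1
    abel
  have e : p = p₁ + (p - p₁) := by ring
  rw [map_add, h W' hW' hW'' k p₁ hk hp₁, h' W' hW' hW'' k _ hk h2, e, map_add,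
    map_add (barPoly q x _), map_add, ← e]

lemma IsChart.isBarQuot_smul (hx : IsChart f V x) {W : X.Opens} {hWU : W ≤ U} {n : Bar f q W}
    {m : Γ(M, W)} (h : IsBarQuot φ x hUV i hWU n m) (a : Γ(X, W)) :
    IsBarQuot φ x hUV i hWU (slotBar q W 0 a * n) (a • m) := by
  intro W' hW' hW'' k p hk hp
  obtain ⟨p₁, hp₁⟩ := hx.exists_sub_barPoly_mem (hW'.trans (hWU.trans hUV)) hW'' (bres hW' n) (k + 1)
  have h2 : bres hW' (slotBar q W 0 a * n) - barPoly q x (hW'.trans (hWU.trans hUV))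
      (ores hW' a • p₁) ∈ barIdeal f q W' ^ (k + 1) := by
    have := Ideal.mul_mem_left _ (slotBar q W' 0 (ores hW' a)) hp₁
    rw [mul_sub] at this
    rw [map_mul (bres hW'), bres_slotBar, MvPolynomial.smul_eq_C_mul, map_mul (barPoly q x _),
      barPoly_C]
    exact this
  rw [hx.bev_barPoly_divX_eq (hUV := hUV) (hW'.trans hWU) hW'' hk hp h2 le_rfl rfl,
    LinearMap.map_smul (divX i),
    bev_barPoly_smul, res_smul, h W' hW' hW'' k p₁ hk hp₁]

lemma IsChart.isBarQuot_zero (hx : IsChart f V x) {W : X.Opens} {hWU : W ≤ U} :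
    IsBarQuot φ x hUV i hWU 0 0 := by
  intro W' h hW' k p hk hp
  have h0 : (0 : Bar f q W') - barPoly q x (h.trans (hWU.trans hUV)) 0 ∈
      barIdeal f q W' ^ (k + 1) := by
    rw [map_zero (barPoly q x _), sub_zero]
    exact Ideal.zero_mem _
  have := hx.bev_barPoly_divX_eq (i := i) (hUV := hUV) (h.trans hWU) hW' hk hp h0 le_rfl
    (map_zero (bres h))
  rw [this, map_zero (divX i), map_zero (barPoly q x _), map_zero, map_zero]

variable (φ hUV i) in
/-- The graph of the quotient of a continuous homomorphism by a coordinate difference, as a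
submodule. -/
def IsChart.quotGraph (hx : IsChart f V x) {W : X.Opens} (hWU : W ≤ U) :
    Submodule Γ(X, W) (Γ((barModule f q).mod, W) × Γ(M, W)) where
  carrier := {n | IsBarQuot φ x hUV i hWU n.1 n.2}
  zero_mem' := hx.isBarQuot_zero (hUV := hUV) (hWU := hWU)
  add_mem' := fun ha hb => hx.isBarQuot_add (hUV := hUV) (hWU := hWU) ha hb
  smul_mem' := fun a _ hb => hx.isBarQuot_smul (hUV := hUV) (hWU := hWU) hb a

lemma IsChart.mem_quotGraph (hx : IsChart f V x) {W : X.Opens} (hWU : W ≤ U) (n : Bar f q W)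
    (m : Γ(M, W)) : (n, m) ∈ hx.quotGraph φ hUV i hWU ↔ IsBarQuot φ x hUV i hWU n m := Iff.rfl

/-- Continuous homomorphisms on the bar resolution can be divided by coordinate differences. -/
lemma IsChart.exists_divided (hx : IsChart f V x) (φ : contHomOn (barModule f q) M U)
    (hUV : U ≤ V) (i : Fin (q.unop.len + 1) × Fin d) :
    ∃ ψ : contHomOn (barModule f q) M U,
      (∀ (W : X.Opens) (hW : W ≤ U) (b : Bar f q W),
        bev ψ hW (barPoly q x (hW.trans hUV) (MvPolynomial.X i) * b) = bev φ hW b) ∧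
      ∀ l ≠ i, (∀ (W : X.Opens) (hW : W ≤ U) (b : Bar f q W),
        bev φ hW (barPoly q x (hW.trans hUV) (MvPolynomial.X l) * b) = 0) →
        ∀ (W : X.Opens) (hW : W ≤ U) (b : Bar f q W),
          bev ψ hW (barPoly q x (hW.trans hUV) (MvPolynomial.X l) * b) = 0 := by
  have haff {W : X.Opens} (y : X) (hy : y ∈ W) :
      ∃ W' : X.Opens, W' ≤ W ∧ y ∈ W' ∧ IsAffineOpen W' := by
    obtain ⟨_, ⟨W', hW', rfl⟩, hyW, hle⟩ :=
      X.isBasis_affineOpens.exists_subset_of_mem_open hy W.2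
    exact ⟨W', hle, hyW, hW'⟩
  obtain ⟨g, hg, hgr⟩ := exists_family_of_graph (N := (barModule f q).mod) (M := M) (U := U)
    (fun W hW => hx.quotGraph φ hUV i hW)
    (fun hV h n m hnm => (hx.mem_quotGraph (h.trans hV) _ _).mpr
      (((hx.mem_quotGraph hV _ _).mp hnm).res h))
    (fun {W} hW n y hy => by
      obtain ⟨W', h, hyW, hW'⟩ := haff y hy
      obtain ⟨k, p, hk, hp, hq⟩ := hx.exists_isBarQuot (φ := φ) (hUV := hUV) (i := i)
        (h.trans hW) hW' (bres h n)
      exact ⟨W', h, _, hyW, (hx.mem_quotGraph _ _ _).mpr hq⟩)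
    (fun {W} hW m hm => eq_zero_of_locally fun y hy => by
      obtain ⟨W', h, hyW, hW'⟩ := haff y hy
      obtain ⟨k, hk⟩ := exists_bev_eq_zero φ (h.trans hW) hW'
      refine ⟨W', h, hyW, ?_⟩
      have h0 : bres h (0 : Bar f q W) - barPoly q x (h.trans (hW.trans hUV)) 0 ∈
          barIdeal f q W' ^ (k + 1) := by
        rw [map_zero (barPoly q x _), map_zero (bres h), sub_zero]
        exact Ideal.zero_mem _
      have := (hx.mem_quotGraph hW _ _).mp hm W' h hW' k 0 hk h0
      rwa [map_zero (divX i), map_zero (barPoly q x _), map_zero] at this)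
  let g' (W : X.Opens) (hW : W ≤ U) : Bar f q W →+ Γ(M, W) := (g ⟨W, hW⟩).toAddMonoidHom
  -- On affine open subsets the quotient is given by the explicit formula with a polynomial
  -- approximation.
  have hg' {W : X.Opens} (hW : W ≤ U) (hW' : IsAffineOpen W) (b : Bar f q W) {k : ℕ}
      {p : MvPolynomial (Fin (q.unop.len + 1) × Fin d) Γ(X, W)}
      (hk : ∀ b ∈ barIdeal f q W ^ k, bev φ hW b = 0)
      (hp : b - barPoly q x (hW.trans hUV) p ∈ barIdeal f q W ^ (k + 1)) :
      g' W hW b = bev φ hW (barPoly q x (hW.trans hUV) (divX i p)) :=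
    hgr W hW b _ (hx.isBarQuot_of_isAffineOpen (hUV := hUV) hW hW' hk hp)
  obtain ⟨ψ, hψ⟩ : ∃ ψ : contHomOn (barModule f q) M U, ∀ W (hW : W ≤ U) b,
      bev ψ hW b = g' W hW b := by
    refine ⟨mkBarHom g' (fun {W W'} hW h b => hg ⟨W, hW⟩ ⟨W', h.trans hW⟩ h b)
      (fun {W} hW a b => (g ⟨W, hW⟩).map_smul a b) (fun {W} hW hW' => ?_), fun W hW b => rfl⟩
    -- The quotient is continuous with a loss of one order: a section of order `k + 1` is
    -- approximated by the zero polynomial.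
    obtain ⟨k, hk⟩ := exists_bev_eq_zero φ hW hW'
    refine ⟨k + 1, fun b hb => ?_⟩
    rw [hg' hW hW' b hk (p := 0) (by rwa [map_zero (barPoly q x _), sub_zero]),
      map_zero (divX i), map_zero (barPoly q x _), map_zero]
  refine ⟨ψ, fun W hW b => eq_of_locally fun y hy => ?_, fun l hl hφ W hW b =>
    eq_zero_of_locally fun y hy => ?_⟩
  · obtain ⟨W', h, hyW, hW'⟩ := haff y hy
    obtain ⟨k, hk⟩ := exists_bev_eq_zero φ (h.trans hW) hW'
    obtain ⟨p, hp⟩ := hx.exists_sub_barPoly_mem (h.trans (hW.trans hUV)) hW' (bres h b) (k + 1)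
    -- If `p` approximates `b`, then `X i * p` approximates `X i * b` to the same order, and
    -- division by `X i` gives back `p`.
    have h2 := Ideal.mul_mem_left _ (barPoly q x (h.trans (hW.trans hUV)) (MvPolynomial.X i)) hp
    rw [mul_sub, ← map_mul (barPoly q x _)] at h2
    have h3 := hk _ (Ideal.pow_le_pow_right k.le_succ hp)
    rw [map_sub, sub_eq_zero] at h3
    refine ⟨W', h, hyW, ?_⟩
    rw [← bev_bres ψ hW h, ← bev_bres φ hW h, map_mul (bres h), bres_barPoly, MvPolynomial.map_X,
      hψ, hg' _ hW' _ hk h2, divX_X_mul_self, h3]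
  · obtain ⟨W', h, hyW, hW'⟩ := haff y hy
    obtain ⟨k, hk⟩ := exists_bev_eq_zero φ (h.trans hW) hW'
    obtain ⟨p, hp⟩ := hx.exists_sub_barPoly_mem (h.trans (hW.trans hUV)) hW' (bres h b) (k + 1)
    have h2 := Ideal.mul_mem_left _ (barPoly q x (h.trans (hW.trans hUV)) (MvPolynomial.X l)) hp
    rw [mul_sub, ← map_mul (barPoly q x _)] at h2
    refine ⟨W', h, hyW, ?_⟩
    rw [← bev_bres ψ hW h, map_mul (bres h), bres_barPoly, MvPolynomial.map_X,
      hψ, hg' _ hW' _ hk h2, divX_X_mul_of_ne hl, map_mul (barPoly q x _), hφ]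

end Relation

end BarDivision

/-! ### The homomorphisms on the bar resolution belong to the adapted class. -/

section Adapted

variable {S X : Scheme.{u}} (f : X ⟶ S) [IsSeparated f]

lemma slots_fromZero_one (q : SimplexCategoryᵒᵖ) :
    slots (fromZero q).unop (1 : Fin 2) = Fin.last (q.unop.len + 1) := by
  apply Fin.ext
  change (Finset.univ.filter fun i : Fin (q.unop.len + 1) =>
    ((fromZero q).unop i : ℕ) < 1).card = q.unop.len + 1
  have : (Finset.univ.filter fun i : Fin (q.unop.len + 1) =>
      ((fromZero q).unop i : ℕ) < 1) = Finset.univ :=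
    Finset.filter_true_of_mem fun i _ => ((fromZero q).unop i).2
  rw [this, Finset.card_univ, Fintype.card_fin]

variable {f}

lemma barAct_slotHom (q : SimplexCategoryᵒᵖ) {V : X.Opens} (l : Fin 2) (a : Γ(X, V))
    {U : X.Opens} (h : U ≤ diag f 2 ⁻¹ᵁ cube f 2 V) (hUV : U ≤ V) :
    barAct q h (slotHom f V l a) = slotBar q U (slots (fromZero q).unop l) (ores hUV a) := by
  rw [barAct, RingHom.comp_apply, ← barPull_slotBar (slots_zero (fromZero q).unop)]
  refine congrArg (barPull (slots_zero (fromZero q).unop) U) ?_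
  rw [← bres_slotBar (op (SimplexCategory.mk 0)) hUV,
    ← toBar_comp_slotHom (op (SimplexCategory.mk 0)) V l a, bres_toBar]

/-- The outer slots are the first and the last one, so `1 ⊗ x_j - x_j ⊗ 1` acts as the variable
which compares the last slot with the first. -/
lemma barAct_coordDiff (q : SimplexCategoryᵒᵖ) {V : X.Opens} {d : ℕ} (x : Fin d → Γ(X, V))
    (j : Fin d) {U : X.Opens} (h : U ≤ diag f 2 ⁻¹ᵁ cube f 2 V) (hUV : U ≤ V) :
    barAct q h (coordDiff f x j) =
      barPoly q x hUV (MvPolynomial.X (Fin.last q.unop.len, j)) := by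
  rw [coordDiff, map_sub, barAct_slotHom q _ _ h hUV, barAct_slotHom q _ _ h hUV,
    slots_fromZero_one, barPoly, polyHom_X, slots_zero]
  rfl

variable (f) in
/-- The sequences of functions on `X ×_S X` which are given by the differences of coordinates. -/
def IsDiagCoord ⦃W : (power f 2).Opens⦄ ⦃n : ℕ⦄ (t : Fin n → Γ(power f 2, W)) : Prop :=
  IsCoord (diag f 2) t ∧ ∃ (V : X.Opens) (x : Fin n → Γ(X, V)) (h : W ≤ cube f 2 V),
    IsChart f V x ∧ ∀ j, t j = ores h (coordDiff f x j)

variable [IsAffine S]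

/-- The functions `t j` act as distinct variables, so `IsChart.exists_divided` provides the
quotient, even without shrinking `V'`. It needs actual coordinate differences; for this reason
`IsDiagCoord` demands more than a coordinate sequence. -/
lemma adaptedClass_barHomObj (q : SimplexCategoryᵒᵖ) (M : X.Modules) :
    adaptedClass (IsDiagCoord f) (barHomObj f q M) := by
  rintro W n t ⟨-, V, x, hWV, hx, ht⟩ V' hV' j u hu y hy
  obtain rfl : t = fun j => ores hWV (coordDiff f x j) := funext ht
  have hUV : diag f 2 ⁻¹ᵁ V' ≤ V :=
    ((diag f 2).preimage_mono (hV'.trans hWV)).trans (diag_preimage_cube f V).le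
  have key (k : Fin n) {U : X.Opens} (hU : U ≤ diag f 2 ⁻¹ᵁ V') :
      barAct q hU (ores hV' (ores hWV (coordDiff f x k))) =
        barPoly q x (hU.trans hUV) (MvPolynomial.X (Fin.last q.unop.len, k)) := by
    rw [barAct_ores, barAct_ores, barAct_coordDiff q x k _ (hU.trans hUV)]
  let φ : contHomOn (barModule f q) M (diag f 2 ⁻¹ᵁ V') := u
  obtain ⟨ψ, hψ, hψ'⟩ := hx.exists_divided φ hUV (Fin.last q.unop.len, j)
  refine ⟨V', le_rfl, ψ, hy, fun k hk => bev_ext fun U hU b => ?_, ?_⟩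
  · change bev ψ hU (barAct q hU (ores hV' (ores hWV (coordDiff f x k))) * b) = 0
    rw [key]
    refine hψ' _ (fun h => hk.ne (Prod.ext_iff.mp h).2) (fun U hU b => ?_) U hU b
    have : barScale (ores hV' (ores hWV (coordDiff f x k))) φ = 0 := hu k hk
    rw [← key k hU]
    exact congr(bev $this hU b)
  · rw [res_refl]
    refine bev_ext fun U hU b => ?_
    change bev ψ hU (barAct q hU (ores hV' (ores hWV (coordDiff f x j))) * b) = bev φ hU b
    rw [key, hψ]

lemma exists_isDiagCoord [Smooth f] (y : (power f 2 : Scheme.{u})) :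
    (∃ V : (power f 2).Opens, y ∈ V ∧ diag f 2 ⁻¹ᵁ V = ⊥) ∨
      ∃ (W : (power f 2).Opens) (n : ℕ) (t : Fin n → Γ(power f 2, W)), y ∈ W ∧
        IsDiagCoord f t := by
  by_cases hy : y ∈ Set.range (diag f 2)
  · obtain ⟨z, rfl⟩ := hy
    obtain ⟨V, d, x, hz, hx⟩ := exists_isChart f z
    obtain ⟨W, h, hVW, hW⟩ := hx.exists_isCoord
    exact Or.inr ⟨W, d, _, hVW hz, hW, V, x, h, hx, fun j => rfl⟩
  · have := isClosedImmersion_diag f 1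
    refine Or.inl ⟨⟨(Set.range (diag f 2))ᶜ, (diag f 2).isClosedEmbedding.isClosed_range.isOpen_compl⟩,
      hy, ?_⟩
    ext z
    simp

end Adapted

/-! ### Hochschild chains as a sheafified quotient of the bar resolution. -/

section ChainSections

variable {S X : Scheme.{u}} {f : X ⟶ S} {q : SimplexCategoryᵒᵖ} {U V : X.Opens}

variable (f q U) in
/-- The sections of the sheaf of complete Hochschild chains. -/
abbrev Chain : CommRingCat.{u} := (chainRing f q).obj.obj (op U)

variable (q U) in
/-- The homomorphism from the bar resolution to the Hochschild chains on sections. -/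
def barToChain : Bar f q U →+* Chain f q U := ((fromBar f q).hom.app (op U)).hom

variable (q U) in
/-- The homomorphism from the functions to the Hochschild chains on sections. -/
def baseToChain : Γ(X, U) →+* Chain f q U := ((fromBase f q).hom.app (op U)).hom

/-- The restriction of Hochschild chains. -/
def cres (h : V ≤ U) : Chain f q U →+* Chain f q V :=
  ((chainRing f q).obj.map (homOfLE h).op).hom

lemma cres_barToChain (h : V ≤ U) (b : Bar f q U) :
    cres h (barToChain q U b) = barToChain q V (bres h b) :=
  congr($((fromBar f q).hom.naturality (homOfLE h).op).hom b).symm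

lemma barToChain_mem_pow {m : ℕ} {b : Bar f q U} (hb : b ∈ barIdeal f q U ^ m) :
    barToChain q U b ∈ chainIdeal f q U ^ m := by
  rw [chainIdeal, ← Ideal.map_pow]
  exact Ideal.mem_map_of_mem _ hb

/-- This is the commutativity of the pushout square which defines the ring of chains. -/
lemma barToChain_barPull (b : Bar f (op (SimplexCategory.mk 0)) U) :
    barToChain q U (barPull (slots_zero (fromZero q).unop) U b) =
      baseToChain q U (barAug _ U b) := by
  have h1 : (completeBar f).map (fromZero q) ≫ fromBar f q =
      augmentation f _ ≫ fromBase' f q := pushout.condition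
  have h2 := congr(($(h1).hom.app (op U)).hom b)
  refine Eq.trans ?_ (h2.trans ?_)
  · rw [← completeBar_map_app]
    rfl
  · change _ = ((fromBase' f q).hom.app (op U)).hom (((𝟙 X : X ⟶ X).app U).hom (barAug _ U b))
    rw [Scheme.Hom.id_app]
    rfl

variable (f q U) in
/-- The ideal of the bar resolution which is generated by the functions of the two outer factors
which vanish on the diagonal. -/
def outerIdeal : Ideal (Bar f q U) :=
  (barIdeal f (op (SimplexCategory.mk 0)) U).map (barPull (slots_zero (fromZero q).unop) U)

lemma bres_mem_outerIdeal (h : V ≤ U) : outerIdeal f q U ≤ (outerIdeal f q V).comap (bres h) := by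
  refine Ideal.map_le_iff_le_comap.mpr fun b hb => ?_
  rw [Ideal.mem_comap, Ideal.mem_comap, bres_barPull]
  refine Ideal.mem_map_of_mem _ ?_
  rw [mem_barIdeal, barAug_bres, mem_barIdeal.mp hb, map_zero]

lemma barToChain_eq_zero {b : Bar f q U} (hb : b ∈ outerIdeal f q U) : barToChain q U b = 0 := by
  suffices outerIdeal f q U ≤ RingHom.ker (barToChain q U) from this hb
  refine Ideal.map_le_iff_le_comap.mpr fun b hb => ?_
  rw [Ideal.mem_comap, RingHom.mem_ker, barToChain_barPull, mem_barIdeal.mp hb, map_zero]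

variable (f q) in
/-- The quotient presheaf of the bar resolution whose sheafification is the sheaf of Hochschild
chains. -/
def chainPresheaf : X.Opensᵒᵖ ⥤ CommRingCat.{u} where
  obj U := .of (Bar f q U.unop ⧸ outerIdeal f q U.unop)
  map i := CommRingCat.ofHom (Ideal.quotientMap _ (bres i.unop.le) (bres_mem_outerIdeal i.unop.le))
  map_id U := by
    refine CommRingCat.hom_ext (Ideal.Quotient.ringHom_ext (RingHom.ext fun b => ?_))
    exact congrArg _ (bres_refl b)
  map_comp i j := by
    refine CommRingCat.hom_ext (Ideal.Quotient.ringHom_ext (RingHom.ext fun b => ?_))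
    exact congrArg _ (bres_bres i.unop.le j.unop.le b).symm

variable (f q) in
/-- The sheaf associated with the quotient presheaf. -/
def chainSheaf : TopCat.Sheaf CommRingCat.{u} X :=
  (presheafToSheaf (Opens.grothendieckTopology X) CommRingCat.{u}).obj (chainPresheaf f q)

/-- The homomorphism from the bar resolution to the quotient sheaf. -/
def barToSheaf (q : SimplexCategoryᵒᵖ) : (completeBar f).obj q ⟶ chainSheaf f q :=
  ⟨{ app U := CommRingCat.ofHom (Ideal.Quotient.mk (outerIdeal f q U.unop))
     naturality _ _ _ := rfl } ≫ toSheafify (Opens.grothendieckTopology X) (chainPresheaf f q)⟩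

/-- The homomorphism from the quotient sheaf to the Hochschild chains. -/
def sheafToChain (q : SimplexCategoryᵒᵖ) : chainSheaf f q ⟶ chainRing f q :=
  ⟨sheafifyLift (Opens.grothendieckTopology X)
    { app U := CommRingCat.ofHom (Ideal.Quotient.lift (outerIdeal f q U.unop)
        (barToChain q U.unop) fun _ hb => barToChain_eq_zero hb)
      naturality _ _ i := CommRingCat.hom_ext (Ideal.Quotient.ringHom_ext (RingHom.ext fun b =>
        (cres_barToChain i.unop.le b).symm)) } (chainRing f q).property⟩

lemma barToSheaf_sheafToChain : barToSheaf q ≫ sheafToChain q = fromBar f q := by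
  refine ObjectProperty.hom_ext _ ?_
  refine (Category.assoc _ _ _).trans ((congrArg (_ ≫ ·) (toSheafify_sheafifyLift _ _ _)).trans ?_)
  rfl

lemma chainRingMap_barToChain {p q : SimplexCategoryᵒᵖ} (θ : p ⟶ q) (W : X.Opens)
    (b : Bar f p W) : ((chainRingMap f θ).hom.app (op W)).hom (barToChain p W b) =
      barToChain q W (barPull (slots_zero θ.unop) W b) := by
  rw [← completeBar_map_app θ W b]
  exact congr(($(fromBar_chainRingMap f θ).hom.app (op W)).hom b)

variable [IsSeparated f]

lemma barToChain_slotBar_zero (a : Γ(X, U)) :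
    barToChain (f := f) q U (slotBar q U 0 a) = baseToChain q U a := by
  have := barToChain_barPull (f := f) (q := q) (slotBar (op (SimplexCategory.mk 0)) U 0 a)
  rwa [barPull_slotBar, slots_zero, barAug_slotBar] at this

lemma barToChain_barAct {V : (power f 2).Opens} (h : U ≤ diag f 2 ⁻¹ᵁ V) (s : Γ(power f 2, V)) :
    barToChain q U (barAct q h s) = baseToChain q U (((diag f 2).appLE V U h).hom s) := by
  rw [barAct, RingHom.comp_apply, barToChain_barPull, barAug_toBar]

/-- Modulo the outer ideal, `B̂_0` acts through its augmentation followed by the first factor. Hence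
the quotient sheaf receives a map from the pushout. -/
lemma barPull_sub_slotBar_mem (b : Bar f (op (SimplexCategory.mk 0)) U) :
    barPull (slots_zero (fromZero q).unop) U b - slotBar q U 0 (barAug _ U b) ∈
      outerIdeal f q U := by
  have : slotBar (f := f) q U 0 (barAug _ U b) = barPull (slots_zero (fromZero q).unop) U
      (slotBar (op (SimplexCategory.mk 0)) U 0 (barAug _ U b)) := by
    rw [barPull_slotBar, slots_zero]
  rw [this, ← map_sub (barPull (slots_zero (fromZero q).unop) U)]
  refine Ideal.mem_map_of_mem _ ?_
  rw [mem_barIdeal, map_sub (barAug _ U), barAug_slotBar, sub_self]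

/-- The homomorphism from the functions to the bar resolution given by the first factor. -/
def pushToBar (q : SimplexCategoryᵒᵖ) :
    (pushStruct X).obj (op (Over.mk (𝟙 X))) ⟶ (completeBar f).obj q :=
  ⟨{ app U := CommRingCat.ofHom (slotBar q U.unop 0)
     naturality U V i := by
      ext a
      exact (bres_slotBar q i.unop.le 0 a).symm }⟩

lemma pushToBar_fromBar : pushToBar q ≫ fromBar f q = fromBase' f q := by
  refine ObjectProperty.hom_ext _ (NatTrans.ext (funext fun U => CommRingCat.hom_ext
    (RingHom.ext fun a => ?_)))
  refine (barToChain_slotBar_zero (U := U.unop) a).trans ?_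
  change ((fromBase' f q).hom.app U).hom (((𝟙 X : X ⟶ X).app U.unop).hom a) = _
  rw [Scheme.Hom.id_app]
  rfl

lemma map_barToSheaf : (completeBar f).map (fromZero q) ≫ barToSheaf q =
    augmentation f _ ≫ pushToBar q ≫ barToSheaf q := by
  refine ObjectProperty.hom_ext _ (NatTrans.ext (funext fun U => CommRingCat.hom_ext
    (RingHom.ext fun b => ?_)))
  refine congrArg ((toSheafify (Opens.grothendieckTopology X) (chainPresheaf f q)).app U).hom ?_
  refine (Ideal.Quotient.eq (I := outerIdeal f q U.unop)).mpr ?_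
  have h1 := completeBar_map_app (fromZero q) U.unop b
  exact (congrArg (fun c => c - slotBar q U.unop 0 (barAug _ U.unop b) ∈ outerIdeal f q U.unop)
    h1).mpr (barPull_sub_slotBar_mem b)

/-- The homomorphism from the Hochschild chains to the quotient sheaf. -/
def chainToSheaf (q : SimplexCategoryᵒᵖ) : chainRing f q ⟶ chainSheaf f q :=
  pushout.desc (barToSheaf q) (pushToBar q ≫ barToSheaf q) map_barToSheaf

lemma fromBar_chainToSheaf : fromBar f q ≫ chainToSheaf q = barToSheaf q := pushout.inl_desc _ _ _

/-- The chains are a retract of the sheafified quotient. This suffices to see that chains come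
locally from the bar resolution. -/
lemma chainToSheaf_sheafToChain : chainToSheaf q ≫ sheafToChain q = 𝟙 (chainRing f q) := by
  refine chainRing_hom_ext ?_ ?_
  · rw [← Category.assoc, fromBar_chainToSheaf, barToSheaf_sheafToChain, Category.comp_id]
  · have h : fromBase' f q ≫ chainToSheaf q = pushToBar q ≫ barToSheaf q := pushout.inr_desc _ _ _
    rw [← Category.assoc, h, Category.assoc, barToSheaf_sheafToChain, pushToBar_fromBar,
      Category.comp_id]

lemma exists_barToChain_eq (c : Chain f q U) (y : X) (hy : y ∈ U) :
    ∃ (V : X.Opens) (h : V ≤ U) (b : Bar f q V), y ∈ V ∧ barToChain q V b = cres h c := by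
  have := Presheaf.isLocallySurjective_toSheafify' (Opens.grothendieckTopology X) (chainPresheaf f q)
  obtain ⟨V, i, ⟨b, hb⟩, hyV⟩ := Presheaf.imageSieve_mem (Opens.grothendieckTopology X)
    (toSheafify (Opens.grothendieckTopology X) (chainPresheaf f q))
    (((chainToSheaf q).hom.app (op U)).hom c) y hy
  obtain ⟨b, rfl⟩ := Ideal.Quotient.mk_surjective b
  refine ⟨V, i.le, b, hyV, ?_⟩
  have h1 := congr(($(barToSheaf_sheafToChain (f := f) (q := q)).hom.app (op V)).hom b)
  have h2 := congr($((sheafToChain (f := f) q).hom.naturality i.op).hom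
    (((chainToSheaf q).hom.app (op U)).hom c))
  have h3 := congr(($(chainToSheaf_sheafToChain (f := f) (q := q)).hom.app (op U)).hom c)
  refine h1.symm.trans ((congrArg ((sheafToChain q).hom.app (op V)).hom hb).trans (h2.trans ?_))
  exact congrArg (cres i.le) h3

/-- If `b` dies in the chains, then it dies in the sheafification of the quotient by the outer
ideal, hence locally in the quotient itself. -/
lemma exists_bres_mem_outerIdeal {b : Bar f q U} (hb : barToChain q U b = 0) (y : X) (hy : y ∈ U) :
    ∃ (V : X.Opens) (h : V ≤ U), y ∈ V ∧ bres h b ∈ outerIdeal f q V := by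
  have := Presheaf.isLocallyInjective_toSheafify' (Opens.grothendieckTopology X) (chainPresheaf f q)
  obtain ⟨V, i, hi, hyV⟩ := Presheaf.equalizerSieve_mem (Opens.grothendieckTopology X)
    (toSheafify (Opens.grothendieckTopology X) (chainPresheaf f q))
    (Ideal.Quotient.mk (outerIdeal f q U) b) 0 (by
      refine Eq.trans ?_ (map_zero ((toSheafify (Opens.grothendieckTopology X)
        (chainPresheaf f q)).app (op U)).hom).symm
      have h1 := congr(($(fromBar_chainToSheaf (f := f) (q := q)).hom.app (op U)).hom b)
      refine h1.symm.trans ((congrArg ((chainToSheaf q).hom.app (op U)).hom hb).trans ?_)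
      exact map_zero ((chainToSheaf q).hom.app (op U)).hom) y hy
  refine ⟨V, i.le, hyV, Ideal.Quotient.eq_zero_iff_mem.mp ?_⟩
  exact (show (chainPresheaf f q).map i.op _ = (chainPresheaf f q).map i.op 0 from hi).trans
    (map_zero ((chainPresheaf f q).map i.op).hom)

end ChainSections

/-! ### Descent of homomorphisms from the bar resolution to the chains. -/

section Descent

variable {S X : Scheme.{u}} {f : X ⟶ S} {q : SimplexCategoryᵒᵖ} {M : X.Modules} {U V : X.Opens}

/-- A continuous Hochschild cochain, as a map on the sections over an open subset. -/
def cev (φ : contHomOn (chainModule f q) M U) (hV : V ≤ U) : Chain f q V →+ Γ(M, V) :=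
  (φ.1 ⟨V, hV⟩).toAddMonoidHom

lemma cev_cres (φ : contHomOn (chainModule f q) M U) (hV : V ≤ U) {V' : X.Opens} (h : V' ≤ V)
    (c : Chain f q V) : cev φ (h.trans hV) (cres h c) = res M h (cev φ hV c) :=
  φ.2.1 ⟨V, hV⟩ ⟨V', h.trans hV⟩ h c

lemma cev_baseToChain_mul (φ : contHomOn (chainModule f q) M U) (hV : V ≤ U) (a : Γ(X, V))
    (c : Chain f q V) : cev φ hV (baseToChain q V a * c) = a • cev φ hV c :=
  (φ.1 ⟨V, hV⟩).map_smul a c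

lemma cev_ext {φ ψ : contHomOn (chainModule f q) M U}
    (h : ∀ V (hV : V ≤ U) c, cev φ hV c = cev ψ hV c) : φ = ψ :=
  contHomOn_ext h

lemma exists_cev_eq_zero (φ : contHomOn (chainModule f q) M U) (hV : V ≤ U)
    (hV' : IsAffineOpen V) : ∃ m : ℕ, ∀ c ∈ chainIdeal f q V ^ m, cev φ hV c = 0 :=
  (continuous_adic_discrete_iff _ (cev φ hV)).mp (φ.2.2 ⟨V, hV'⟩ hV)

variable [IsSeparated f]

/-- The continuous homomorphism on the bar resolution given by a continuous Hochschild cochain. -/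
def cochainToBar (φ : contHomOn (chainModule f q) M U) : contHomOn (barModule f q) M U :=
  mkBarHom (fun V hV => (cev φ hV).comp (barToChain q V).toAddMonoidHom)
    (fun {V V'} hV h b => by
      change cev φ _ (barToChain q V' (bres h b)) = res M h (cev φ hV (barToChain q V b))
      rw [← cres_barToChain, cev_cres φ hV h])
    (fun {V} hV a b => by
      change cev φ hV (barToChain q V (slotBar q V 0 a * b)) = a • cev φ hV (barToChain q V b)
      rw [map_mul (barToChain q V), barToChain_slotBar_zero, cev_baseToChain_mul])
    (fun {V} hV hV' => by
      obtain ⟨m, hm⟩ := exists_cev_eq_zero φ hV hV'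
      exact ⟨m, fun b hb => hm _ (barToChain_mem_pow hb)⟩)

lemma bev_cochainToBar (φ : contHomOn (chainModule f q) M U) (hV : V ≤ U) (b : Bar f q V) :
    bev (cochainToBar φ) hV b = cev φ hV (barToChain q V b) := rfl

/-- Every chain comes locally from the bar resolution. -/
lemma cochainToBar_injective :
    Function.Injective (cochainToBar (f := f) (q := q) (M := M) (U := U)) := by
  intro φ ψ h
  refine cev_ext fun V hV c => eq_of_locally fun y hy => ?_
  obtain ⟨V', h', b, hyV, hb⟩ := exists_barToChain_eq c y hy
  refine ⟨V', h', hyV, ?_⟩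
  rw [← cev_cres φ hV h', ← cev_cres ψ hV h', ← hb, ← bev_cochainToBar, ← bev_cochainToBar, h]

variable [IsAffine S]

/-- The outer ideal is generated by sections of the completion of the product along the diagonal,
whereas the hypothesis concerns honest functions on open subsets of the product. Continuity bridges
the gap: a generator may be replaced by a polynomial in the coordinate differences. -/
lemma bev_eq_zero_of_mem_outerIdeal [Smooth f] {V : (power f 2).Opens}
    (φ : contHomOn (barModule f q) M (diag f 2 ⁻¹ᵁ V))
    (hφ : ∀ (V' : (power f 2).Opens) (h : V' ≤ V) (s : Γ(power f 2, V')),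
      (diag f 2).app V' s = 0 → ∀ (W : X.Opens) (hW : W ≤ diag f 2 ⁻¹ᵁ V') (b : Bar f q W),
        bev φ (hW.trans ((diag f 2).preimage_mono h)) (barAct q hW s * b) = 0)
    {W : X.Opens} (hW : W ≤ diag f 2 ⁻¹ᵁ V) {b : Bar f q W} (hb : b ∈ outerIdeal f q W) :
    bev φ hW b = 0 := by
  refine eq_zero_of_locally fun y hy => ?_
  obtain ⟨W', d, x, hyW, hWW, hx⟩ := exists_isChart_le f hy
  refine ⟨W', hWW, hyW, ?_⟩
  rw [← bev_bres φ hW hWW]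
  have hb' : bres hWW b ∈ outerIdeal f q W' := bres_mem_outerIdeal hWW hb
  obtain ⟨k, hk⟩ := exists_bev_eq_zero φ (hWW.trans hW) hx.1
  -- The statement is strengthened to all multiples so that it passes to the ideal generated.
  suffices ∀ c : Bar f q W', bev φ (hWW.trans hW) (c * bres hWW b) = 0 by
    simpa only [one_mul] using this 1
  refine Submodule.span_induction (p := fun b _ => ∀ c : Bar f q W',
    bev φ (hWW.trans hW) (c * b) = 0) ?_ ?_ ?_ ?_ hb'
  · rintro _ ⟨b₀, hb₀, rfl⟩ c
    -- The exponent is `k + 1` rather than `k` so that it is positive: the error then vanishes on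
    -- the diagonal, and so does the approximating polynomial.
    obtain ⟨p, hp⟩ := hx.exists_sub_polyHom_mem (op (SimplexCategory.mk 0)) b₀ (k + 1)
    let s₀ : Γ(power f 2, cube f 2 W') := polyHom x (slotHom f W') p
    let V' : (power f 2).Opens := cube f 2 W' ⊓ V
    have hs₀ : toBar (op (SimplexCategory.mk 0)) (diag_preimage_cube f W').ge s₀ =
      polyHom x (slotBar (op (SimplexCategory.mk 0)) W') p :=
        RingHom.congr_fun (toBar_comp_polyHom (op (SimplexCategory.mk 0)) x) p
    have hs₀' : ((diag f 2).appLE _ W' (diag_preimage_cube f W').ge).hom s₀ = 0 := by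
      rw [← barAug_toBar (op (SimplexCategory.mk 0)) (diag_preimage_cube f W').ge s₀, hs₀]
      have h1 := Ideal.sub_mem _ hb₀ (Ideal.pow_le_self (Nat.succ_ne_zero k) hp)
      rwa [sub_sub_cancel, mem_barIdeal] at h1
    have hW' : W' ≤ diag f 2 ⁻¹ᵁ V' :=
      le_inf (diag_preimage_cube f W').ge (hWW.trans hW)
    have hV' : diag f 2 ⁻¹ᵁ V' ≤ W' :=
      ((diag f 2).preimage_mono inf_le_left).trans (diag_preimage_cube f W').le
    have h1 : (diag f 2).app V' (ores (inf_le_left : V' ≤ _) s₀) = 0 := by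
      have h2 : (diag f 2).app V' (ores (inf_le_left : V' ≤ _) s₀) =
          ((diag f 2).appLE V' _ le_rfl).hom (ores (inf_le_left : V' ≤ _) s₀) := by
        rw [Scheme.Hom.appLE_eq_app]
      rw [h2, appLE_ores, ← ores_appLE (diag_preimage_cube f W').ge hV', hs₀', map_zero]
    have h2 := hφ V' inf_le_right _ h1 W' hW' c
    rw [barAct_ores, barAct, RingHom.comp_apply, mul_comm] at h2
    have h3 : barPull (slots_zero (fromZero q).unop) W' (b₀ - polyHom x (slotBar _ W') p) ∈
      barIdeal f q W' ^ (k + 1) := barPull_mem_pow _ hp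
    have h4 := hk _ (Ideal.mul_mem_left _ c (Ideal.pow_le_pow_right k.le_succ h3))
    rw [← hs₀, map_sub (barPull _ W'), mul_sub, map_sub, sub_eq_zero] at h4
    exact h4.trans h2
  · intro c
    rw [mul_zero, map_zero]
  · intro a a' _ _ ha ha' c
    rw [mul_add, map_add, ha, ha', add_zero]
  · intro a a' _ ha c
    rw [smul_eq_mul, ← mul_assoc]
    exact ha _

/-- Continuous homomorphisms on the bar resolution which are linear for the functions on the
diagonal descend to the Hochschild chains. -/
lemma exists_cochainToBar_eq [Smooth f] (φ : contHomOn (barModule f q) M U)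
    (hφ : ∀ (V : X.Opens) (hV : V ≤ U) (b : Bar f q V), b ∈ outerIdeal f q V → bev φ hV b = 0) :
    ∃ ψ : contHomOn (chainModule f q) M U, cochainToBar ψ = φ := by
  have hφ' (V : X.Opens) (hV : V ≤ U) (b : Bar f q V) (hb : barToChain q V b = 0) :
      bev φ hV b = 0 := by
    refine eq_zero_of_locally fun y hy => ?_
    obtain ⟨V', h', hyV, hV'⟩ := exists_bres_mem_outerIdeal hb y hy
    exact ⟨V', h', hyV, (bev_bres φ hV h' b).symm.trans (hφ V' (h'.trans hV) _ hV')⟩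
  -- The graph consists of the pairs given by a common preimage in the bar resolution; `hφ'` makes
  -- it single-valued.
  let r (V : X.Opens) (hV : V ≤ U) : Submodule Γ(X, V) (Γ((chainModule f q).mod, V) × Γ(M, V)) :=
    { carrier := {p | ∃ b : Bar f q V, barToChain q V b = p.1 ∧ bev φ hV b = p.2}
      zero_mem' := ⟨0, map_zero _, map_zero _⟩
      add_mem' := by
        rintro _ _ ⟨b, h1, h2⟩ ⟨b', h1', h2'⟩
        exact ⟨b + b', (map_add (barToChain q V) _ _).trans (congrArg₂ _ h1 h1'),
          (map_add (bev φ hV) _ _).trans (congrArg₂ _ h2 h2')⟩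
      smul_mem' := by
        rintro a _ ⟨b, h1, h2⟩
        refine ⟨slotBar q V 0 a * b, ?_, (bev_slotBar_mul φ hV a b).trans (congrArg _ h2)⟩
        rw [map_mul (barToChain q V), barToChain_slotBar_zero, h1]
        rfl }
  obtain ⟨g, hg, hgr⟩ := exists_family_of_graph (N := (chainModule f q).mod) r
    (by
      rintro V W hV h _ _ ⟨b, rfl, rfl⟩
      exact ⟨bres h b, (cres_barToChain h b).symm, bev_bres φ hV h b⟩)
    (by
      intro V hV c y hy
      obtain ⟨W, h, b, hyW, hb⟩ := exists_barToChain_eq c y hy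
      exact ⟨W, h, _, hyW, b, hb, rfl⟩)
    (by
      rintro V hV _ ⟨b, hb, rfl⟩
      exact hφ' V hV b hb)
  let g' (V : X.Opens) (hV : V ≤ U) : Chain f q V →+ Γ(M, V) := (g ⟨V, hV⟩).toAddMonoidHom
  have hg' (V : X.Opens) (hV : V ≤ U) (b : Bar f q V) :
      g' V hV (barToChain q V b) = bev φ hV b := hgr V hV _ _ ⟨b, rfl, rfl⟩
  have hg'' {V V' : X.Opens} (hV : V ≤ U) (h : V' ≤ V) (c : Chain f q V) :
      g' V' (h.trans hV) (cres h c) = res M h (g' V hV c) := hg ⟨V, hV⟩ ⟨V', h.trans hV⟩ h c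
  have hcont {V : X.Opens} (hV : V ≤ U) {d : ℕ} {x : Fin d → Γ(X, V)} (hx : IsChart f V x) :
      ∃ m : ℕ, ∀ c ∈ chainIdeal f q V ^ m, g' V hV c = 0 := by
    obtain ⟨m, hm⟩ := exists_bev_eq_zero φ hV hx.1
    refine ⟨m, fun c hc => ?_⟩
    -- A power of the chain ideal consists of combinations of images of `b` in the power of the bar
    -- ideal, with coefficients `c'` in the ring of chains. These lift to the bar resolution only on
    -- smaller open subsets, where `IsChart.bev_mul_bres_eq_zero` gives vanishing for an `m` which
    -- does not depend on the open subset.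
    rw [chainIdeal, ← Ideal.map_pow] at hc
    suffices ∀ c' : Chain f q V, g' V hV (c' * c) = 0 by simpa only [one_mul] using this 1
    refine Submodule.span_induction (p := fun c _ => ∀ c' : Chain f q V,
      g' V hV (c' * c) = 0) ?_ ?_ ?_ ?_ hc
    · rintro _ ⟨b, hb, rfl⟩ c'
      refine eq_zero_of_locally fun y hy => ?_
      obtain ⟨V', h, b', hyV, hb'⟩ := exists_barToChain_eq c' y hy
      obtain ⟨_, ⟨W, hW, rfl⟩, hyW, hle⟩ := X.isBasis_affineOpens.exists_subset_of_mem_open hyV V'.2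
      have hWV : W ≤ V := (show W ≤ V' from hle).trans h
      refine ⟨W, hWV, hyW, ?_⟩
      have h1 : cres hWV (c' * barToChain q V b) =
          barToChain q W (bres (show W ≤ V' from hle) b' * bres hWV b) := by
        rw [map_mul (cres hWV), map_mul (barToChain q W), ← cres_barToChain, ← cres_barToChain, hb']
        congr 1
        exact congr(($((chainRing f q).obj.map_comp (homOfLE h).op
          (homOfLE (show W ≤ V' from hle)).op)).hom c')
      refine (hg'' hV hWV _).symm.trans ((congrArg _ h1).trans ((hg' W _ _).trans ?_))
      exact hx.bev_mul_bres_eq_zero φ hV (barIdeal f q V ^ m) hm hWV hW _ hb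
    · intro c
      rw [mul_zero, map_zero]
    · intro a a' _ _ ha ha' c
      rw [mul_add, map_add, ha, ha', add_zero]
    · intro a a' _ ha c
      rw [smul_eq_mul, ← mul_assoc]
      exact ha _
  refine ⟨⟨g, mem_contHomOn_of_locally _ hg fun y hy => ?_⟩, bev_ext hg'⟩
  obtain ⟨V, d, x, hyV, hV, hx⟩ := exists_isChart_le f hy
  exact ⟨V, hV, hyV, fun W hW => (continuous_adic_discrete_iff _ (g' W.1 (hW.trans hV))).mpr
    (hcont _ (hx.res W.2 hW))⟩

end Descent

/-! ### Cochains as homomorphisms from the structure sheaf of the diagonal. -/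

section Comparison

variable {S X : Scheme.{u}} {f : X ⟶ S} [IsSeparated f] {q : SimplexCategoryᵒᵖ} {M : X.Modules}
  {U : X.Opens}

lemma bev_smul (a : Γ(X, U)) (φ : contHomOn (barModule f q) M U) {V : X.Opens} (hV : V ≤ U)
    (b : Bar f q V) : bev (a • φ) hV b = ores hV a • bev φ hV b := rfl

/-- The functions on `X ×_S X` act on the Hochschild cochains by their restrictions to the
diagonal. -/
lemma barScale_smul_cochainToBar {V : (power f 2).Opens} (s : Γ(power f 2, V))
    (a : Γ(X, diag f 2 ⁻¹ᵁ V)) (φ : contHomOn (chainModule f q) M (diag f 2 ⁻¹ᵁ V)) :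
    barScale s (a • cochainToBar φ) = ((diag f 2).app V s * a) • cochainToBar φ := by
  refine bev_ext fun W hW b => ?_
  rw [bev_barScale, bev_smul, bev_smul, map_mul (ores hW), bev_cochainToBar, bev_cochainToBar,
    map_mul (barToChain q W), barToChain_barAct, cev_baseToChain_mul, ← mul_smul, mul_comm]
  rfl

/-- The multiples of a Hochschild cochain, as continuous homomorphisms on the bar resolution. -/
def cochainMultiples {V : (power f 2).Opens}
    (φ : contHomOn (chainModule f q) M (diag f 2 ⁻¹ᵁ V)) :
    Γ(pushUnit (diag f 2), V) →ₗ[Γ(power f 2, V)] Γ(barHomObj f q M, V) where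
  toFun a :=
    let a' : Γ(X, diag f 2 ⁻¹ᵁ V) := a
    show contHomOn (barModule f q) M (diag f 2 ⁻¹ᵁ V) from a' • cochainToBar φ
  map_add' a b := bev_ext fun W hW c => by
    let a' : Γ(X, diag f 2 ⁻¹ᵁ V) := a
    let b' : Γ(X, diag f 2 ⁻¹ᵁ V) := b
    change ores hW (a' + b') • bev (cochainToBar φ) hW c =
      ores hW a' • bev (cochainToBar φ) hW c + ores hW b' • bev (cochainToBar φ) hW c
    rw [map_add, add_smul]
  map_smul' s a := (barScale_smul_cochainToBar s (show Γ(X, diag f 2 ⁻¹ᵁ V) from a) φ).symm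

/-- The comparison of Hochschild cochains with homomorphisms from the structure sheaf of the
diagonal to the homomorphisms on the bar resolution, on sections. -/
def comparisonFun {V : (power f 2).Opens} (φ : contHomOn (chainModule f q) M (diag f 2 ⁻¹ᵁ V)) :
    contHomOn (discrete (pushUnit (diag f 2))) (barHomObj f q M) V :=
  ⟨fun V' => cochainMultiples (contHomRes ((diag f 2).preimage_mono V'.2) φ),
    (mem_contHomOn_discrete _ _ _ _).mpr fun V' W h a =>
      bev_ext fun O hO b => by
        let a₀ : Γ(X, diag f 2 ⁻¹ᵁ V'.1) := a
        let a' : Γ(X, diag f 2 ⁻¹ᵁ W.1) := ores ((diag f 2).preimage_mono h) a₀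
        have hO' : O ≤ diag f 2 ⁻¹ᵁ W.1 := hO
        have hOV := hO'.trans ((diag f 2).preimage_mono W.2)
        change ores hO' a' • bev (cochainToBar φ) hOV b =
          ores (hO'.trans ((diag f 2).preimage_mono h)) a₀ • bev (cochainToBar φ) hOV b
        rw [ores_ores]⟩

/-- Near the diagonal functions extend by the definition of coordinate sequences; away from it there
is nothing to extend. -/
lemma exists_app_diag_eq [IsAffine S] [Smooth f] {V : (power f 2).Opens}
    (a : Γ(X, diag f 2 ⁻¹ᵁ V)) (y : (power f 2 : Scheme.{u})) (hy : y ∈ V) :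
    ∃ (V' : (power f 2).Opens) (h : V' ≤ V) (s : Γ(power f 2, V')), y ∈ V' ∧
      (diag f 2).app V' s = ores ((diag f 2).preimage_mono h) a := by
  obtain ⟨W, hyW, hW⟩ | ⟨W, n, t, hyW, ht, -⟩ := exists_isDiagCoord (f := f) y
  · have h1 : diag f 2 ⁻¹ᵁ (V ⊓ W) = ⊥ := le_bot_iff.mp
      (((diag f 2).preimage_mono inf_le_right).trans hW.le)
    refine ⟨V ⊓ W, inf_le_left, 0, ⟨hy, hyW⟩, ores_eq_of_locally fun x hx => ?_⟩
    rw [h1] at hx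
    exact hx.elim
  · obtain ⟨V', h, s, hyV, hs⟩ := ht.surj (V := V ⊓ W) inf_le_right
      (ores ((diag f 2).preimage_mono inf_le_left) a) y ⟨hy, hyW⟩
    refine ⟨V', h.trans inf_le_left, s, hyV, hs.trans ?_⟩
    rw [ores_ores]

/-- Evaluation at the section `1` recovers the cochain as a homomorphism on the bar resolution. -/
lemma comparisonFun_injective {V : (power f 2).Opens} : Function.Injective
    (comparisonFun (f := f) (q := q) (M := M) (V := V)) := by
  intro φ ψ h
  refine cochainToBar_injective ?_
  have h1 (χ : contHomOn (chainModule f q) M (diag f 2 ⁻¹ᵁ V)) :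
      dev (comparisonFun χ) le_rfl (pushOne (diag f 2) V) = cochainToBar χ :=
    one_smul Γ(X, diag f 2 ⁻¹ᵁ V) (cochainToBar χ)
  exact (h1 φ).symm.trans ((congrArg (fun χ => dev χ le_rfl (pushOne (diag f 2) V)) h).trans (h1 ψ))

/-- The image `φ` of `1` under `H` is killed by the functions vanishing on the diagonal, hence by
the outer ideal, and descends to a cochain. Its multiples agree with `H` because functions on the
diagonal extend locally to the product. -/
lemma comparisonFun_surjective [IsAffine S] [Smooth f] {V : (power f 2).Opens} :
    Function.Surjective (comparisonFun (f := f) (q := q) (M := M) (V := V)) := by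
  intro H
  let φ : contHomOn (barModule f q) M (diag f 2 ⁻¹ᵁ V) := dev H le_rfl (pushOne _ V)
  have hφ {V' : (power f 2).Opens} (h : V' ≤ V) (s : Γ(power f 2, V')) :
      barScale s (contHomRes ((diag f 2).preimage_mono h) φ) =
        dev H h ((diag f 2).app V' s) := by
    have h1 : (contHomRes ((diag f 2).preimage_mono h) φ) = dev H h (pushOne _ V') :=
      (dev_res H le_rfl h (pushOne _ V)).symm.trans (congrArg (dev H h) (res_pushOne h))
    have h2 := (dev H h).map_smul s (pushOne _ V')
    rw [smul_pushOne] at h2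
    rw [h1]
    exact h2.symm
  obtain ⟨ψ, hψ⟩ := exists_cochainToBar_eq φ fun W hW b hb =>
    bev_eq_zero_of_mem_outerIdeal φ (fun V' h s hs W hW b => by
      have h1 := hφ h s
      rw [hs] at h1
      have h2 := h1.trans (map_zero (dev H h))
      exact congr(bev $h2 hW b)) hW hb
  refine ⟨ψ, dev_ext fun V' h a => eq_of_locally fun y hy => ?_⟩
  obtain ⟨V'', h', s, hyV, hs⟩ := exists_app_diag_eq (f := f) a y hy
  refine ⟨V'', h', hyV, ?_⟩
  have h1 : res _ h' (dev H h a) = dev H (h'.trans h) ((diag f 2).app V'' s) :=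
    (dev_res H h h' a).symm.trans (congrArg (dev H (h'.trans h)) hs.symm)
  have h2 : res _ h' (dev (comparisonFun ψ) h a) =
      dev (comparisonFun ψ) (h'.trans h) ((diag f 2).app V'' s) :=
    (dev_res (comparisonFun ψ) h h' a).symm.trans
      (congrArg (dev (comparisonFun ψ) (h'.trans h)) hs.symm)
  rw [h1, h2, ← hφ, ← hψ]
  have h3 := barScale_smul_cochainToBar s 1
    (contHomRes ((diag f 2).preimage_mono (h'.trans h)) ψ)
  rw [one_smul, mul_one] at h3
  exact h3.symm

variable (f) in
/-- The comparison of Hochschild cochains with homomorphisms from the structure sheaf of the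
diagonal to the homomorphisms on the bar resolution. -/
def comparison (q : SimplexCategoryᵒᵖ) (M : X.Modules) :
    (Scheme.Modules.pushforward (diag f 2)).obj (contHomObj (chainModule f q) M) ⟶
      (sheafHom (pushUnit (diag f 2))).obj (barHomObj f q M) where
  val := PresheafOfModules.homMk
    (M₁ := ((Scheme.Modules.pushforward (diag f 2)).obj (contHomObj (chainModule f q) M)).val)
    (M₂ := ((sheafHom (pushUnit (diag f 2))).obj (barHomObj f q M)).val)
    { app V := AddCommGrpCat.ofHom
        { toFun := fun φ => comparisonFun (V := V.unop) φ
          map_zero' := dev_ext fun V' h (a : Γ(X, diag f 2 ⁻¹ᵁ V')) => bev_ext fun W hW b =>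
            smul_zero (ores hW a)
          map_add' := fun φ ψ => dev_ext fun V' h (a : Γ(X, diag f 2 ⁻¹ᵁ V')) =>
            bev_ext fun W hW b => smul_add (ores hW a)
              (cev (U := diag f 2 ⁻¹ᵁ V.unop) φ
                (hW.trans ((diag f 2).preimage_mono h)) (barToChain q W b))
              (cev (U := diag f 2 ⁻¹ᵁ V.unop) ψ
                (hW.trans ((diag f 2).preimage_mono h)) (barToChain q W b)) }
      naturality V V' i := rfl } (fun V r φ => dev_ext fun V' h (a : Γ(X, diag f 2 ⁻¹ᵁ V')) =>
        bev_ext fun W hW b => by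
          let r' : Γ(power f 2, V.unop) := r
          let φ' : contHomOn (chainModule f q) M (diag f 2 ⁻¹ᵁ V.unop) := φ
          have hW' : W ≤ diag f 2 ⁻¹ᵁ V.unop := hW.trans ((diag f 2).preimage_mono h)
          change ores hW a • (ores hW' ((diag f 2).app V.unop r') • cev φ' hW' (barToChain q W b)) =
            ores hW a • cev φ' hW' (barToChain q W (barAct q hW (ores h r') * b))
          rw [map_mul (barToChain q W), barToChain_barAct, cev_baseToChain_mul, appLE_ores]
          rfl)

instance [IsAffine S] [Smooth f] (q : SimplexCategoryᵒᵖ) (M : X.Modules) :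
    IsIso (comparison f q M) := by
  rw [Scheme.Modules.Hom.isIso_iff_isIso_app]
  intro V
  rw [ConcreteCategory.isIso_iff_bijective]
  exact ⟨comparisonFun_injective, comparisonFun_surjective⟩

/-- The simplicial structure of the complete Hochschild chains. -/
abbrev chainMap {p q : SimplexCategory} (θ : p ⟶ q) :
    chainModule f (op q) ⟶ chainModule f (op p) :=
  (completeChains f).map θ.op

lemma comparison_naturality {p q : SimplexCategory} (θ : p ⟶ q) {M M' : X.Modules} (g : M ⟶ M') :
    (Scheme.Modules.pushforward (diag f 2)).map
      (contHomMap (chainMap (f := f) θ) g) ≫ comparison f (op q) M' =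
    comparison f (op p) M ≫ (sheafHom (pushUnit (diag f 2))).map (barHomMap θ g) := by
  ext V φ
  refine dev_ext fun V' h (a : Γ(X, diag f 2 ⁻¹ᵁ V')) => bev_ext fun W hW b => ?_
  let φ' : contHomOn (chainModule f (op p)) M (diag f 2 ⁻¹ᵁ V) := φ
  have hW' : W ≤ diag f 2 ⁻¹ᵁ V := hW.trans ((diag f 2).preimage_mono h)
  change ores hW a • g.app W (cev φ' hW'
      (((chainRingMap f θ.op).hom.app (op W)).hom (barToChain (op q) W b))) =
    g.app W (ores hW a • cev φ' hW' (barToChain (op p) W (barPull (slots_zero θ) W b)))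
  rw [Scheme.Modules.Hom.app_smul]
  exact congrArg (fun c => ores hW a • g.app W (cev φ' hW' c)) (chainRingMap_barToChain θ.op W b)

end Comparison

/-! ### Identities of the extra degeneracy. -/

section Slots

lemma slots_δ {n : ℕ} (i : Fin (n + 2)) (j : Fin (n + 1 + 2)) :
    (slots (SimplexCategory.δ i) j : ℕ) = if (j : ℕ) ≤ i then (j : ℕ) else (j : ℕ) - 1 := by
  change (Finset.univ.filter fun l : Fin (n + 1) => (i.succAbove l : ℕ) < j).card = _
  have h (l : Fin (n + 1)) : (i.succAbove l : ℕ) < j ↔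
      (l : ℕ) < if (j : ℕ) ≤ i then (j : ℕ) else (j : ℕ) - 1 := by
    rw [Fin.succAbove]
    split_ifs with h1 h2 h2 <;> simp only [Fin.lt_def, Fin.val_castSucc, Fin.val_succ] at * <;>
      omega
  simp only [h]
  refine card_filter_val_lt ?_
  split_ifs <;> omega

/-- Inserting `1` in a new last slot and then multiplying the last two slots changes nothing. The
other faces commute with the insertion by the next lemma. -/
lemma slots_δ_last_comp_castSucc (n : ℕ) :
    slots (SimplexCategory.δ (Fin.last (n + 1))) ∘ (Fin.castSucc : Fin (n + 2) → Fin (n + 1 + 2)) =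
      id := by
  funext j
  apply Fin.ext
  rw [Function.comp_apply, slots_δ, Fin.val_castSucc, Fin.val_last, id_eq, if_pos (by omega)]

lemma slots_δ_castSucc_comp_castSucc {n : ℕ} (i : Fin (n + 2)) :
    slots (SimplexCategory.δ i.castSucc) ∘ (Fin.castSucc : Fin (n + 1 + 2) → Fin (n + 2 + 2)) =
      Fin.castSucc ∘ slots (SimplexCategory.δ i) := by
  funext j
  apply Fin.ext
  rw [Function.comp_apply, Function.comp_apply, slots_δ, Fin.val_castSucc, Fin.val_castSucc,
    Fin.val_castSucc, slots_δ]

/-- In lowest degree the remaining face multiplies all the old slots together, so it factors through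
the diagonal. -/
lemma slots_δ_zero_comp_castSucc (j : Fin 2) :
    slots (SimplexCategory.δ (0 : Fin 2)) (Fin.castSucc j : Fin 3) = (0 : Fin 2) := by
  apply Fin.ext
  refine (slots_δ 0 _).trans ?_
  rw [Fin.val_castSucc]
  split_ifs with h
  · exact Nat.le_zero.mp h
  · change (j : ℕ) - 1 = 0
    omega

end Slots

/-! ### The contraction and the coaugmentation of the complex of homomorphisms. -/

section Contraction

open AlgebraicTopology

variable {S X : Scheme.{u}} {f : X ⟶ S} [IsSeparated f] {p q : SimplexCategoryᵒᵖ} {M : X.Modules}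
  {U V : X.Opens}

/-- The evaluation of a morphism between the modules of homomorphisms on the bar resolution. -/
def bevApp {V : (power f 2).Opens} (φ : contHomOn (barModule f p) M (diag f 2 ⁻¹ᵁ V))
    {W : X.Opens} (hW : W ≤ diag f 2 ⁻¹ᵁ V) (b : Bar f q W) :
    (barHomObj f p M ⟶ barHomObj f q M) →+ Γ(M, W) where
  toFun g := bev (show contHomOn (barModule f q) M (diag f 2 ⁻¹ᵁ V) from g.app V φ) hW b
  map_zero' := rfl
  map_add' _ _ := rfl

lemma bev_objD (n : ℕ) {V : (power f 2).Opens}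
    (φ : contHomOn (barModule f (op (SimplexCategory.mk n))) M (diag f 2 ⁻¹ᵁ V)) {W : X.Opens}
    (hW : W ≤ diag f 2 ⁻¹ᵁ V) (b : Bar f (op (SimplexCategory.mk (n + 1))) W) :
    bevApp φ hW b (AlternatingCofaceMapComplex.objD ((barHom f).obj M) n) =
      ∑ i : Fin (n + 2), (-1 : ℤ) ^ (i : ℕ) •
        bev φ hW (barPull (p := op (SimplexCategory.mk (n + 1))) (q := op (SimplexCategory.mk n))
          (slots_zero (SimplexCategory.δ i)) W b) := by
  refine (map_sum (bevApp φ hW b) _ _).trans (Finset.sum_congr rfl fun i _ => ?_)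
  exact map_zsmul (bevApp φ hW b) _ _

/-- The insertion of `1` in the last slot gives a contraction of the complex of homomorphisms on
the bar resolution in positive degrees. -/
lemma exists_objD_eq (n : ℕ) {V : (power f 2).Opens}
    (φ : Γ(barHomObj f (op (SimplexCategory.mk (n + 1))) M, V))
    (hφ : (AlternatingCofaceMapComplex.objD ((barHom f).obj M) (n + 1)).app V φ = 0) :
    ∃ ψ : Γ(barHomObj f (op (SimplexCategory.mk n)) M, V),
      (AlternatingCofaceMapComplex.objD ((barHom f).obj M) n).app V ψ = φ := by
  let φ' : contHomOn (barModule f (op (SimplexCategory.mk (n + 1)))) M (diag f 2 ⁻¹ᵁ V) := φ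
  have h0 : (Fin.castSucc : Fin (n + 2) → Fin (n + 1 + 2)) 0 = 0 := rfl
  have h0' : (Fin.castSucc : Fin (n + 1 + 2) → Fin (n + 2 + 2)) 0 = 0 := rfl
  -- Up to sign, the primitive is `φ` composed with the insertion of `1` in the last slot.
  let ψ : contHomOn (barModule f (op (SimplexCategory.mk n))) M (diag f 2 ⁻¹ᵁ V) :=
    barPrecomp (p := op (SimplexCategory.mk n)) (q := op (SimplexCategory.mk (n + 1))) h0 φ'
  have hψ {W : X.Opens} (hW : W ≤ diag f 2 ⁻¹ᵁ V)
      (b : Bar f (op (SimplexCategory.mk (n + 1))) W) :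
      bevApp ψ hW b (AlternatingCofaceMapComplex.objD ((barHom f).obj M) n) =
        (-1 : ℤ) ^ (n + 1) • bev φ' hW b := by
    -- The cocycle condition is evaluated on `b` with `1` inserted: the last face returns `φ(b)` up
    -- to sign, and the other faces add up to the differential of `ψ` at `b`.
    have h1 := bev_objD (n + 1) φ' hW (barPull (p := op (SimplexCategory.mk (n + 1)))
      (q := op (SimplexCategory.mk (n + 2))) h0' W b)
    have h2 : bevApp φ' hW (barPull (p := op (SimplexCategory.mk (n + 1)))
      (q := op (SimplexCategory.mk (n + 2))) h0' W b)
        (AlternatingCofaceMapComplex.objD ((barHom f).obj M) (n + 1)) = 0 := congr(bev $hφ hW _)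
    rw [h2, Fin.sum_univ_castSucc, barPull_barPull h0' (slots_zero _) rfl
      (slots_δ_last_comp_castSucc (n + 1)), barPull_id rfl rfl, Fin.val_last] at h1
    have h3 : ∑ i : Fin (n + 2), (-1 : ℤ) ^ (i.castSucc : ℕ) • bev φ' hW
        (barPull (p := op (SimplexCategory.mk (n + 2))) (q := op (SimplexCategory.mk (n + 1)))
          (slots_zero (SimplexCategory.δ i.castSucc)) W (barPull (p := op (SimplexCategory.mk (n + 1)))
            (q := op (SimplexCategory.mk (n + 2))) h0' W b)) =
        bevApp ψ hW b (AlternatingCofaceMapComplex.objD ((barHom f).obj M) n) := by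
      rw [bev_objD]
      refine Finset.sum_congr rfl fun i _ => ?_
      rw [bev_barPrecomp, barPull_barPull (slots_zero (SimplexCategory.δ i)) h0
          (congrArg Fin.castSucc (slots_zero (SimplexCategory.δ i))) rfl,
        barPull_barPull h0' (slots_zero (SimplexCategory.δ i.castSucc))
          (congrArg Fin.castSucc (slots_zero (SimplexCategory.δ i)))
          (slots_δ_castSucc_comp_castSucc i)]
      rfl
    rw [h3] at h1
    rw [← add_right_cancel_iff (a := (-1 : ℤ) ^ (n + 2) • bev φ' hW b), ← h1, pow_succ _ (n + 1),
      mul_neg_one, neg_smul, add_neg_cancel]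
  -- The differential of `ψ` is `(-1) ^ (n + 1)` times `φ`, which the sign corrects.
  refine ⟨((-1 : ℤ) ^ (n + 1) • ψ :), bev_ext fun W hW b => ?_⟩
  let E : Γ(barHomObj f (op (SimplexCategory.mk (n + 1))) M, V) →+ Γ(M, W) :=
    { toFun := fun χ => bev (show contHomOn (barModule f (op (SimplexCategory.mk (n + 1)))) M
        (diag f 2 ⁻¹ᵁ V) from χ) hW b
      map_zero' := rfl
      map_add' := fun _ _ => rfl }
  have h1 := map_zsmul (E.comp ((AlternatingCofaceMapComplex.objD
    ((barHom f).obj M) n).app V).hom) ((-1 : ℤ) ^ (n + 1)) ψ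
  refine h1.trans ((congrArg _ (hψ hW b)).trans ?_)
  rw [← mul_smul, ← mul_pow, neg_one_mul, neg_neg, one_pow, one_smul]

/-- Homomorphisms on the bar resolution composed with the diagonal. -/
lemma bev_barPull_of_forall_eq_zero [IsAffine S] [Smooth f] (φ : contHomOn (barModule f q) M U)
    {σ : Fin (p.unop.len + 2) → Fin (q.unop.len + 2)} (hσ : ∀ j, σ j = 0) (hV : V ≤ U)
    (b : Bar f p V) : bev φ hV (barPull (hσ 0) V b) = barAug p V b • bev φ hV 1 := by
  refine eq_of_locally fun y hy => ?_
  obtain ⟨W, d, x, hyW, hWV, hx⟩ := exists_isChart_le f hy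
  refine ⟨W, hWV, hyW, ?_⟩
  obtain ⟨k, hk⟩ := exists_bev_eq_zero φ (hWV.trans hV) hx.1
  -- The order `k + 1` is at least `k`, so `φ` does not see the error, and it is positive, so the
  -- augmentation does not see it either.
  obtain ⟨P, hP⟩ := hx.exists_sub_polyHom_mem p (bres hWV b) (k + 1)
  -- All slots go to the first one, so every coordinate difference goes to zero and only the
  -- constant coefficient survives.
  have h1 (P : MvPolynomial (Fin (p.unop.len + 1) × Fin d) Γ(X, W)) :
      barPull (f := f) (hσ 0) W (polyHom x (slotBar p W) P) =
        slotBar q W 0 (MvPolynomial.constantCoeff P) := by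
    refine RingHom.congr_fun (f := (barPull (f := f) (hσ 0) W).comp (polyHom x (slotBar p W)))
      (g := (slotBar q W 0).comp MvPolynomial.constantCoeff) ?_ P
    refine MvPolynomial.ringHom_ext (fun a => ?_) fun l => ?_
    · rw [RingHom.comp_apply, RingHom.comp_apply, polyHom_C, barPull_slotBar, hσ,
        MvPolynomial.constantCoeff_C]
    · rw [RingHom.comp_apply, RingHom.comp_apply, polyHom_X, map_sub, barPull_slotBar,
        barPull_slotBar, hσ, hσ, sub_self, MvPolynomial.constantCoeff_X, map_zero]
  have h2 (P : MvPolynomial (Fin (p.unop.len + 1) × Fin d) Γ(X, W)) :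
      barAug p W (polyHom x (slotBar (f := f) p W) P) = MvPolynomial.constantCoeff P := by
    refine RingHom.congr_fun (f := (barAug p W).comp (polyHom x (slotBar (f := f) p W)))
      (g := MvPolynomial.constantCoeff) ?_ P
    refine MvPolynomial.ringHom_ext (fun a => ?_) fun l => ?_
    · rw [RingHom.comp_apply, polyHom_C, barAug_slotBar, MvPolynomial.constantCoeff_C]
    · rw [RingHom.comp_apply, polyHom_X, map_sub, barAug_slotBar, barAug_slotBar, sub_self,
        MvPolynomial.constantCoeff_X]
  have h3 := hk _ (Ideal.pow_le_pow_right k.le_succ (barPull_mem_pow (hσ 0) hP))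
  rw [map_sub (barPull (hσ 0) W), h1, map_sub, sub_eq_zero] at h3
  have h4 := Ideal.pow_le_self (Nat.succ_ne_zero k) hP
  rw [mem_barIdeal, map_sub (barAug p W), h2, sub_eq_zero, barAug_bres] at h4
  rw [res_smul, h4, ← bev_bres φ hV hWV, ← bev_bres φ hV hWV, map_one (bres hWV), bres_barPull, h3,
    ← bev_slotBar_mul, mul_one]

/-- Multiples of a section, as homomorphisms on the bar resolution. -/
def augMultiple (q : SimplexCategoryᵒᵖ) (m : Γ(M, U)) : contHomOn (barModule f q) M U :=
  mkBarHom (fun W hW =>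
      { toFun := fun b => barAug q W b • res M hW m
        map_zero' := by rw [map_zero, zero_smul]
        map_add' := fun b b' => by rw [map_add, add_smul] })
    (fun {V V'} hV h b => by
      change barAug q V' (bres h b) • res M (h.trans hV) m = res M h (barAug q V b • res M hV m)
      rw [res_smul, barAug_bres, res_res])
    (fun {V} hV a b => by
      change barAug q V (slotBar q V 0 a * b) • res M hV m = a • barAug q V b • res M hV m
      rw [map_mul, barAug_slotBar, mul_smul])
    (fun {V} hV hV' => ⟨1, fun b hb => by
      rw [pow_one, mem_barIdeal] at hb
      change barAug q V b • res M hV m = 0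
      rw [hb, zero_smul]⟩)

lemma bev_augMultiple (m : Γ(M, U)) (hV : V ≤ U) (b : Bar f q V) :
    bev (augMultiple q m) hV b = barAug q V b • res M hV m := rfl

lemma augMultiple_res (h : V ≤ U) (m : Γ(M, U)) :
    augMultiple q (res M h m) = contHomRes h (augMultiple (f := f) q m) := by
  refine bev_ext fun W hW b => ?_
  rw [bev_contHomRes, bev_augMultiple, bev_augMultiple, res_res]

lemma augMultiple_smul {V : (power f 2).Opens} (s : Γ(power f 2, V))
    (m : Γ(M, diag f 2 ⁻¹ᵁ V)) :
    augMultiple q ((diag f 2).app V s • m) = barScale s (augMultiple q m) := by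
  refine bev_ext fun W hW b => ?_
  rw [bev_barScale, bev_augMultiple, bev_augMultiple, res_smul, map_mul (barAug q W), barAct,
    RingHom.comp_apply, barAug_barPull, barAug_toBar, mul_comm, mul_smul]
  rfl

variable (f M) in
/-- The coaugmentation of the cosimplicial module of homomorphisms on the bar resolution. -/
def coaugmentation : (Scheme.Modules.pushforward (diag f 2)).obj M ⟶
    barHomObj f (op (SimplexCategory.mk 0)) M where
  val := PresheafOfModules.homMk
    (M₁ := ((Scheme.Modules.pushforward (diag f 2)).obj M).val)
    (M₂ := (barHomObj f (op (SimplexCategory.mk 0)) M).val)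
    { app V := AddCommGrpCat.ofHom
        { toFun := fun (m : Γ(M, diag f 2 ⁻¹ᵁ V.unop)) => augMultiple (f := f) _ m
          map_zero' := bev_ext fun W hW b => by
            change barAug _ W b • res M hW (0 : Γ(M, diag f 2 ⁻¹ᵁ V.unop)) = 0
            rw [map_zero, smul_zero]
          map_add' := fun m m' => bev_ext fun W hW b => by
            let m₀ : Γ(M, diag f 2 ⁻¹ᵁ V.unop) := m
            let m₁ : Γ(M, diag f 2 ⁻¹ᵁ V.unop) := m'
            change barAug _ W b • res M hW (m₀ + m₁) =
              barAug _ W b • res M hW m₀ + barAug _ W b • res M hW m₁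
            rw [map_add, smul_add] }
      naturality V V' i := by
        refine ConcreteCategory.hom_ext _ _ fun m => ?_
        exact augMultiple_res ((diag f 2).preimage_mono i.unop.le) m } (fun V r m =>
        augMultiple_smul (q := op (SimplexCategory.mk 0)) (show Γ(power f 2, V.unop) from r) m)

end Contraction

/-! ### Exactness of the coaugmented complex. -/

section Resolution

open AlgebraicTopology

variable {S X : Scheme.{u}} (f : X ⟶ S) [IsSeparated f] (M : X.Modules)

/-- Faces preserve the augmentation, so the two terms of the alternating sum cancel. -/
lemma coaugmentation_objD :
    coaugmentation f M ≫ AlternatingCofaceMapComplex.objD ((barHom f).obj M) 0 = 0 := by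
  ext V m
  refine bev_ext fun W hW b => ?_
  let m' : Γ(M, diag f 2 ⁻¹ᵁ V) := m
  refine (bev_objD 0 (augMultiple _ m') hW b).trans ?_
  rw [Fin.sum_univ_two, bev_augMultiple, bev_augMultiple, barAug_barPull, barAug_barPull,
    Fin.val_zero, Fin.val_one, pow_zero, pow_one, one_smul, neg_smul, one_smul, add_neg_cancel]
  rfl

instance : Mono (coaugmentation f M) := by
  refine mono_of_injective_app _ fun V m m' h => ?_
  have key (m : Γ(M, diag f 2 ⁻¹ᵁ V)) :
      bev (augMultiple (f := f) (op (SimplexCategory.mk 0)) m) le_rfl 1 = m := by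
    rw [bev_augMultiple, map_one, one_smul, res_refl]
  refine (key m).symm.trans (Eq.trans ?_ (key m'))
  exact congr(bev (show contHomOn (barModule f _) M (diag f 2 ⁻¹ᵁ V) from $h) le_rfl 1)

variable {M} in
lemma coaugmentation_naturality {M' : X.Modules} (g : M ⟶ M') :
    (Scheme.Modules.pushforward (diag f 2)).map g ≫ coaugmentation f M' =
      coaugmentation f M ≫ ((barHom f).map g).app (SimplexCategory.mk 0) := by
  ext V m
  refine bev_ext fun W hW b => ?_
  let m' : Γ(M, diag f 2 ⁻¹ᵁ V) := m
  have hW' : W ≤ diag f 2 ⁻¹ᵁ V := hW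
  change barAug _ W b • res M' hW' (g.app _ m') = g.app W (barAug _ W
    (barPull (slots_zero (𝟙 (SimplexCategory.mk 0))) W b) • res M hW' m')
  rw [barAug_barPull, Scheme.Modules.Hom.app_smul, app_res]

variable {f M} in
lemma bev_barPull_barPull_of_forall_eq_zero [IsAffine S] [Smooth f] {p q r : SimplexCategoryᵒᵖ}
    {U : X.Opens} (φ : contHomOn (barModule f r) M U)
    {σ : Fin (p.unop.len + 2) → Fin (q.unop.len + 2)} (hσ : σ 0 = 0)
    {τ : Fin (q.unop.len + 2) → Fin (r.unop.len + 2)} (hτ : τ 0 = 0) (h : ∀ j, τ (σ j) = 0)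
    {V : X.Opens} (hV : V ≤ U) (b : Bar f p V) :
    bev φ hV (barPull hτ V (barPull hσ V b)) = barAug p V b • bev φ hV 1 := by
  rw [barPull_barPull hσ hτ (ρ := τ ∘ σ) (h 0) rfl]
  exact bev_barPull_of_forall_eq_zero φ h hV b

-- On `b` with `1` inserted, one of the two faces returns `b` and the other one collapses `b` to the
-- diagonal. The cocycle condition equates the values of `φ` on the two, so `φ` is the augmentation
-- times `φ 1`.
variable {f M} in
lemma bev_eq_smul_of_bevApp_objD_eq_zero [IsAffine S] [Smooth f] {V : (power f 2).Opens}
    (φ : contHomOn (barModule f (op (SimplexCategory.mk 0))) M (diag f 2 ⁻¹ᵁ V))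
    (hφ : ∀ {W : X.Opens} (hW : W ≤ diag f 2 ⁻¹ᵁ V) (b : Bar f (op (SimplexCategory.mk 1)) W),
      bevApp φ hW b (AlternatingCofaceMapComplex.objD ((barHom f).obj M) 0) = 0)
    {W : X.Opens} (hW : W ≤ diag f 2 ⁻¹ᵁ V) (b : Bar f (op (SimplexCategory.mk 0)) W) :
    bev φ hW b = barAug _ W b • bev φ hW 1 := by
  have h0 : (Fin.castSucc : Fin 2 → Fin 3) 0 = 0 := rfl
  let b' : Bar f (op (SimplexCategory.mk 1)) W :=
    barPull (p := op (SimplexCategory.mk 0)) (q := op (SimplexCategory.mk 1)) h0 W b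
  have h1 := bev_objD 0 φ hW b'
  have e1 : barPull (slots_zero (SimplexCategory.δ (1 : Fin 2))) W b' = b :=
    (barPull_barPull h0 (slots_zero _) rfl (slots_δ_last_comp_castSucc 0) b).trans
      (barPull_id rfl rfl b)
  have e0 : bev φ hW (barPull (slots_zero (SimplexCategory.δ (0 : Fin 2))) W b') =
      barAug _ W b • bev φ hW 1 :=
    bev_barPull_barPull_of_forall_eq_zero φ h0 (slots_zero _) slots_δ_zero_comp_castSucc hW b
  rw [hφ, Fin.sum_univ_two, e0, e1, Fin.val_zero, Fin.val_one, pow_zero, pow_one, one_smul,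
    neg_smul, one_smul, ← sub_eq_add_neg] at h1
  exact (sub_eq_zero.mp h1.symm).symm

lemma exists_coaugmentation_eq [IsAffine S] [Smooth f] {V : (power f 2).Opens}
    (φ : Γ(barHomObj f (op (SimplexCategory.mk 0)) M, V))
    (hφ : (AlternatingCofaceMapComplex.objD ((barHom f).obj M) 0).app V φ = 0) :
    ∃ m : Γ(M, diag f 2 ⁻¹ᵁ V), (coaugmentation f M).app V m = φ := by
  let φ' : contHomOn (barModule f (op (SimplexCategory.mk 0))) M (diag f 2 ⁻¹ᵁ V) := φ
  refine ⟨bev φ' le_rfl 1, bev_ext fun W hW b => ?_⟩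
  refine Eq.trans ?_ (bev_eq_smul_of_bevApp_objD_eq_zero φ' (fun hW b =>
    congr(bev (show contHomOn (barModule f _) M (diag f 2 ⁻¹ᵁ V) from $hφ) hW b)) hW b).symm
  refine (bev_augMultiple _ hW b).trans (congrArg _ ?_)
  rw [← bev_bres, map_one (bres hW)]

lemma exact_coaugmentation [IsAffine S] [Smooth f] :
    (ShortComplex.mk _ _ (coaugmentation_objD f M)).Exact := by
  refine exact_of_locally fun V φ hφ y hy => ?_
  obtain ⟨m, hm⟩ := exists_coaugmentation_eq f M φ hφ
  exact ⟨V, le_rfl, m, hy, hm.trans (res_refl _).symm⟩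

lemma exact_objD [IsAffine S] [Smooth f] (n : ℕ) :
    (ShortComplex.mk _ _ (AlternatingCofaceMapComplex.d_squared ((barHom f).obj M) n)).Exact := by
  refine exact_of_locally fun V φ hφ y hy => ?_
  obtain ⟨m, hm⟩ := exists_objD_eq n φ hφ
  exact ⟨V, le_rfl, m, hy, hm.trans (res_refl _).symm⟩

end Resolution

/-! ### Resolutions of complexes from coaugmented cosimplicial objects. -/

section Cosimplicial

open AlgebraicTopology

variable {C : Type*} [Category* C] [Abelian C]

lemma alternatingCofaceMapComplex_d (Y : CosimplicialObject C) (n : ℕ) :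
    ((alternatingCofaceMapComplex C).obj Y).d n (n + 1) =
      AlternatingCofaceMapComplex.objD Y n :=
  CochainComplex.of_d (fun n => Y.obj (SimplexCategory.mk n)) (AlternatingCofaceMapComplex.objD Y) n

/-- The morphism to the alternating coface map complex given by a coaugmentation. -/
def fromSingleZero {A : C} {Y : CosimplicialObject C} (e : A ⟶ Y.obj (SimplexCategory.mk 0))
    (he : e ≫ AlternatingCofaceMapComplex.objD Y 0 = 0) :
    (CochainComplex.single₀ C).obj A ⟶ (alternatingCofaceMapComplex C).obj Y :=
  (CochainComplex.fromSingle₀Equiv _ _).symm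
    ⟨e, by rw [alternatingCofaceMapComplex_d]; exact he⟩

lemma fromSingleZero_f_zero {A : C} {Y : CosimplicialObject C}
    (e : A ⟶ Y.obj (SimplexCategory.mk 0)) (he : e ≫ AlternatingCofaceMapComplex.objD Y 0 = 0) :
    (fromSingleZero e he).f 0 = e :=
  CochainComplex.fromSingle₀Equiv_symm_apply_f_zero _ _

/-- In degree zero the condition is that `e` is a kernel of the first differential; in positive
degrees the source is exact and the condition is the exactness of the complex. -/
lemma quasiIso_fromSingleZero {A : C} {Y : CosimplicialObject C}
    (e : A ⟶ Y.obj (SimplexCategory.mk 0)) (he : e ≫ AlternatingCofaceMapComplex.objD Y 0 = 0)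
    [Mono e] (h0 : (ShortComplex.mk _ _ he).Exact)
    (h : ∀ n, (ShortComplex.mk _ _ (AlternatingCofaceMapComplex.d_squared Y n)).Exact) :
    QuasiIso (fromSingleZero e he) where
  quasiIsoAt n := by
    cases n with
    | zero =>
      rw [CochainComplex.quasiIsoAt₀_iff, ShortComplex.quasiIso_iff_of_zeros]
      · refine (ShortComplex.exact_and_mono_f_iff_of_iso ?_).2 ⟨h0, by assumption⟩
        exact ShortComplex.isoMk (Iso.refl _) (Iso.refl _) (Iso.refl _)
          ((Category.id_comp _).trans ((fromSingleZero_f_zero e he).symm.trans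
            (Category.comp_id _).symm))
          ((Category.id_comp _).trans ((alternatingCofaceMapComplex_d Y 0).symm.trans
            (Category.comp_id _).symm))
      all_goals rfl
    | succ n =>
      rw [quasiIsoAt_iff_exactAt]
      · rw [HomologicalComplex.exactAt_iff' _ n (n + 1) (n + 1 + 1) (by simp) (by simp)]
        refine (ShortComplex.exact_iff_of_iso ?_).2 (h n)
        exact ShortComplex.isoMk (Iso.refl _) (Iso.refl _) (Iso.refl _)
          ((Category.id_comp _).trans ((alternatingCofaceMapComplex_d Y n).symm.trans
            (Category.comp_id _).symm))
          ((Category.id_comp _).trans ((alternatingCofaceMapComplex_d Y (n + 1)).symm.trans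
            (Category.comp_id _).symm))
      · apply CochainComplex.exactAt_succ_single_obj

/-- The complex in nonnegative degrees given by a cosimplicial object. -/
abbrev cochainComplexFunctor (C : Type*) [Category* C] [Abelian C] :
    CosimplicialObject C ⥤ CochainComplex C ℤ :=
  alternatingCofaceMapComplex C ⋙ ComplexShape.embeddingUpNat.extendFunctor C

instance (Y : CosimplicialObject C) : ((cochainComplexFunctor C).obj Y).IsStrictlyGE 0 :=
  inferInstanceAs (CochainComplex.IsStrictlyGE
    (HomologicalComplex.extend ((alternatingCofaceMapComplex C).obj Y) _) 0)

/-- The complex with a single object, as an extension of a complex in nonnegative degrees. -/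
def singleIso (A : C) : (CochainComplex.singleFunctor C 0).obj A ≅
    (ComplexShape.embeddingUpNat.extendFunctor C).obj ((CochainComplex.single₀ C).obj A) :=
  (HomologicalComplex.extendSingleIso ComplexShape.embeddingUpNat _ 0 0 (by simp)).symm

lemma single_map_comp_extendSingleIso_inv {A A' : C} (a : A ⟶ A') :
    (HomologicalComplex.single C (ComplexShape.up ℤ) 0).map a ≫
      (HomologicalComplex.extendSingleIso ComplexShape.embeddingUpNat A' 0 0 (by simp)).inv =
    (HomologicalComplex.extendSingleIso ComplexShape.embeddingUpNat A 0 0 (by simp)).inv ≫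
      HomologicalComplex.extendMap ((HomologicalComplex.single C (ComplexShape.up ℕ) 0).map a)
        ComplexShape.embeddingUpNat := by
  refine HomologicalComplex.from_single_hom_ext ?_
  rw [HomologicalComplex.comp_f, HomologicalComplex.comp_f,
    HomologicalComplex.extendSingleIso_inv_f, HomologicalComplex.extendSingleIso_inv_f,
    HomologicalComplex.extendMap_f _ _ (i := 0) (by simp), HomologicalComplex.single_map_f_self,
    HomologicalComplex.single_map_f_self]
  simp only [Category.assoc, Iso.inv_hom_id_assoc]

lemma single_map_comp_singleIso_hom {A A' : C} (a : A ⟶ A') :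
    (CochainComplex.singleFunctor C 0).map a ≫ (singleIso A').hom = (singleIso A).hom ≫
      (ComplexShape.embeddingUpNat.extendFunctor C).map ((CochainComplex.single₀ C).map a) :=
  single_map_comp_extendSingleIso_inv a

/-- The morphism of complexes given by a coaugmentation. -/
def fromSingle {A : C} {Y : CosimplicialObject C} (e : A ⟶ Y.obj (SimplexCategory.mk 0))
    (he : e ≫ AlternatingCofaceMapComplex.objD Y 0 = 0) :
    (CochainComplex.singleFunctor C 0).obj A ⟶ (cochainComplexFunctor C).obj Y :=
  (singleIso A).hom ≫ (ComplexShape.embeddingUpNat.extendFunctor C).map (fromSingleZero e he)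

lemma quasiIso_fromSingle {A : C} {Y : CosimplicialObject C}
    (e : A ⟶ Y.obj (SimplexCategory.mk 0)) (he : e ≫ AlternatingCofaceMapComplex.objD Y 0 = 0)
    (hm : Mono e) (h0 : (ShortComplex.mk _ _ he).Exact)
    (h : ∀ n, (ShortComplex.mk _ _ (AlternatingCofaceMapComplex.d_squared Y n)).Exact) :
    QuasiIso (fromSingle e he) := by
  have := quasiIso_fromSingleZero e he h0 h
  have : QuasiIso ((ComplexShape.embeddingUpNat.extendFunctor C).map (fromSingleZero e he)) :=
    inferInstanceAs (QuasiIso (HomologicalComplex.extendMap (fromSingleZero e he) _))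
  exact quasiIso_comp _ _

lemma fromSingle_naturality {A A' : C} {Y Y' : CosimplicialObject C}
    (e : A ⟶ Y.obj (SimplexCategory.mk 0)) (he : e ≫ AlternatingCofaceMapComplex.objD Y 0 = 0)
    (e' : A' ⟶ Y'.obj (SimplexCategory.mk 0))
    (he' : e' ≫ AlternatingCofaceMapComplex.objD Y' 0 = 0)
    (a : A ⟶ A') (g : Y ⟶ Y') (h : a ≫ e' = e ≫ g.app _) :
    (CochainComplex.singleFunctor C 0).map a ≫ fromSingle e' he' =
      fromSingle e he ≫ (cochainComplexFunctor C).map g := by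
  have h1 : (CochainComplex.single₀ C).map a ≫ fromSingleZero e' he' =
      fromSingleZero e he ≫ (alternatingCofaceMapComplex C).map g := by
    refine HomologicalComplex.from_single_hom_ext ?_
    rw [HomologicalComplex.comp_f, HomologicalComplex.comp_f, fromSingleZero_f_zero,
      fromSingleZero_f_zero, CochainComplex.single₀_map_f_zero]
    exact h
  have h2 := congrArg (ComplexShape.embeddingUpNat.extendFunctor C).map h1
  rw [Functor.map_comp, Functor.map_comp] at h2
  refine (Category.assoc _ _ _).symm.trans
    ((congrArg (· ≫ _) (single_map_comp_singleIso_hom a)).trans ((Category.assoc _ _ _).trans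
    ((congrArg _ h2).trans (Category.assoc _ _ _).symm)))

/-- In negative degrees the complex is zero, and zero objects are injective and hence in `P`. -/
lemma of_cochainComplexFunctor {D : Type*} [Category* D] [Abelian D] {F : C ⥤ D} [F.Additive]
    {P : ObjectProperty C} (hP : IsAdapted F P) {Y : CosimplicialObject C}
    (h : ∀ n : ℕ, P (Y.obj (SimplexCategory.mk n))) (n : ℤ) :
    P (((cochainComplexFunctor C).obj Y).X n) := by
  by_cases hn : 0 ≤ n
  · obtain ⟨k, rfl⟩ := Int.eq_ofNat_of_zero_le hn
    exact hP.of_iso (HomologicalComplex.extendXIso ((alternatingCofaceMapComplex C).obj Y)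
      ComplexShape.embeddingUpNat (i := k) rfl).symm (h k)
  · have := (((cochainComplexFunctor C).obj Y).isZero_of_isStrictlyGE 0 n (by lia)).injective
    exact hP.injective _

end Cosimplicial

/-! ### Additive functors and the complexes of cosimplicial objects. -/

section MapComplex

open AlgebraicTopology

variable {C D : Type*} [Category* C] [Category* D] [Abelian C] [Abelian D] (F : C ⥤ D) [F.Additive]

section Extend

variable {ι ι' : Type*} {c : ComplexShape ι} {c' : ComplexShape ι'} (e : c.Embedding c')

/-- An additive functor commutes with extensions of complexes, in each degree. -/
def mapExtendXIso (K : HomologicalComplex C c) (i : Option ι) :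
    F.obj (HomologicalComplex.extend.X K i) ≅
      HomologicalComplex.extend.X ((F.mapHomologicalComplex c).obj K) i :=
  match i with
  | some _ => Iso.refl _
  | none => (F.map_isZero (isZero_zero C)).iso (isZero_zero D)

lemma mapExtendXIso_comp_d (K : HomologicalComplex C c) (i j : Option ι) :
    (mapExtendXIso F K i).hom ≫
        HomologicalComplex.extend.d ((F.mapHomologicalComplex c).obj K) i j =
      F.map (HomologicalComplex.extend.d K i j) ≫ (mapExtendXIso F K j).hom :=
  match i, j with
  | some _, some _ => (Category.id_comp _).trans (Category.comp_id _).symm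
  | none, _ => (F.map_isZero (isZero_zero C)).eq_of_src _ _
  | some _, none => (isZero_zero D).eq_of_tgt _ _

lemma mapExtendXIso_naturality {K L : HomologicalComplex C c} (φ : K ⟶ L) (i : Option ι) :
    F.map (HomologicalComplex.extend.mapX φ i) ≫ (mapExtendXIso F L i).hom =
      (mapExtendXIso F K i).hom ≫
        HomologicalComplex.extend.mapX ((F.mapHomologicalComplex c).map φ) i :=
  match i with
  | some _ => (Category.comp_id _).trans (Category.id_comp _).symm
  | none => (isZero_zero D).eq_of_tgt _ _

/-- An additive functor commutes with extensions of complexes. -/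
def mapExtendIso : e.extendFunctor C ⋙ F.mapHomologicalComplex c' ≅
    F.mapHomologicalComplex c ⋙ e.extendFunctor D :=
  NatIso.ofComponents
    (fun K => HomologicalComplex.Hom.isoOfComponents (fun i => mapExtendXIso F K (e.r i))
      fun i j _ => mapExtendXIso_comp_d F K (e.r i) (e.r j))
    fun φ => HomologicalComplex.hom_ext _ _ fun i => mapExtendXIso_naturality F φ (e.r i)

end Extend

lemma map_objD (Y : CosimplicialObject C) (n : ℕ) :
    F.map (AlternatingCofaceMapComplex.objD Y n) =
      AlternatingCofaceMapComplex.objD (((CosimplicialObject.whiskering C D).obj F).obj Y) n := by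
  dsimp only [AlternatingCofaceMapComplex.objD]
  rw [F.map_sum]
  refine Finset.sum_congr rfl fun i _ => F.map_zsmul

/-- An additive functor commutes with alternating coface map complexes. -/
def mapAlternatingCofaceIso :
    alternatingCofaceMapComplex C ⋙ F.mapHomologicalComplex (ComplexShape.up ℕ) ≅
      (CosimplicialObject.whiskering C D).obj F ⋙ alternatingCofaceMapComplex D :=
  NatIso.ofComponents
    (fun Y => HomologicalComplex.Hom.isoOfComponents (fun n => Iso.refl _) (by
      rintro i _ rfl
      refine (Category.id_comp _).trans (Eq.trans ?_ (Category.comp_id _).symm)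
      refine (alternatingCofaceMapComplex_d _ i).trans ?_
      exact (map_objD F Y i).symm.trans (congrArg F.map (alternatingCofaceMapComplex_d Y i).symm)))
    fun φ => HomologicalComplex.hom_ext _ _ fun i =>
      (Category.comp_id _).trans (Category.id_comp _).symm

/-- An additive functor commutes with the complexes given by cosimplicial objects. -/
def mapCochainComplexIso :
    cochainComplexFunctor C ⋙ F.mapHomologicalComplex (ComplexShape.up ℤ) ≅
      (CosimplicialObject.whiskering C D).obj F ⋙ cochainComplexFunctor D :=
  Functor.associator _ _ _ ≪≫
    Functor.isoWhiskerLeft _ (mapExtendIso F ComplexShape.embeddingUpNat) ≪≫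
    (Functor.associator _ _ _).symm ≪≫
    Functor.isoWhiskerRight (mapAlternatingCofaceIso F) _ ≪≫ Functor.associator _ _ _

end MapComplex

/-! ### The comparison as an isomorphism of cosimplicial modules. -/

section Comparison

variable {S X : Scheme.{u}} (f : X ⟶ S) [IsAffine S] [IsSeparated f] [Smooth f]

omit [IsAffine S] [IsSeparated f] [Smooth f] in
lemma chainMap_id (n : SimplexCategory) : chainMap (f := f) (𝟙 n) = 𝟙 (chainModule f (op n)) :=
  (completeChains f).map_id _

/-- The continuous Hochschild cochains in a fixed degree as a sheaf of homomorphisms on the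
product. -/
def comparisonAppIso (n : SimplexCategory) (M : X.Modules) :
    (Scheme.Modules.pushforward (diag f 2)).obj (contHomObj (chainModule f (op n)) M) ≅
      (sheafHom (pushUnit (diag f 2))).obj (barHomObj f (op n) M) :=
  asIso (comparison f (op n) M)

/-- The continuous Hochschild cochains as a sheaf of homomorphisms on the product. -/
def comparisonIso :
    cosimplicialCochains f ⋙ (CosimplicialObject.whiskering _ _).obj
        (Scheme.Modules.pushforward (diag f 2)) ≅
      barHom f ⋙ (CosimplicialObject.whiskering _ _).obj (sheafHom (pushUnit (diag f 2))) :=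
  NatIso.ofComponents
    (fun M => NatIso.ofComponents (fun n => comparisonAppIso f n M) (fun {p q} θ =>
      comparison_naturality (f := f) θ (𝟙 M)))
    fun g => NatTrans.ext (funext fun n => by
      have h := comparison_naturality (f := f) (𝟙 n) g
      rw [chainMap_id] at h
      exact h)

end Comparison

/-! ### The comparison with the derived sheaf of homomorphisms. -/

section Main

open AlgebraicTopology

variable {S X : Scheme.{u}} (f : X ⟶ S) [IsAffine S] [IsSeparated f] [Smooth f]

/-- The continuous bar resolution. -/
def barResolution :
    Scheme.Modules.pushforward (diag f 2) ⋙ CochainComplex.singleFunctor _ 0 ⟶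
      barHom f ⋙ cochainComplexFunctor _ where
  app M := fromSingle (coaugmentation f M) (coaugmentation_objD f M)
  naturality _ _ g := fromSingle_naturality _ _ _ _ _ _ (coaugmentation_naturality f g)

lemma quasiIso_fromSingle_coaugmentation (M : X.Modules) :
    QuasiIso (fromSingle (Y := (barHom f).obj M) (coaugmentation f M) (coaugmentation_objD f M)) :=
  quasiIso_fromSingle (Y := (barHom f).obj M) (coaugmentation f M) (coaugmentation_objD f M)
    (inferInstanceAs (Mono (coaugmentation f M))) (exact_coaugmentation f M)
    (exact_objD f M)

lemma quasiIso_barResolution_app (M : X.Modules) : QuasiIso ((barResolution f).app M) :=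
  quasiIso_fromSingle_coaugmentation f M

/-- The continuous Hochschild cochains as the image of the bar resolution. -/
def cochainsIso :
    cochains f ⋙ (Scheme.Modules.pushforward (diag f 2)).mapHomologicalComplex _ ≅
      (barHom f ⋙ cochainComplexFunctor _) ⋙
        (sheafHom (pushUnit (diag f 2))).mapHomologicalComplex (ComplexShape.up ℤ) :=
  Functor.associator (cosimplicialCochains f) (cochainComplexFunctor _) _ ≪≫
    Functor.isoWhiskerLeft _ (mapCochainComplexIso _) ≪≫ (Functor.associator _ _ _).symm ≪≫
    Functor.isoWhiskerRight (comparisonIso f) _ ≪≫ Functor.associator _ _ _ ≪≫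
    Functor.isoWhiskerLeft _ (mapCochainComplexIso _).symm ≪≫ (Functor.associator _ _ _).symm

/-- The bar resolution consists of objects of the adapted class, so its image under `𝓗om(𝒪_X, -)`
represents the derived functor; `cochainsIso` identifies this image with the Hochschild cochains. -/
theorem nonempty_iso_derivedHom [HasDerivedCategory.{w} (power f 2).Modules] :
    Nonempty (derivedCochains f ≅ derivedHom f) := by
  have hP := isAdapted_sheafHom (diag f 2) (IsDiagCoord f) (fun _ _ _ h => h.1)
    (exists_isDiagCoord)
  obtain ⟨e⟩ := hP.nonempty_iso (Scheme.Modules.pushforward (diag f 2))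
    (barHom f ⋙ cochainComplexFunctor _) (barResolution f) (quasiIso_barResolution_app f)
    (fun M => inferInstanceAs
      (((cochainComplexFunctor (power f 2).Modules).obj ((barHom f).obj M)).IsStrictlyGE 0))
    (fun M => of_cochainComplexFunctor hP fun n => adaptedClass_barHomObj (op (SimplexCategory.mk n)) M)
  exact ⟨Functor.isoWhiskerRight (cochainsIso f) DerivedCategory.Q ≪≫ Functor.associator _ _ _ ≪≫ e⟩

end Main

end ContHochschild

end

theorem theorem0p1 {K : Type u} [CommRing K] [IsNoetherianRing K] {X : Scheme.{u}}
    (f : X ⟶ Spec (.of K)) [Smooth f] [QuasiCompact f] [IsSeparated f]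
    [HasDerivedCategory.{w} (ContHochschild.power f 2).Modules] :
    Nonempty (ContHochschild.derivedCochains f ≅ ContHochschild.derivedHom f) := by
  exact ContHochschild.nonempty_iso_derivedHom f
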